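/- Fix integers $i,j,k,l$ with $0<i<k\le j<l$ and $r:=k-i<c:=l-j$, and a $j$-dimensional subspace $F\subseteq\mathbb C^l$. For $1\le p\le r+1$ put $i_p:=k-p+1$. Let $\mathbb G_d(E)$ denote the Grassmann variety of $d$-dimensional subspaces of a complex vector space $E$, and set $$\Delta_p:=\{V\in\mathbb G_k(\mathbb C^l):\dim (V\cap F)\ge i_p\},\qquad \Delta_p^0:=\Delta_p\setminus\Delta_{p-1}\quad(\Delta_0:=\emptyset),$$ $$\widetilde\Delta_p:=\{(Z,V)\in\mathbb G_{i_p}(F)\times\mathbb G_k(\mathbb C^l): Z\subseteq V\}.$$ For $1\le q<p\le r+1$ let $$\widetilde\Delta_{pq}^0:=\{(W,Z,V): W\subseteq Z\subseteq F\cap V,\ \dim W=i_p,\ \dim Z=i_q,\ V\in\Delta_q^0\},$$ a locally closed subset of $\mathbb G_{i_p}(F)\times\mathbb G_{i_q}(F)\times\mathbb G_k(\mathbb C^l)$. All these sets carry their reduced structure of complex algebraic varieties. Then $\widetilde\Delta_p$ and $\widetilde\Delta_{pq}^0$ are smooth, and $(W,Z,V)\mapsto(W,V)$ identifies $\widetilde\Delta_{pq}^0$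 with a locally closed subvariety of $\widetilde\Delta_p$. Denote by $S_p$, $S_q$, $S_k$ the tautological bundles on $\widetilde\Delta_{pq}^0$ whose fibres at $(W,Z,V)$ are $W$, $Z$, $V$ respectively, and put $\mathcal J_{pq}:=\mathbb C^l/(S_k+F)$, with fibre $\mathbb C^l/(V+F)$. Then the normal bundle $\mathcal N_{pq}=T_{\widetilde\Delta_p}|_{\widetilde\Delta_{pq}^0}/T_{\widetilde\Delta_{pq}^0}$ of $\widetilde\Delta_{pq}^0$ in $\widetilde\Delta_p$ and $\mathrm{Hom}(S_q/S_p,\mathcal J_{pq})$ are algebraic vector bundles on $\widetilde\Delta_{pq}^0$, and there is an isomorphism of algebraic vector bundles $$\mathcal N_{pq}\cong \mathrm{Hom}(S_q/S_p,\ \mathcal J_{pq}).$$ -/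

import Mathlib

open Filter Topology

noncomputable section

namespace GrassmannVariety

/-! ### Subvarieties of products of Grassmannians

Varieties are classical complex varieties: sets of points with the Zariski topology and the
`ℂ`-valued regular functions. -/

/-- The points of a set `S` of tuples `(V a)_{a ∈ ι}` of subspaces of `ℂ^l`. For `S` locally closed in
a product of Grassmannians (all dimensions being allowed), this is a variety, with the
topology and the regular functions defined below. -/
structure Locus {ι : Type} {l : ℕ} (S : Set (ι → Submodule ℂ (Fin l → ℂ))) where
  /-- The tuple of subspaces. -/
  sub : ι → Submodule ℂ (Fin l → ℂ)
  mem : sub ∈ S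

section Variety

variable {ι : Type} {l : ℕ} {S : Set (ι → Submodule ℂ (Fin l → ℂ))}

/-- `x` lies in the standard affine chart of the product of Grassmannians given by the
complements `C`: this chart consists of the tuples with `V a ⊕ C a = ℂ^l` for all `a`. -/
def InChart (C : ι → Submodule ℂ (Fin l → ℂ)) (x : Locus S) : Prop :=
  ∀ a, IsCompl (x.sub a) (C a)

/-- The affine coordinates of a point of the chart `C`: the matrix entries of the projectors of
`ℂ^l` onto `V a` along `C a`. These projectors form an affine subspace of the space of matrices,
which identifies the chart with the affine space `∏ a, Hom(ℂ^l / C a, C a)`. -/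
def chartCoord (C : ι → Submodule ℂ (Fin l → ℂ)) (x : Locus S) (h : InChart C x) :
    ι × Fin l × Fin l → ℂ :=
  fun t => (x.sub t.1).projection (C t.1) (h t.1) (Pi.single t.2.2 1) t.2.1

/-- The part of the chart `C` where the polynomial `Q` in the coordinates does not vanish. -/
def basicOpen (C : ι → Submodule ℂ (Fin l → ℂ)) (Q : MvPolynomial (ι × Fin l × Fin l) ℂ) :
    Set (Locus S) :=
  {x | ∃ h : InChart C x, MvPolynomial.eval (chartCoord C x h) Q ≠ 0}

/-- The Zariski topology. -/
instance zariskiTopology : TopologicalSpace (Locus S) :=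
  TopologicalSpace.generateFrom {U | ∃ C Q, U = basicOpen C Q}

/-- `f` is a regular function near `x`: in every affine chart around `x` it is, on a neighbourhood
of `x`, a quotient of two polynomials in the coordinates, with nonvanishing denominator. The values
of `f` away from `x` do not matter. -/
def IsRegularAt (f : Locus S → ℂ) (x : Locus S) : Prop :=
  ∀ (C : ι → Submodule ℂ (Fin l → ℂ)) (h : InChart C x),
    ∃ P Q : MvPolynomial (ι × Fin l × Fin l) ℂ,
      MvPolynomial.eval (chartCoord C x h) Q ≠ 0 ∧
      ∀ (y : Locus S) (hy : InChart C y), MvPolynomial.eval (chartCoord C y hy) Q ≠ 0 →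
        f y = MvPolynomial.eval (chartCoord C y hy) P / MvPolynomial.eval (chartCoord C y hy) Q

theorem isRegularAt_const (c : ℂ) (x : Locus S) : IsRegularAt (fun _ => c) x :=
  fun _ _ => ⟨MvPolynomial.C c, 1, by simp, by simp⟩

theorem IsRegularAt.add {f g : Locus S → ℂ} {x : Locus S} (hf : IsRegularAt f x)
    (hg : IsRegularAt g x) : IsRegularAt (f + g) x := by
  intro C h
  obtain ⟨P, Q, hQ, hf⟩ := hf C h
  obtain ⟨P', Q', hQ', hg⟩ := hg C h
  refine ⟨P * Q' + P' * Q, Q * Q', by simp [hQ, hQ'], fun y hy hne => ?_⟩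
  rw [map_mul] at hne
  have h1 := left_ne_zero_of_mul hne
  have h2 := right_ne_zero_of_mul hne
  rw [Pi.add_apply, hf y hy h1, hg y hy h2]
  simp only [map_add, map_mul]
  field_simp

theorem IsRegularAt.mul {f g : Locus S → ℂ} {x : Locus S} (hf : IsRegularAt f x)
    (hg : IsRegularAt g x) : IsRegularAt (f * g) x := by
  intro C h
  obtain ⟨P, Q, hQ, hf⟩ := hf C h
  obtain ⟨P', Q', hQ', hg⟩ := hg C h
  refine ⟨P * P', Q * Q', by simp [hQ, hQ'], fun y hy hne => ?_⟩
  rw [map_mul] at hne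
  have h1 := left_ne_zero_of_mul hne
  have h2 := right_ne_zero_of_mul hne
  rw [Pi.mul_apply, hf y hy h1, hg y hy h2]
  simp only [map_mul]
  field_simp

/-- Germs of complex functions form a `ℂ`-algebra. -/
instance germAlgebra {X : Type} (u : Filter X) : Algebra ℂ (Germ u ℂ) :=
  Algebra.ofModule
    (fun _ a b => Germ.inductionOn₂ a b fun _ _ => by
      rw [← Germ.coe_smul, ← Germ.coe_mul, ← Germ.coe_mul, ← Germ.coe_smul, smul_mul_assoc])
    (fun _ a b => Germ.inductionOn₂ a b fun _ _ => by
      rw [← Germ.coe_smul, ← Germ.coe_mul, ← Germ.coe_mul, ← Germ.coe_smul, mul_smul_comm])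

theorem germ_algebraMap {X : Type} (u : Filter X) (c : ℂ) :
    algebraMap ℂ (Germ u ℂ) c = ((fun _ => c : X → ℂ) : Germ u ℂ) := by
  rw [Algebra.algebraMap_eq_smul_one, ← Germ.coe_one, ← Germ.coe_smul]
  congr 1
  funext y
  simp

/-- The local ring `𝒪_x`: the germs at `x`, for the Zariski topology, of functions that are regular
near `x`. -/
def localRing (x : Locus S) : Subalgebra ℂ (Germ (𝓝 x) ℂ) where
  carrier := {g | ∃ f : Locus S → ℂ, IsRegularAt f x ∧ (f : Germ (𝓝 x) ℂ) = g}
  mul_mem' := by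
    rintro _ _ ⟨f, hf, rfl⟩ ⟨g, hg, rfl⟩
    exact ⟨f * g, hf.mul hg, Germ.coe_mul f g⟩
  add_mem' := by
    rintro _ _ ⟨f, hf, rfl⟩ ⟨g, hg, rfl⟩
    exact ⟨f + g, hf.add hg, Germ.coe_add f g⟩
  algebraMap_mem' c := ⟨fun _ => c, isRegularAt_const c x, (germ_algebraMap _ c).symm⟩

/-- The germ at `x` of a function that is regular near `x`. -/
def toGerm (f : Locus S → ℂ) (x : Locus S) (hf : IsRegularAt f x) : localRing x :=
  ⟨(f : Germ (𝓝 x) ℂ), f, hf, rfl⟩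

/-- A variety is smooth if its local rings are regular. -/
def IsSmooth (S : Set (ι → Submodule ℂ (Fin l → ℂ))) : Prop :=
  ∀ x : Locus S, IsRegularLocalRing (localRing x)

/-- The Zariski tangent space `T_x`: the `ℂ`-linear point derivations `𝒪_x → ℂ`. -/
def tangentSpace (x : Locus S) : Submodule ℂ (localRing x →ₗ[ℂ] ℂ) where
  carrier := {D | ∀ a b : localRing x,
    D (a * b) = (a : Germ (𝓝 x) ℂ).value * D b + (b : Germ (𝓝 x) ℂ).value * D a}
  add_mem' := by
    intro D D' h h' a b
    simp only [LinearMap.add_apply, h a b, h' a b]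
    ring
  zero_mem' := by
    intro a b
    simp
  smul_mem' := by
    intro c D h a b
    simp only [LinearMap.smul_apply, h a b, smul_eq_mul]
    ring

end Variety

section Morphism

variable {ι κ : Type} {l m : ℕ} {S : Set (ι → Submodule ℂ (Fin l → ℂ))}
  {T : Set (κ → Submodule ℂ (Fin m → ℂ))}

/-- Morphisms of varieties: continuous maps that pull back regular functions to regular
functions. -/
structure IsMorphism (j : Locus S → Locus T) : Prop where
  continuous : Continuous j
  regular : ∀ (f : Locus T → ℂ) (y : Locus S), IsRegularAt f (j y) → IsRegularAt (f ∘ j) y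

/-- The pull-back `𝒪_{j y} → 𝒪_y` along a morphism `j`. -/
def pullbackGerm {j : Locus S → Locus T} (hj : IsMorphism j) (y : Locus S) :
    localRing (j y) →ₐ[ℂ] localRing y where
  toFun g := ⟨(g : Germ (𝓝 (j y)) ℂ).compTendsto j (hj.continuous.tendsto y), by
    obtain ⟨_, f, hf, rfl⟩ := g
    exact ⟨f ∘ j, hj.regular f y hf, rfl⟩⟩
  map_one' := rfl
  map_zero' := rfl
  map_mul' := by
    rintro ⟨_, f, hf, rfl⟩ ⟨_, g, hg, rfl⟩
    rfl
  map_add' := by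
    rintro ⟨_, f, hf, rfl⟩ ⟨_, g, hg, rfl⟩
    rfl
  commutes' c := by
    apply Subtype.ext
    change ((algebraMap ℂ (Germ (𝓝 (j y)) ℂ) c)).compTendsto j (hj.continuous.tendsto y)
      = algebraMap ℂ (Germ (𝓝 y) ℂ) c
    rw [germ_algebraMap, germ_algebraMap]
    rfl

/-- The pull-back of germs does not change the value at the point. -/
theorem value_pullbackGerm {j : Locus S → Locus T} (hj : IsMorphism j) (y : Locus S)
    (g : localRing (j y)) :
    (pullbackGerm hj y g : Germ (𝓝 y) ℂ).value = (g : Germ (𝓝 (j y)) ℂ).value := by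
  obtain ⟨_, f, hf, rfl⟩ := g
  rfl

/-- The differential `T_y → T_{j y}` of a morphism `j`. -/
def differential {j : Locus S → Locus T} (hj : IsMorphism j) (y : Locus S) :
    tangentSpace y →ₗ[ℂ] tangentSpace (j y) where
  toFun D := ⟨(D : localRing y →ₗ[ℂ] ℂ) ∘ₗ (pullbackGerm hj y).toLinearMap, by
    intro a b
    have h := D.2 (pullbackGerm hj y a) (pullbackGerm hj y b)
    rw [value_pullbackGerm, value_pullbackGerm] at h
    simpa using h⟩
  map_add' _ _ := rfl
  map_smul' _ _ := rfl

/-- `j` is the inclusion of a (locally closed) subvariety: it is an isomorphism of varieties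
onto a locally closed subset of `T`, whose regular functions are locally the restrictions of
regular functions on `T`. -/
structure IsSubvariety (j : Locus S → Locus T) : Prop where
  isMorphism : IsMorphism j
  isEmbedding : IsEmbedding j
  isLocallyClosed : IsLocallyClosed (Set.range j)
  extend : ∀ (f : Locus S → ℂ) (y : Locus S), IsRegularAt f y →
    ∃ g : Locus T → ℂ, IsRegularAt g (j y) ∧ ∀ᶠ z in 𝓝 y, f z = g (j z)

end Morphism

/-! ### Algebraic vector bundles

A vector bundle is given by its fibres and its regular sections. -/

/-- A family of complex vector spaces over a variety, together with a notion of regular section: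
`RegularAt s y` says that the (set-theoretic) section `s` is regular near `y`. -/
structure VectorFamily {ι : Type} {l : ℕ} (S : Set (ι → Submodule ℂ (Fin l → ℂ))) where
  Fib : Locus S → Type
  [addCommGroup : ∀ y, AddCommGroup (Fib y)]
  [module : ∀ y, Module ℂ (Fib y)]
  RegularAt : (∀ y, Fib y) → Locus S → Prop

attribute [instance] VectorFamily.addCommGroup VectorFamily.module

namespace VectorFamily

variable {ι κ : Type} {l m : ℕ} {S : Set (ι → Submodule ℂ (Fin l → ℂ))}
  {T : Set (κ → Submodule ℂ (Fin m → ℂ))}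

/-- Algebraic vector bundles: near every point there is a frame `e` of finitely many
sections such that the regular sections are the linear combinations of `e` with regular functions
as coefficients. -/
def IsVectorBundle (A : VectorFamily S) : Prop :=
  ∀ y₀ : Locus S, ∃ (n : ℕ) (e : Fin n → ∀ y, A.Fib y), ∀ᶠ y in 𝓝 y₀,
    (∃ b : Module.Basis (Fin n) ℂ (A.Fib y), ∀ i, b i = e i y) ∧
    ∀ s : ∀ z, A.Fib z, A.RegularAt s y ↔
      ∃ f : Fin n → Locus S → ℂ, (∀ i, IsRegularAt (f i) y) ∧
        ∀ᶠ z in 𝓝 y, s z = ∑ i, f i z • e i z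

/-- Isomorphisms of vector bundles: linear isomorphisms of the fibres under which the regular
sections correspond to each other. -/
structure Iso (A B : VectorFamily S) where
  equiv : ∀ y, A.Fib y ≃ₗ[ℂ] B.Fib y
  regularAt_iff : ∀ (s : ∀ y, A.Fib y) (y : Locus S),
    A.RegularAt s y ↔ B.RegularAt (fun z => equiv z (s z)) y

/-- The subbundle with fibres `K y` of the trivial bundle with fibre `ℂ^m`. -/
def sub (K : Locus S → Submodule ℂ (Fin m → ℂ)) : VectorFamily S where
  Fib y := K y
  RegularAt s y := ∀ i, IsRegularAt (fun z => (s z : Fin m → ℂ) i) y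

/-- The trivial bundle with fibre `ℂ^m`. -/
def trivial (S : Set (ι → Submodule ℂ (Fin l → ℂ))) (m : ℕ) : VectorFamily S where
  Fib _ := Fin m → ℂ
  RegularAt s y := ∀ i, IsRegularAt (fun z => s z i) y

/-- The quotient `A / K`: its regular sections are those that lift locally to regular sections
of `A`. -/
def quot (A : VectorFamily S) (K : ∀ y, Submodule ℂ (A.Fib y)) : VectorFamily S where
  Fib y := A.Fib y ⧸ K y
  RegularAt s y := ∃ t : ∀ z, A.Fib z, A.RegularAt t y ∧ ∀ᶠ z in 𝓝 y, s z = (K z).mkQ (t z)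

/-- The bundle `Hom(A, B)`: its regular sections are those that map regular sections of `A` to
regular sections of `B`. -/
def hom (A B : VectorFamily S) : VectorFamily S where
  Fib y := A.Fib y →ₗ[ℂ] B.Fib y
  RegularAt φ y := ∀ s : ∀ z, A.Fib z, A.RegularAt s y → B.RegularAt (fun z => φ z (s z)) y

/-- The pull-back `j^* T` of the tangent bundle along a map `j`: its regular sections are the vector
fields along `j` that map regular functions to regular functions. -/
def tangentAlong (j : Locus S → Locus T) : VectorFamily S where
  Fib y := tangentSpace (j y)
  RegularAt v y := ∀ f : Locus T → ℂ, IsRegularAt f (j y) →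
    ∃ g : Locus S → ℂ, IsRegularAt g y ∧ ∀ᶠ z in 𝓝 y, ∃ h : IsRegularAt f (j z),
      (v z : localRing (j z) →ₗ[ℂ] ℂ) (toGerm f (j z) h) = g z

/-- The normal bundle `j^* T_T / T_S` of the (immersive) morphism `j : S → T`. -/
def normalBundle {j : Locus S → Locus T} (hj : IsMorphism j) : VectorFamily S :=
  (tangentAlong j).quot fun y => LinearMap.range (differential hj y)

end VectorFamily

/-! ### The varieties attached to a special Schubert variety -/

variable {l : ℕ}

/-- The special Schubert variety `Δ_p = {V ∈ 𝔾_k(ℂ^l) : dim (V ∩ F) ≥ i_p}`, where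
`i_p = k - p + 1`. -/
def schubert (F : Submodule ℂ (Fin l → ℂ)) (k p : ℕ) : Set (Submodule ℂ (Fin l → ℂ)) :=
  {V | Module.finrank ℂ V = k ∧ k + 1 - p ≤ Module.finrank ℂ ↥(V ⊓ F)}

/-- The stratum `Δ_p^0 = Δ_p \ Δ_{p-1}`. -/
def schubertStratum (F : Submodule ℂ (Fin l → ℂ)) (k p : ℕ) :
    Set (Submodule ℂ (Fin l → ℂ)) :=
  schubert F k p \ schubert F k (p - 1)

/-- `Δ̃_p`: the pairs `x = (Z, V)` in `𝔾_{i_p}(F) × 𝔾_k(ℂ^l)` with `Z ⊆ V`. -/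
def tildeDelta (F : Submodule ℂ (Fin l → ℂ)) (k p : ℕ) :
    Set (Fin 2 → Submodule ℂ (Fin l → ℂ)) :=
  {x | x 0 ≤ F ∧ Module.finrank ℂ (x 0) = k + 1 - p ∧ Module.finrank ℂ (x 1) = k ∧ x 0 ≤ x 1}

/-- `Δ̃_{pq}^0`: the triples `x = (W, Z, V)`, where `W ⊆ Z` is a partial flag in `F` of
dimensions `i_p`, `i_q`, and `V ∈ Δ_q^0` contains `Z`. -/
def tildeDeltaZero (F : Submodule ℂ (Fin l → ℂ)) (k p q : ℕ) :
    Set (Fin 3 → Submodule ℂ (Fin l → ℂ)) :=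
  {x | x 0 ≤ x 1 ∧ x 1 ≤ F ∧ Module.finrank ℂ (x 0) = k + 1 - p ∧
    Module.finrank ℂ (x 1) = k + 1 - q ∧ x 1 ≤ x 2 ∧ x 2 ∈ schubertStratum F k q}

/-- The inclusion `Δ̃_{pq}^0 → Δ̃_p`, `(W, Z, V) ↦ (W, V)`. -/
def incl (F : Submodule ℂ (Fin l → ℂ)) (k p q : ℕ) (y : Locus (tildeDeltaZero F k p q)) :
    Locus (tildeDelta F k p) where
  sub := ![y.sub 0, y.sub 2]
  mem := by
    obtain ⟨h1, h2, h3, -, h5, h6⟩ := y.mem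
    exact ⟨h1.trans h2, h3, h6.1.1, h1.trans h5⟩

/-- The complements for `(W, V)` obtained from complements for `(W, Z, V)`. -/
def forgetMiddle (C : Fin 3 → Submodule ℂ (Fin l → ℂ)) : Fin 2 → Submodule ℂ (Fin l → ℂ) :=
  ![C 0, C 2]

/-- The polynomials in the coordinates of `(W, V)`, as polynomials in those of `(W, Z, V)`. -/
def renameMiddle (P : MvPolynomial (Fin 2 × Fin l × Fin l) ℂ) :
    MvPolynomial (Fin 3 × Fin l × Fin l) ℂ :=
  MvPolynomial.rename (fun t => ((![0, 2] : Fin 2 → Fin 3) t.1, t.2)) P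

theorem inChart_incl {F : Submodule ℂ (Fin l → ℂ)} {k p q : ℕ}
    {C : Fin 3 → Submodule ℂ (Fin l → ℂ)} {y : Locus (tildeDeltaZero F k p q)}
    (h : InChart C y) : InChart (forgetMiddle C) (incl F k p q y) := by
  intro a
  fin_cases a
  · exact h 0
  · exact h 2

theorem eval_renameMiddle {F : Submodule ℂ (Fin l → ℂ)} {k p q : ℕ}
    {C : Fin 3 → Submodule ℂ (Fin l → ℂ)} {y : Locus (tildeDeltaZero F k p q)}
    (h : InChart C y) (P : MvPolynomial (Fin 2 × Fin l × Fin l) ℂ) :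
    MvPolynomial.eval (chartCoord C y h) (renameMiddle P) =
      MvPolynomial.eval (chartCoord (forgetMiddle C) (incl F k p q y) (inChart_incl h)) P := by
  rw [renameMiddle, MvPolynomial.eval_rename]
  congr 2
  funext t
  obtain ⟨a, u, v⟩ := t
  fin_cases a
  · rfl
  · rfl

theorem isMorphism_incl (F : Submodule ℂ (Fin l → ℂ)) (k p q : ℕ) :
    IsMorphism (incl F k p q) where
  continuous := by
    refine continuous_generateFrom_iff.2 ?_
    rintro _ ⟨C, Q, rfl⟩
    rw [isOpen_iff_forall_mem_open]
    rintro y ⟨h, hQ⟩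
    obtain ⟨D, hD⟩ := exists_isCompl (y.sub 1)
    have hC : forgetMiddle ![C 0, D, C 1] = C := by
      funext a
      fin_cases a
      · rfl
      · rfl
    have hy : InChart ![C 0, D, C 1] y := by
      intro a
      fin_cases a
      · exact h 0
      · exact hD
      · exact h 1
    refine ⟨basicOpen ![C 0, D, C 1] (renameMiddle Q), ?_,
      TopologicalSpace.isOpen_generateFrom_of_mem ⟨_, _, rfl⟩, hy, ?_⟩
    · rintro z ⟨hz, hz'⟩
      rw [eval_renameMiddle] at hz'
      have := inChart_incl hz
      rw [Set.mem_preimage, ← hC]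
      exact ⟨this, hz'⟩
    · rw [eval_renameMiddle]
      convert hQ
  regular := by
    intro f y hf C h
    obtain ⟨P, Q, hQ, hf⟩ := hf (forgetMiddle C) (inChart_incl h)
    refine ⟨renameMiddle P, renameMiddle Q, by rwa [eval_renameMiddle], fun z hz hne => ?_⟩
    rw [eval_renameMiddle] at hne ⊢
    rw [eval_renameMiddle]
    exact hf _ _ hne

variable (F : Submodule ℂ (Fin l → ℂ)) (k p q : ℕ)

/-- The normal bundle of `Δ̃_{pq}^0` in `Δ̃_p`. -/
def normalBundlePQ : VectorFamily (tildeDeltaZero F k p q) :=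
  VectorFamily.normalBundle (isMorphism_incl F k p q)

/-- The bundle `S_q / S_p` on `Δ̃_{pq}^0`, with fibre `Z / W` at `(W, Z, V)`. -/
def quotSqSp : VectorFamily (tildeDeltaZero F k p q) :=
  (VectorFamily.sub fun y => y.sub 1).quot fun y => (y.sub 0).comap (y.sub 1).subtype

/-- The bundle `J_{pq} = ℂ^l / (S_k + F)` on `Δ̃_{pq}^0`, with fibre `ℂ^l / (V + F)` at
`(W, Z, V)`. -/
def bundleJ : VectorFamily (tildeDeltaZero F k p q) :=
  (VectorFamily.trivial _ l).quot fun y => y.sub 2 ⊔ F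

end GrassmannVariety

end

/-! Near a point `(W, Z, V)` of the stratum one has `Z = V ∩ F` (`tildeDeltaZero_mid_eq`). Choose a
basis of `ℂ^l` adapted to `W ⊆ V ∩ F`, `F` and `V`; its vectors carry five colours `0`, ..., `4`,
for `W`, `Z / W`, `F / Z`, `V / Z` and `ℂ^l / (V + F)` (`exists_adapted_frame`). The pairs in the
corresponding chart of `tildeDelta` are exactly the translates of the standard pair by `1 + N`,
where the blocks of `N` are those in `pairBlocks`: column `0` moves `W` inside `F`, columns `1` and
`3` move `V`, and nothing else is free because `W ⊆ V`. The entries of `N` are polynomials in the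
entries of the projectors, and conversely, so the cell is an affine space (`IsAdapted.chart`). Its
local rings are localizations of a polynomial ring, whence smoothness.

A pair of this cell comes from the stratum if and only if the block `(4, 1)` of `N` vanishes: this
is the block that pushes vectors of `Z` out of `V + F`. Thus the inclusion is, in these charts, that
of a coordinate subspace (`IsAdaptedTriple.isCoordinateInclusion`). It is therefore the inclusion of
a locally closed subvariety, and the normal bundle is trivialized by the derivatives of the entries
of the block `(4, 1)`, which has the shape of `Hom(Z / W, ℂ^l / (V + F))`.

The isomorphism itself is defined without a basis. A tangent vector `D` at `(W, V)` is sent to the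
derivative along `D` of the projector onto `V`, restricted to `Z` and taken modulo `V + F`. Two
projectors onto `V` have derivatives that agree on `V` modulo `V`, so the complement is irrelevant
(`moveMap_apply_eq`); since `W` stays inside both `V` and `F`, the map kills `W`
(`moveMap_eq_zero`). The decisive computation is `IsAdaptedTriple.cellCoframe_dMat_cellFrame`: in
the moving frame of the cell, the matrix of this map consists of the derivatives of the `(4, 1)`
entries, without correction terms. Hence its kernel is the tangent space of the stratum, and the
induced map is the identity matrix in suitable local trivializations. This gives bijectivity on
fibres and the correspondence of regular sections together. -/

noncomputable section
namespace GrassmannVariety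

/-! ### Projectors and changes of charts -/

section Projector

variable {l : ℕ} {V C : Submodule ℂ (Fin l → ℂ)}

open Classical in
/-- The matrix of the projector onto `V` along `C`, and `0` if `V` and `C` are not complementary. -/
def projMat (V C : Submodule ℂ (Fin l → ℂ)) : Matrix (Fin l) (Fin l) ℂ :=
  if h : IsCompl V C then LinearMap.toMatrix' (V.projection C h) else 0

theorem projMat_mulVec (h : IsCompl V C) (u : Fin l → ℂ) :
    (projMat V C).mulVec u = V.projection C h u := by
  rw [projMat, dif_pos h, ← Matrix.toLin'_apply, Matrix.toLin'_toMatrix']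

theorem projMat_mulVec_mem (h : IsCompl V C) (u : Fin l → ℂ) : (projMat V C).mulVec u ∈ V := by
  rw [projMat_mulVec h]
  exact Submodule.projection_apply_mem _ _

theorem sub_projMat_mulVec_mem (h : IsCompl V C) (u : Fin l → ℂ) :
    u - (projMat V C).mulVec u ∈ C := by
  rw [projMat_mulVec h]
  exact Submodule.sub_projection_mem _ _

theorem projMat_mulVec_of_mem (h : IsCompl V C) {u : Fin l → ℂ} (hu : u ∈ V) :
    (projMat V C).mulVec u = u := by
  rw [projMat_mulVec h, Submodule.projection_apply_of_mem_left _ hu]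

theorem projMat_mulVec_of_mem_right (h : IsCompl V C) {u : Fin l → ℂ} (hu : u ∈ C) :
    (projMat V C).mulVec u = 0 := by
  rw [projMat_mulVec h, Submodule.projection_apply_eq_zero_iff]
  exact hu

theorem projMat_mulVec_eq (h : IsCompl V C) {u v : Fin l → ℂ} (hv : v ∈ V) (huv : u - v ∈ C) :
    (projMat V C).mulVec u = v := by
  have := projMat_mulVec_of_mem_right h huv
  rw [Matrix.mulVec_sub, projMat_mulVec_of_mem h hv, sub_eq_zero] at this
  exact this

theorem projMat_eq (h : IsCompl V C) {M : Matrix (Fin l) (Fin l) ℂ}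
    (h1 : ∀ u, M.mulVec u ∈ V) (h2 : ∀ u, u - M.mulVec u ∈ C) : projMat V C = M := by
  apply Matrix.toLin'.injective
  refine LinearMap.ext fun u => ?_
  rw [Matrix.toLin'_apply, Matrix.toLin'_apply]
  exact projMat_mulVec_eq h (h1 u) (h2 u)

/-- Splitting `u` as `M u + (u - M u)` shows that the sum is everything; the dimensions then force
it to be direct. Idempotence of `M` need not be known beforehand. -/
theorem isCompl_of_matrix {M : Matrix (Fin l) (Fin l) ℂ}
    (h1 : ∀ u, M.mulVec u ∈ V) (h2 : ∀ u, u - M.mulVec u ∈ C)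
    (hd : Module.finrank ℂ V + Module.finrank ℂ C = l) : IsCompl V C := by
  have hsup : V ⊔ C = ⊤ := by
    rw [eq_top_iff]
    intro u _
    rw [Submodule.mem_sup]
    exact ⟨_, h1 u, _, h2 u, by abel⟩
  refine ⟨?_, codisjoint_iff.2 hsup⟩
  have h := Submodule.finrank_sup_add_finrank_inf_eq V C
  rw [hsup, finrank_top, Module.finrank_fin_fun, hd] at h
  rw [disjoint_iff]
  exact Submodule.finrank_eq_zero.1 (by omega)

/-- The matrix whose determinant decides whether `V`, a complement of `C`, is also a
complement of `C'`; here `V₀` is a complement of both. -/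
def transitionMat (E R : Matrix (Fin l) (Fin l) ℂ) : Matrix (Fin l) (Fin l) ℂ :=
  R * E * R + 1 - R

/-- The matrix `A = transitionMat E R` is the identity on `C'` and equals `R E` on `V₀`. It commutes
with `R`, so when it is invertible `R (E A⁻¹ R) = R`. Thus `E A⁻¹ R` has values in `V` and changes
vectors only by elements of `C' = ker R`, which makes it the new projector. -/
theorem transition {V₀ C' : Submodule ℂ (Fin l → ℂ)} (h : IsCompl V C) (h₀ : IsCompl V₀ C)
    (h₀' : IsCompl V₀ C')
    (hdet : (transitionMat (projMat V C) (projMat V₀ C')).det ≠ 0) :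
    IsCompl V C' ∧ projMat V C' = projMat V C *
      (transitionMat (projMat V C) (projMat V₀ C'))⁻¹ * projMat V₀ C' := by
  set E := projMat V C with hE
  set R := projMat V₀ C' with hR
  set A := transitionMat E R with hA
  have hRR : R * R = R := by
    apply Matrix.toLin'.injective
    refine LinearMap.ext fun u => ?_
    rw [Matrix.toLin'_apply, Matrix.toLin'_apply, ← Matrix.mulVec_mulVec]
    exact projMat_mulVec_of_mem h₀' (projMat_mulVec_mem h₀' u)
  have hu : IsUnit A.det := isUnit_iff_ne_zero.2 hdet
  have h3 : R * A = A * R := by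
    rw [hA, transitionMat]
    simp only [mul_sub, mul_add, sub_mul, add_mul, mul_one, one_mul, ← mul_assoc, hRR]
    rw [mul_assoc (R * E), hRR]
  have h3' : R * A = R * E * R := by
    rw [hA, transitionMat]
    simp only [mul_sub, mul_add, mul_one, ← mul_assoc, hRR]
    abel
  have h4 : R * (E * A⁻¹ * R) = R := by
    have h5 : A⁻¹ * R = R * A⁻¹ := by
      calc A⁻¹ * R = A⁻¹ * (R * A) * A⁻¹ := by
            rw [mul_assoc, mul_assoc, Matrix.mul_nonsing_inv _ hu, mul_one]
        _ = R * A⁻¹ := by rw [h3, ← mul_assoc A⁻¹, Matrix.nonsing_inv_mul _ hu, one_mul]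
    calc R * (E * A⁻¹ * R) = R * E * (A⁻¹ * (R * R)) := by rw [hRR]; simp only [mul_assoc]
      _ = R * E * (R * A⁻¹ * R) := by rw [← mul_assoc A⁻¹, h5]
      _ = R * A * A⁻¹ * R := by rw [h3']; simp only [mul_assoc]
      _ = R := by rw [mul_assoc R, Matrix.mul_nonsing_inv _ hu, mul_one, hRR]
  have m1 : ∀ u, (E * A⁻¹ * R).mulVec u ∈ V := fun u => by
    rw [mul_assoc, ← Matrix.mulVec_mulVec]
    exact projMat_mulVec_mem h _
  have m2 : ∀ u, u - (E * A⁻¹ * R).mulVec u ∈ C' := fun u => by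
    have := sub_projMat_mulVec_mem h₀' (u - (E * A⁻¹ * R).mulVec u)
    rwa [Matrix.mulVec_sub, Matrix.mulVec_mulVec, ← hR, h4, sub_self, sub_zero] at this
  -- `V` and `V₀` have the same dimension, being complements of the same `C`.
  have hd : Module.finrank ℂ V + Module.finrank ℂ C' = l := by
    have e1 := Submodule.finrank_add_eq_of_isCompl h
    have e2 := Submodule.finrank_add_eq_of_isCompl h₀
    have e3 := Submodule.finrank_add_eq_of_isCompl h₀'
    rw [Module.finrank_fin_fun] at e1 e2 e3
    omega
  have hc := isCompl_of_matrix m1 m2 hd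
  exact ⟨hc, projMat_eq hc m1 m2⟩

/-- At the base point `V = V₀` the determinant in `transition` is `1`, so its nonvanishing defines a
neighbourhood of that point. -/
theorem transitionMat_self {C' : Submodule ℂ (Fin l → ℂ)} (h : IsCompl V C) (h' : IsCompl V C') :
    transitionMat (projMat V C) (projMat V C') = 1 := by
  have : projMat V C * projMat V C' = projMat V C' := by
    apply Matrix.toLin'.injective
    refine LinearMap.ext fun u => ?_
    rw [Matrix.toLin'_apply, Matrix.toLin'_apply, ← Matrix.mulVec_mulVec]
    exact projMat_mulVec_of_mem h (projMat_mulVec_mem h' u)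
  have hRR : projMat V C' * projMat V C' = projMat V C' := by
    apply Matrix.toLin'.injective
    refine LinearMap.ext fun u => ?_
    rw [Matrix.toLin'_apply, Matrix.toLin'_apply, ← Matrix.mulVec_mulVec]
    exact projMat_mulVec_of_mem h' (projMat_mulVec_mem h' u)
  rw [transitionMat, mul_assoc, this, hRR]
  abel

end Projector

/-! ### Regularity in one chart -/

section Regular

variable {ι : Type} {l : ℕ} {S : Set (ι → Submodule ℂ (Fin l → ℂ))}

/-- The coordinates of the chart `C`, extended by `0`. -/
def coord (C : ι → Submodule ℂ (Fin l → ℂ)) (x : Locus S) : ι × Fin l × Fin l → ℂ :=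
  fun t => projMat (x.sub t.1) (C t.1) t.2.1 t.2.2

theorem chartCoord_eq {C : ι → Submodule ℂ (Fin l → ℂ)} {x : Locus S} (h : InChart C x) :
    chartCoord C x h = coord C x := by
  funext t
  rw [chartCoord, coord, projMat, dif_pos (h t.1), LinearMap.toMatrix'_apply]

theorem mem_basicOpen {C : ι → Submodule ℂ (Fin l → ℂ)} {x : Locus S}
    {Q : MvPolynomial (ι × Fin l × Fin l) ℂ} :
    x ∈ basicOpen C Q ↔ InChart C x ∧ MvPolynomial.eval (coord C x) Q ≠ 0 := by
  constructor
  · rintro ⟨h, hQ⟩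
    exact ⟨h, by rwa [← chartCoord_eq h]⟩
  · rintro ⟨h, hQ⟩
    exact ⟨h, by rwa [chartCoord_eq h]⟩

theorem exists_inChart (x : Locus S) : ∃ C, InChart C x := by
  choose C hC using fun a => exists_isCompl (x.sub a)
  exact ⟨C, hC⟩

/-- The functions that are near `y` quotients of polynomials in the coordinates of the chart `C`. -/
def regIn (C : ι → Submodule ℂ (Fin l → ℂ)) (y : Locus S) : Subalgebra ℂ (Locus S → ℂ) where
  carrier := {f | ∃ P Q : MvPolynomial (ι × Fin l × Fin l) ℂ, MvPolynomial.eval (coord C y) Q ≠ 0 ∧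
    ∀ z, InChart C z → MvPolynomial.eval (coord C z) Q ≠ 0 →
      f z = MvPolynomial.eval (coord C z) P / MvPolynomial.eval (coord C z) Q}
  mul_mem' := by
    rintro f g ⟨P, Q, hQ, hf⟩ ⟨P', Q', hQ', hg⟩
    refine ⟨P * P', Q * Q', by simp [hQ, hQ'], fun z hz hne => ?_⟩
    rw [map_mul] at hne
    rw [Pi.mul_apply, hf z hz (left_ne_zero_of_mul hne), hg z hz (right_ne_zero_of_mul hne)]
    simp only [map_mul]
    rw [div_mul_div_comm]
  add_mem' := by
    rintro f g ⟨P, Q, hQ, hf⟩ ⟨P', Q', hQ', hg⟩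
    refine ⟨P * Q' + Q * P', Q * Q', by simp [hQ, hQ'], fun z hz hne => ?_⟩
    rw [map_mul] at hne
    have h1 := left_ne_zero_of_mul hne
    have h2 := right_ne_zero_of_mul hne
    rw [Pi.add_apply, hf z hz h1, hg z hz h2]
    simp only [map_add, map_mul]
    rw [div_add_div _ _ h1 h2]
  algebraMap_mem' c := ⟨MvPolynomial.C c, 1, by simp, fun z _ _ => by simp⟩

variable {C C' : ι → Submodule ℂ (Fin l → ℂ)} {y : Locus S}

theorem coord_mem_regIn (C : ι → Submodule ℂ (Fin l → ℂ)) (y : Locus S)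
    (t : ι × Fin l × Fin l) : (fun z => coord C z t) ∈ regIn C y :=
  ⟨MvPolynomial.X t, 1, by simp, fun z _ _ => by simp⟩

theorem inv_mem_regIn {f : Locus S → ℂ} (hy : InChart C y) (hf : f ∈ regIn C y) (h : f y ≠ 0) :
    f⁻¹ ∈ regIn C y := by
  obtain ⟨P, Q, hQ, hf⟩ := hf
  have hP : MvPolynomial.eval (coord C y) P ≠ 0 := by
    rw [hf y hy hQ] at h
    exact (div_ne_zero_iff.1 h).1
  -- The fraction `Q / P` is expanded by `Q`: where the new denominator is nonzero, so is `Q`, and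
  -- the formula for `f` may be used.
  refine ⟨Q * Q, P * Q, by simp [hP, hQ], fun z hz hne => ?_⟩
  rw [map_mul] at hne
  have h1 := left_ne_zero_of_mul hne
  have h2 := right_ne_zero_of_mul hne
  rw [Pi.inv_apply, hf z hz h2, map_mul, map_mul, inv_div, mul_div_mul_right _ _ h2]

theorem eval_mem_of_forall {X : Type*} {A : Subalgebra ℂ (X → ℂ)} {τ : Type*} {c : X → τ → ℂ}
    (hc : ∀ t, (fun z => c z t) ∈ A) (P : MvPolynomial τ ℂ) :
    (fun z => MvPolynomial.eval (c z) P) ∈ A := by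
  induction P using MvPolynomial.induction_on with
  | C a =>
    simp only [MvPolynomial.eval_C]
    exact A.algebraMap_mem a
  | add p q hp hq =>
    simp only [map_add]
    exact A.add_mem hp hq
  | mul_X p t hp =>
    simp only [map_mul, MvPolynomial.eval_X]
    exact A.mul_mem hp (hc t)

/-- Expanding a fraction by `R` shrinks the set where it has to represent the function. -/
theorem mem_regIn_of_eqOn {f g : Locus S → ℂ} (hf : f ∈ regIn C y)
    {R : MvPolynomial (ι × Fin l × Fin l) ℂ} (hR : MvPolynomial.eval (coord C y) R ≠ 0)
    (hfg : ∀ z, InChart C z → MvPolynomial.eval (coord C z) R ≠ 0 → g z = f z) :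
    g ∈ regIn C y := by
  obtain ⟨P, Q, hQ, hf⟩ := hf
  refine ⟨P * R, Q * R, by simp [hQ, hR], fun z hz hne => ?_⟩
  rw [map_mul] at hne
  have h1 := left_ne_zero_of_mul hne
  have h2 := right_ne_zero_of_mul hne
  rw [hfg z hz h2, hf z hz h1, map_mul, map_mul, mul_div_mul_right _ _ h2]

/-- Evaluation at a point, as a ring homomorphism on an algebra of functions. -/
def evalAt {X : Type*} (A : Subalgebra ℂ (X → ℂ)) (z : X) : A →+* ℂ :=
  (Pi.evalRingHom (fun _ : X => ℂ) z).comp A.val.toRingHom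

/-- A matrix of functions is one matrix over the commutative ring `A`, specialized at each point.
Determinants, adjugates and products commute with the specialization, so they stay in `A`. -/
theorem exists_matrix_of_forall {X : Type*} {A : Subalgebra ℂ (X → ℂ)}
    {M : X → Matrix (Fin l) (Fin l) ℂ} (hM : ∀ u v, (fun z => M z u v) ∈ A) :
    ∃ M' : Matrix (Fin l) (Fin l) A, ∀ z, M z = (evalAt A z).mapMatrix M' :=
  ⟨fun u v => ⟨_, hM u v⟩, fun _ => rfl⟩

theorem det_mem_of_forall {X : Type*} {A : Subalgebra ℂ (X → ℂ)}
    {M : X → Matrix (Fin l) (Fin l) ℂ} (hM : ∀ u v, (fun z => M z u v) ∈ A) :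
    (fun z => (M z).det) ∈ A := by
  obtain ⟨M', hM'⟩ := exists_matrix_of_forall hM
  convert M'.det.2 using 1
  funext z
  rw [hM', ← RingHom.map_det]
  rfl

theorem adjugate_mem_of_forall {X : Type*} {A : Subalgebra ℂ (X → ℂ)}
    {M : X → Matrix (Fin l) (Fin l) ℂ} (hM : ∀ u v, (fun z => M z u v) ∈ A) (u v : Fin l) :
    (fun z => (M z).adjugate u v) ∈ A := by
  obtain ⟨M', hM'⟩ := exists_matrix_of_forall hM
  convert (M'.adjugate u v).2 using 1
  funext z
  rw [hM', ← RingHom.map_adjugate]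
  rfl

theorem mul_mem_of_forall {X : Type*} {A : Subalgebra ℂ (X → ℂ)}
    {M N : X → Matrix (Fin l) (Fin l) ℂ} (hM : ∀ u v, (fun z => M z u v) ∈ A)
    (hN : ∀ u v, (fun z => N z u v) ∈ A) (u v : Fin l) :
    (fun z => (M z * N z) u v) ∈ A := by
  obtain ⟨M', hM'⟩ := exists_matrix_of_forall hM
  obtain ⟨N', hN'⟩ := exists_matrix_of_forall hN
  convert ((M' * N') u v).2 using 1
  funext z
  rw [hM', hN', ← map_mul]
  rfl

theorem const_mem {X : Type*} (A : Subalgebra ℂ (X → ℂ)) (c : ℂ) : (fun _ => c) ∈ A :=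
  A.algebraMap_mem c

theorem inv_mem_of_forall {M : Locus S → Matrix (Fin l) (Fin l) ℂ} (hy : InChart C y)
    (hM : ∀ u v, (fun z => M z u v) ∈ regIn C y) (hdet : (M y).det ≠ 0) (u v : Fin l) :
    (fun z => (M z)⁻¹ u v) ∈ regIn C y := by
  have := (regIn C y).mul_mem (inv_mem_regIn hy (det_mem_of_forall hM) hdet)
    (adjugate_mem_of_forall hM u v)
  convert this using 1
  funext z
  simp [Matrix.inv_def]

theorem transitionMat_mem (C : ι → Submodule ℂ (Fin l → ℂ)) (y : Locus S) (a : ι)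
    (R : Matrix (Fin l) (Fin l) ℂ) (u v : Fin l) :
    (fun z : Locus S => transitionMat (projMat (z.sub a) (C a)) R u v) ∈ regIn C y := by
  have h1 := mul_mem_of_forall (mul_mem_of_forall (A := regIn C y) (M := fun _ => R)
    (fun u v => const_mem _ _) (fun u v => coord_mem_regIn C y (a, u, v))) (N := fun _ => R)
    (fun u v => const_mem _ _) u v
  exact (regIn C y).sub_mem ((regIn C y).add_mem h1 (const_mem _ ((1 : Matrix _ _ ℂ) u v)))
    (const_mem _ (R u v))

/-- A regular function that does not vanish at `y` does not vanish on a basic open set. -/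
theorem exists_poly_of_ne_zero {f : Locus S → ℂ} (hy : InChart C y) (hf : f ∈ regIn C y)
    (h : f y ≠ 0) : ∃ R : MvPolynomial (ι × Fin l × Fin l) ℂ,
      MvPolynomial.eval (coord C y) R ≠ 0 ∧
      ∀ z, InChart C z → MvPolynomial.eval (coord C z) R ≠ 0 → f z ≠ 0 := by
  obtain ⟨P, Q, hQ, hf⟩ := hf
  have hP : MvPolynomial.eval (coord C y) P ≠ 0 := by
    rw [hf y hy hQ] at h
    exact (div_ne_zero_iff.1 h).1
  refine ⟨P * Q, by simp [hP, hQ], fun z hz hne => ?_⟩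
  rw [map_mul] at hne
  have h1 := left_ne_zero_of_mul hne
  have h2 := right_ne_zero_of_mul hne
  rw [hf z hz h2]
  exact div_ne_zero h1 h2

theorem isOpen_basicOpen (C : ι → Submodule ℂ (Fin l → ℂ))
    (Q : MvPolynomial (ι × Fin l × Fin l) ℂ) : IsOpen (basicOpen C Q : Set (Locus S)) :=
  TopologicalSpace.isOpen_generateFrom_of_mem ⟨_, _, rfl⟩

theorem isOpen_inChart (C : ι → Submodule ℂ (Fin l → ℂ)) :
    IsOpen {x : Locus S | InChart C x} := by
  convert isOpen_basicOpen (S := S) C 1 using 1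
  ext x
  simp [mem_basicOpen]

variable [Fintype ι]

/-- Near a point of both charts `C` and `C'`, the points of the chart `C` lie in the chart `C'`. -/
theorem exists_poly_inChart (h : InChart C y) (h' : InChart C' y) :
    ∃ R : MvPolynomial (ι × Fin l × Fin l) ℂ, MvPolynomial.eval (coord C y) R ≠ 0 ∧
      ∀ z : Locus S, InChart C z → MvPolynomial.eval (coord C z) R ≠ 0 → InChart C' z ∧
        ∀ a, (transitionMat (projMat (z.sub a) (C a)) (projMat (y.sub a) (C' a))).det ≠ 0 := by
  have hmem : (∏ a, fun z : Locus S =>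
      (transitionMat (projMat (z.sub a) (C a)) (projMat (y.sub a) (C' a))).det) ∈ regIn C y :=
    (regIn C y).prod_mem fun a _ => det_mem_of_forall (transitionMat_mem C y a _)
  obtain ⟨R, hR, hz⟩ := exists_poly_of_ne_zero h hmem (by
    rw [Finset.prod_apply]
    refine Finset.prod_ne_zero_iff.2 fun a _ => ?_
    rw [transitionMat_self (h a) (h' a)]
    simp)
  refine ⟨R, hR, fun z hz1 hz2 => ?_⟩
  have := hz z hz1 hz2
  rw [Finset.prod_apply, Finset.prod_ne_zero_iff] at this
  exact ⟨fun a => (transition (hz1 a) (h a) (h' a) (this a (Finset.mem_univ a))).1,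
    fun a => this a (Finset.mem_univ a)⟩

/-- The formula of `transition`, with the fixed reference subspaces `y.sub a`, is rational in the
old coordinates, and its denominator is `1` at `y`. -/
theorem coord_mem_regIn_of_inChart (h : InChart C y) (h' : InChart C' y)
    (t : ι × Fin l × Fin l) : (fun z => coord C' z t) ∈ regIn C y := by
  obtain ⟨a, u, v⟩ := t
  obtain ⟨R, hR, hz⟩ := exists_poly_inChart h h'
  refine mem_regIn_of_eqOn (f := fun z => (projMat (z.sub a) (C a) *
      (transitionMat (projMat (z.sub a) (C a)) (projMat (y.sub a) (C' a)))⁻¹ *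
      projMat (y.sub a) (C' a)) u v) ?_ hR fun z hz1 hz2 => ?_
  · refine mul_mem_of_forall (mul_mem_of_forall (fun u v => coord_mem_regIn C y (a, u, v))
      (inv_mem_of_forall h (transitionMat_mem C y a (projMat (y.sub a) (C' a))) ?_))
      (N := fun _ => projMat (y.sub a) (C' a)) (fun u v => const_mem _ _) u v
    rw [transitionMat_self (h a) (h' a)]
    simp
  · exact congrFun (congrFun (transition (hz1 a) (h a) (h' a) ((hz z hz1 hz2).2 a)).2 u) v

theorem mem_regIn_of_inChart (h : InChart C y) (h' : InChart C' y) {f : Locus S → ℂ}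
    (hf : f ∈ regIn C' y) : f ∈ regIn C y := by
  obtain ⟨P, Q, hQ, hf⟩ := hf
  have hP := eval_mem_of_forall (coord_mem_regIn_of_inChart h h') P
  have hQ' := eval_mem_of_forall (coord_mem_regIn_of_inChart h h') Q
  obtain ⟨R, hR, hz⟩ := exists_poly_inChart h h'
  obtain ⟨R', hR', hz'⟩ := exists_poly_of_ne_zero h hQ' hQ
  refine mem_regIn_of_eqOn ((regIn C y).mul_mem hP (inv_mem_regIn h hQ' hQ)) (R := R * R')
    (by simp [hR, hR']) fun z hz1 hz2 => ?_
  rw [map_mul] at hz2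
  exact hf z (hz z hz1 (left_ne_zero_of_mul hz2)).1 (hz' z hz1 (right_ne_zero_of_mul hz2))

/-- Regularity can be checked in one chart. -/
theorem isRegularAt_iff_mem_regIn (h : InChart C y) {f : Locus S → ℂ} :
    IsRegularAt f y ↔ f ∈ regIn C y := by
  constructor
  · intro hf
    obtain ⟨P, Q, hQ, hf⟩ := hf C h
    refine ⟨P, Q, by rwa [← chartCoord_eq h], fun z hz hne => ?_⟩
    rw [← chartCoord_eq hz] at hne ⊢
    exact hf z hz hne
  · intro hf C' h'
    obtain ⟨P, Q, hQ, hf⟩ := mem_regIn_of_inChart h' h hf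
    refine ⟨P, Q, by rwa [chartCoord_eq h'], fun z hz hne => ?_⟩
    rw [chartCoord_eq hz] at hne ⊢
    exact hf z hz hne

theorem basicOpen_subset_of_mem (h : InChart C y) {Q' : MvPolynomial (ι × Fin l × Fin l) ℂ}
    (hy : y ∈ basicOpen C' Q') : ∃ Q, MvPolynomial.eval (coord C y) Q ≠ 0 ∧
      (basicOpen C Q : Set (Locus S)) ⊆ basicOpen C' Q' := by
  obtain ⟨h', hQ'⟩ := mem_basicOpen.1 hy
  obtain ⟨R, hR, hz⟩ := exists_poly_inChart h h'
  obtain ⟨R', hR', hz'⟩ := exists_poly_of_ne_zero h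
    (eval_mem_of_forall (coord_mem_regIn_of_inChart h h') Q') hQ'
  refine ⟨R * R', by simp [hR, hR'], fun z hz1 => ?_⟩
  obtain ⟨hz1, hz2⟩ := mem_basicOpen.1 hz1
  rw [map_mul] at hz2
  exact mem_basicOpen.2
    ⟨(hz z hz1 (left_ne_zero_of_mul hz2)).1, hz' z hz1 (right_ne_zero_of_mul hz2)⟩

theorem isTopologicalBasis_basicOpen :
    TopologicalSpace.IsTopologicalBasis {U : Set (Locus S) | ∃ C Q, U = basicOpen C Q} where
  exists_subset_inter := by
    rintro _ ⟨C₁, Q₁, rfl⟩ _ ⟨C₂, Q₂, rfl⟩ y ⟨h1, h2⟩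
    obtain ⟨hy, hQ⟩ := mem_basicOpen.1 h1
    obtain ⟨Q, hQ', hs⟩ := basicOpen_subset_of_mem hy h2
    refine ⟨_, ⟨C₁, Q₁ * Q, rfl⟩, mem_basicOpen.2 ⟨hy, by simp [hQ, hQ']⟩, fun z hz => ?_⟩
    obtain ⟨hz1, hz2⟩ := mem_basicOpen.1 hz
    rw [map_mul] at hz2
    exact ⟨mem_basicOpen.2 ⟨hz1, left_ne_zero_of_mul hz2⟩,
      hs (mem_basicOpen.2 ⟨hz1, right_ne_zero_of_mul hz2⟩)⟩
  sUnion_eq := by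
    refine Set.eq_univ_of_forall fun y => ?_
    obtain ⟨C, hC⟩ := exists_inChart y
    exact ⟨_, ⟨C, 1, rfl⟩, mem_basicOpen.2 ⟨hC, by simp⟩⟩
  eq_generateFrom := rfl

/-- The basic open sets of one chart form a neighbourhood basis. -/
theorem mem_nhds_iff_basicOpen (h : InChart C y) {U : Set (Locus S)} :
    U ∈ 𝓝 y ↔ ∃ Q, MvPolynomial.eval (coord C y) Q ≠ 0 ∧ basicOpen C Q ⊆ U := by
  constructor
  · intro hU
    obtain ⟨_, ⟨C', Q', rfl⟩, hy, hs⟩ := isTopologicalBasis_basicOpen.mem_nhds_iff.1 hU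
    obtain ⟨Q, hQ, hs'⟩ := basicOpen_subset_of_mem h hy
    exact ⟨Q, hQ, hs'.trans hs⟩
  · rintro ⟨Q, hQ, hs⟩
    exact mem_of_superset ((isOpen_basicOpen C Q).mem_nhds (mem_basicOpen.2 ⟨h, hQ⟩)) hs

/-- The functions that are regular at `y`. -/
def regularAt (y : Locus S) : Subalgebra ℂ (Locus S → ℂ) where
  carrier := {f | IsRegularAt f y}
  mul_mem' := IsRegularAt.mul
  add_mem' := IsRegularAt.add
  algebraMap_mem' c := isRegularAt_const c y

theorem IsRegularAt.congr {f g : Locus S → ℂ} (hf : IsRegularAt f y) (hfg : g =ᶠ[𝓝 y] f) :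
    IsRegularAt g y := by
  obtain ⟨C, hC⟩ := exists_inChart y
  rw [isRegularAt_iff_mem_regIn hC] at hf ⊢
  obtain ⟨Q, hQ, hs⟩ := (mem_nhds_iff_basicOpen hC).1 hfg
  exact mem_regIn_of_eqOn hf hQ fun z hz1 hz2 => hs (mem_basicOpen.2 ⟨hz1, hz2⟩)

theorem IsRegularAt.eventually {f : Locus S → ℂ} (hf : IsRegularAt f y) :
    ∀ᶠ z in 𝓝 y, IsRegularAt f z := by
  obtain ⟨C, hC⟩ := exists_inChart y
  rw [isRegularAt_iff_mem_regIn hC] at hf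
  obtain ⟨P, Q, hQ, hf⟩ := hf
  refine (mem_nhds_iff_basicOpen hC).2 ⟨Q, hQ, fun z hz => ?_⟩
  obtain ⟨hz1, hz2⟩ := mem_basicOpen.1 hz
  exact (isRegularAt_iff_mem_regIn hz1).2 ⟨P, Q, hz2, hf⟩

theorem IsRegularAt.inv {f : Locus S → ℂ} (hf : IsRegularAt f y) (h : f y ≠ 0) :
    IsRegularAt f⁻¹ y := by
  obtain ⟨C, hC⟩ := exists_inChart y
  rw [isRegularAt_iff_mem_regIn hC] at hf ⊢
  exact inv_mem_regIn hC hf h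

theorem IsRegularAt.eventually_ne {f : Locus S → ℂ} (hf : IsRegularAt f y) (h : f y ≠ 0) :
    ∀ᶠ z in 𝓝 y, f z ≠ 0 := by
  obtain ⟨C, hC⟩ := exists_inChart y
  rw [isRegularAt_iff_mem_regIn hC] at hf
  obtain ⟨R, hR, hz⟩ := exists_poly_of_ne_zero hC hf h
  exact (mem_nhds_iff_basicOpen hC).2 ⟨R, hR, fun z hz' =>
    hz z (mem_basicOpen.1 hz').1 (mem_basicOpen.1 hz').2⟩

theorem isRegularAt_coord (h : InChart C y) (t : ι × Fin l × Fin l) :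
    IsRegularAt (fun z => coord C z t) y :=
  (isRegularAt_iff_mem_regIn h).2 (coord_mem_regIn C y t)

end Regular

/-! ### Varieties that are locally affine spaces -/

/-- A standard chart whose intersection with `S` is an affine space `ℂ^n`, by means of polynomial
maps in both directions. -/
structure AffineChart {ι : Type} {l : ℕ} (S : Set (ι → Submodule ℂ (Fin l → ℂ))) (n : Type) where
  compl : ι → Submodule ℂ (Fin l → ℂ)
  point : (n → ℂ) → Locus S
  param : Locus S → n → ℂ
  inChart : ∀ a, InChart compl (point a)
  coord_poly : ∀ t, ∃ P : MvPolynomial n ℂ, ∀ a,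
    coord compl (point a) t = MvPolynomial.eval a P
  param_poly : ∀ i, ∃ P : MvPolynomial (ι × Fin l × Fin l) ℂ, ∀ y, InChart compl y →
    param y i = MvPolynomial.eval (coord compl y) P
  param_point : ∀ a, param (point a) = a
  point_param : ∀ y, InChart compl y → point (param y) = y

theorem exists_poly_comp {σ τ : Type*} {X : Type*} {f : X → σ → ℂ} {g : X → τ → ℂ} {A : Set X}
    (h : ∀ t, ∃ P : MvPolynomial σ ℂ, ∀ x ∈ A, g x t = MvPolynomial.eval (f x) P)
    (R : MvPolynomial τ ℂ) :
    ∃ P : MvPolynomial σ ℂ, ∀ x ∈ A, MvPolynomial.eval (g x) R = MvPolynomial.eval (f x) P := by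
  choose P hP using h
  refine ⟨MvPolynomial.bind₁ P R, fun x hx => ?_⟩
  have : g x = fun t => MvPolynomial.eval (f x) (P t) := funext fun t => hP t x hx
  rw [this]
  change _ = MvPolynomial.eval₂Hom (RingHom.id ℂ) (f x) _
  rw [MvPolynomial.eval₂Hom_bind₁]
  rfl

theorem localRing_ext {ι : Type} {l : ℕ} {S : Set (ι → Submodule ℂ (Fin l → ℂ))} {y : Locus S}
    {f g : Locus S → ℂ} {hf : IsRegularAt f y} {hg : IsRegularAt g y} (h : f =ᶠ[𝓝 y] g) :
    toGerm f y hf = toGerm g y hg :=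
  Subtype.ext (Germ.coe_eq.2 h)

theorem localRing_eq_toGerm {ι : Type} {l : ℕ} {S : Set (ι → Submodule ℂ (Fin l → ℂ))}
    {y : Locus S} (g : localRing y) : ∃ (f : Locus S → ℂ) (hf : IsRegularAt f y),
      g = toGerm f y hf := by
  obtain ⟨_, f, hf, rfl⟩ := g
  exact ⟨f, hf, rfl⟩

theorem tangent_one {ι : Type} {l : ℕ} {S : Set (ι → Submodule ℂ (Fin l → ℂ))}
    {y : Locus S} (D : tangentSpace y) : (D : localRing y →ₗ[ℂ] ℂ) 1 = 0 := by
  have h := D.2 1 1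
  have h1 : ((1 : localRing y) : Germ (𝓝 y) ℂ).value = 1 := rfl
  rw [mul_one, h1, one_mul] at h
  simpa using h

namespace AffineChart

variable {ι : Type} {l : ℕ} {S : Set (ι → Submodule ℂ (Fin l → ℂ))} {n : Type}
  (κ : AffineChart S n) {y : Locus S}

theorem exists_poly_coord (R : MvPolynomial (ι × Fin l × Fin l) ℂ) :
    ∃ P : MvPolynomial n ℂ, ∀ z, InChart κ.compl z →
      MvPolynomial.eval (coord κ.compl z) R = MvPolynomial.eval (κ.param z) P := by
  refine exists_poly_comp (A := {z | InChart κ.compl z}) (fun t => ?_) R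
  obtain ⟨P, hP⟩ := κ.coord_poly t
  refine ⟨P, fun z hz => ?_⟩
  rw [← hP, κ.point_param z hz]

theorem exists_poly_param (R : MvPolynomial n ℂ) :
    ∃ P : MvPolynomial (ι × Fin l × Fin l) ℂ, ∀ z, InChart κ.compl z →
      MvPolynomial.eval (κ.param z) R = MvPolynomial.eval (coord κ.compl z) P :=
  exists_poly_comp (A := {z | InChart κ.compl z}) κ.param_poly R

variable [Fintype ι]

theorem isRegularAt_iff (hy : InChart κ.compl y) {f : Locus S → ℂ} :
    IsRegularAt f y ↔ ∃ P Q : MvPolynomial n ℂ, MvPolynomial.eval (κ.param y) Q ≠ 0 ∧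
      ∀ z, InChart κ.compl z → MvPolynomial.eval (κ.param z) Q ≠ 0 →
        f z = MvPolynomial.eval (κ.param z) P / MvPolynomial.eval (κ.param z) Q := by
  rw [isRegularAt_iff_mem_regIn hy]
  constructor
  · rintro ⟨P, Q, hQ, hf⟩
    obtain ⟨P', hP'⟩ := κ.exists_poly_coord P
    obtain ⟨Q', hQ'⟩ := κ.exists_poly_coord Q
    refine ⟨P', Q', by rwa [← hQ' y hy], fun z hz hne => ?_⟩
    rw [← hQ' z hz] at hne ⊢
    rw [← hP' z hz]
    exact hf z hz hne
  · rintro ⟨P, Q, hQ, hf⟩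
    obtain ⟨P', hP'⟩ := κ.exists_poly_param P
    obtain ⟨Q', hQ'⟩ := κ.exists_poly_param Q
    refine ⟨P', Q', by rwa [← hQ' y hy], fun z hz hne => ?_⟩
    rw [← hQ' z hz] at hne ⊢
    rw [← hP' z hz]
    exact hf z hz hne

theorem mem_nhds_iff (hy : InChart κ.compl y) {U : Set (Locus S)} :
    U ∈ 𝓝 y ↔ ∃ Q : MvPolynomial n ℂ, MvPolynomial.eval (κ.param y) Q ≠ 0 ∧
      ∀ z, InChart κ.compl z → MvPolynomial.eval (κ.param z) Q ≠ 0 → z ∈ U := by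
  rw [mem_nhds_iff_basicOpen hy]
  constructor
  · rintro ⟨Q, hQ, hs⟩
    obtain ⟨Q', hQ'⟩ := κ.exists_poly_coord Q
    refine ⟨Q', by rwa [← hQ' y hy], fun z hz hne => hs (mem_basicOpen.2 ⟨hz, ?_⟩)⟩
    rwa [hQ' z hz]
  · rintro ⟨Q, hQ, hs⟩
    obtain ⟨Q', hQ'⟩ := κ.exists_poly_param Q
    refine ⟨Q', by rwa [← hQ' y hy], fun z hz => ?_⟩
    obtain ⟨hz1, hz2⟩ := mem_basicOpen.1 hz
    exact hs z hz1 (by rwa [hQ' z hz1])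

theorem isRegularAt_eval (hy : InChart κ.compl y) (P : MvPolynomial n ℂ) :
    IsRegularAt (fun z => MvPolynomial.eval (κ.param z) P) y :=
  (κ.isRegularAt_iff hy).2 ⟨P, 1, by simp, by simp⟩

theorem isRegularAt_param (hy : InChart κ.compl y) (i : n) :
    IsRegularAt (fun z => κ.param z i) y := by
  simpa using κ.isRegularAt_eval hy (MvPolynomial.X i)

/-- The polynomials in the parameters, as germs at `y`. -/
def polyGerm (hy : InChart κ.compl y) : MvPolynomial n ℂ →ₐ[ℂ] localRing y :=
  MvPolynomial.aeval fun i => toGerm _ y (κ.isRegularAt_param hy i)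

theorem polyGerm_apply (hy : InChart κ.compl y) (P : MvPolynomial n ℂ) :
    κ.polyGerm hy P = toGerm _ y (κ.isRegularAt_eval hy P) := by
  induction P using MvPolynomial.induction_on with
  | C a =>
    rw [polyGerm, MvPolynomial.algHom_C]
    apply Subtype.ext
    simp only [toGerm, MvPolynomial.eval_C]
    exact germ_algebraMap _ a
  | add p q hp hq =>
    rw [map_add, hp, hq]
    apply Subtype.ext
    simp only [toGerm, map_add]
    rfl
  | mul_X p i hp =>
    rw [map_mul, hp, polyGerm, MvPolynomial.aeval_X]
    apply Subtype.ext
    simp only [toGerm, map_mul, MvPolynomial.eval_X]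
    rfl

theorem exists_mul_polyGerm (hy : InChart κ.compl y) (g : localRing y) :
    ∃ P Q : MvPolynomial n ℂ, MvPolynomial.eval (κ.param y) Q ≠ 0 ∧
      g * κ.polyGerm hy Q = κ.polyGerm hy P := by
  obtain ⟨f, hf, rfl⟩ := localRing_eq_toGerm g
  obtain ⟨P, Q, hQ, h⟩ := (κ.isRegularAt_iff hy).1 hf
  refine ⟨P, Q, hQ, ?_⟩
  rw [polyGerm_apply, polyGerm_apply]
  refine localRing_ext (hf := hf.mul (κ.isRegularAt_eval hy Q)) ?_
  refine (κ.mem_nhds_iff hy).2 ⟨Q, hQ, fun z hz hne => ?_⟩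
  change f z * _ = _
  rw [h z hz hne, div_mul_cancel₀ _ hne]

/-- The local rings of an affine space are regular. -/
theorem isRegularLocalRing [Finite n] (hy : InChart κ.compl y) :
    IsRegularLocalRing (localRing y) := by
  let 𝔪 : Ideal (MvPolynomial n ℂ) := RingHom.ker (MvPolynomial.eval (κ.param y))
  have : 𝔪.IsPrime := RingHom.ker_isPrime _
  let : Algebra (MvPolynomial n ℂ) (localRing y) := (κ.polyGerm hy).toRingHom.toAlgebra
  have halg : ∀ P, algebraMap (MvPolynomial n ℂ) (localRing y) P = κ.polyGerm hy P := fun _ => rfl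
  -- The three conditions say that polynomials not vanishing at the point become units, that every
  -- germ is a fraction, and that polynomials with equal germs agree after multiplication by some
  -- such polynomial.
  have : IsLocalization 𝔪.primeCompl (localRing y) := by
    rw [isLocalization_iff]
    refine ⟨?_, fun g => ?_, fun {P P'} h => ?_⟩
    · rintro ⟨Q, hQ⟩
      have hQ' : MvPolynomial.eval (κ.param y) Q ≠ 0 := hQ
      have hreg := κ.isRegularAt_eval hy Q
      rw [halg, polyGerm_apply, isUnit_iff_exists_inv]
      refine ⟨toGerm _ y (hreg.inv hQ'), ?_⟩
      refine localRing_ext (hf := hreg.mul (hreg.inv hQ')) (hg := isRegularAt_const 1 y) ?_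
      filter_upwards [hreg.eventually_ne hQ'] with z hz
      exact mul_inv_cancel₀ hz
    · obtain ⟨P, Q, hQ, h⟩ := κ.exists_mul_polyGerm hy g
      exact ⟨(P, ⟨Q, hQ⟩), h⟩
    · rw [halg, halg, polyGerm_apply, polyGerm_apply] at h
      have h' := Germ.coe_eq.1 (Subtype.ext_iff.1 h)
      obtain ⟨Q, hQ, hz⟩ := (κ.mem_nhds_iff hy).1 h'
      -- Every `a` is the parameter of a point of the cell. Hence `P` and `P'` agree wherever `Q`
      -- does not vanish, so `Q P = Q P'` as functions on the whole affine space, and therefore as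
      -- polynomials.
      refine ⟨⟨Q, hQ⟩, MvPolynomial.funext fun a => ?_⟩
      have : MvPolynomial.eval (κ.param (κ.point a)) Q ≠ 0 →
          MvPolynomial.eval (κ.param (κ.point a)) P = MvPolynomial.eval (κ.param (κ.point a)) P' :=
        hz (κ.point a) (κ.inChart a)
      rw [κ.param_point] at this
      simp only [map_mul]
      by_cases h0 : MvPolynomial.eval a Q = 0
      · rw [h0, zero_mul, zero_mul]
      · rw [this h0]
  exact IsRegularLocalRing.of_ringEquiv
    (IsLocalization.algEquiv 𝔪.primeCompl (Localization.AtPrime 𝔪) (localRing y)).toRingEquiv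

/-! #### Tangent spaces -/

theorem hasDerivAt_eval [Fintype n] (a v : n → ℂ) (P : MvPolynomial n ℂ) :
    HasDerivAt (fun s : ℂ => MvPolynomial.eval (a + s • v) P)
      (∑ i, v i * MvPolynomial.eval a (MvPolynomial.pderiv i P)) 0 := by
  classical
  induction P using MvPolynomial.induction_on with
  | C c => simpa using hasDerivAt_const (0 : ℂ) c
  | add p q hp hq =>
    have e : (fun s : ℂ => MvPolynomial.eval (a + s • v) (p + q)) =
        fun s => MvPolynomial.eval (a + s • v) p + MvPolynomial.eval (a + s • v) q :=
      funext fun s => map_add _ _ _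
    rw [e]
    refine (hp.add hq).congr_deriv ?_
    simp only [map_add, mul_add, Finset.sum_add_distrib]
  | mul_X p i hp =>
    have h1 : HasDerivAt (fun s : ℂ => (a + s • v) i) (v i) 0 := by
      simpa using ((hasDerivAt_id (0 : ℂ)).mul_const (v i)).const_add (a i)
    have e : (fun s : ℂ => MvPolynomial.eval (a + s • v) (p * MvPolynomial.X i)) =
        fun s => MvPolynomial.eval (a + s • v) p * (a + s • v) i :=
      funext fun s => by rw [map_mul, MvPolynomial.eval_X]
    rw [e]
    refine (hp.mul h1).congr_deriv ?_
    simp only [Derivation.leibniz, MvPolynomial.pderiv_X, smul_eq_mul, map_add, map_mul,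
      MvPolynomial.eval_X, mul_add, Finset.sum_add_distrib, zero_smul, add_zero]
    rw [add_comm, Finset.sum_mul]
    congr 1
    · rw [Finset.sum_eq_single i]
      · simp [mul_comm]
      · intro j _ hj
        simp [Pi.single_eq_of_ne hj.symm]
      · simp
    · exact Finset.sum_congr rfl fun j _ => by ring

/-- The line through `y` in direction `v`, in the parameters. -/
def line (y : Locus S) (v : n → ℂ) (s : ℂ) : Locus S := κ.point (κ.param y + s • v)

theorem tendsto_line (hy : InChart κ.compl y) (v : n → ℂ) [Fintype n] :
    Tendsto (κ.line y v) (𝓝 0) (𝓝 y) := by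
  intro U hU
  obtain ⟨Q, hQ, hs⟩ := (κ.mem_nhds_iff hy).1 hU
  have hc := (hasDerivAt_eval (κ.param y) v Q).continuousAt
  have := hc.eventually_ne (by simpa using hQ)
  rw [mem_map]
  filter_upwards [this] with s hne
  exact hs _ (κ.inChart _) (by rwa [line, κ.param_point])

theorem differentiableAt_line (hy : InChart κ.compl y) (v : n → ℂ) [Fintype n] {f : Locus S → ℂ}
    (hf : IsRegularAt f y) : DifferentiableAt ℂ (f ∘ κ.line y v) 0 := by
  obtain ⟨P, Q, hQ, h⟩ := (κ.isRegularAt_iff hy).1 hf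
  have hP' := hasDerivAt_eval (κ.param y) v P
  have hQ' := hasDerivAt_eval (κ.param y) v Q
  have hne : MvPolynomial.eval (κ.param y + (0 : ℂ) • v) Q ≠ 0 := by simpa using hQ
  refine (hP'.div hQ' hne).differentiableAt.congr_of_eventuallyEq ?_
  filter_upwards [hQ'.continuousAt.eventually_ne hne] with s hs
  have := h (κ.line y v s) (κ.inChart _) (by rwa [line, κ.param_point])
  rwa [line, κ.param_point] at this

/-- The derivative of a germ of functions on `ℂ`. -/
def derivGerm (g : Germ (𝓝 (0 : ℂ)) ℂ) : ℂ :=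
  g.liftOn (fun f => deriv f 0) fun _ _ h => h.deriv_eq

/-- The derivation of `𝒪_y` in direction `v`. -/
def dirDeriv [Fintype n] (hy : InChart κ.compl y) (v : n → ℂ) : tangentSpace y :=
  ⟨{ toFun := fun g => derivGerm ((g : Germ (𝓝 y) ℂ).compTendsto _ (κ.tendsto_line hy v))
     map_add' := by
      rintro ⟨_, f, hf, rfl⟩ ⟨_, g, hg, rfl⟩
      exact deriv_add (κ.differentiableAt_line hy v hf) (κ.differentiableAt_line hy v hg)
     map_smul' := by
      rintro c ⟨_, f, hf, rfl⟩
      exact deriv_const_smul c (κ.differentiableAt_line hy v hf) }, by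
    rintro ⟨_, f, hf, rfl⟩ ⟨_, g, hg, rfl⟩
    have h := deriv_mul (κ.differentiableAt_line hy v hf) (κ.differentiableAt_line hy v hg)
    have h0 : κ.line y v 0 = y := by
      rw [line, zero_smul, add_zero, κ.point_param y hy]
    refine Eq.trans h ?_
    change _ * (g (κ.line y v 0)) + f (κ.line y v 0) * _ = f y * _ + g y * _
    rw [h0, add_comm, mul_comm _ (g y)]
    rfl⟩

theorem dirDeriv_param [Fintype n] (hy : InChart κ.compl y) (v : n → ℂ) (i : n) :
    (κ.dirDeriv hy v : localRing y →ₗ[ℂ] ℂ) (toGerm _ y (κ.isRegularAt_param hy i)) = v i := by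
  change deriv (fun s => κ.param (κ.line y v s) i) 0 = v i
  have : (fun s => κ.param (κ.line y v s) i) = fun s => κ.param y i + s * v i := by
    funext s
    rw [line, κ.param_point]
    rfl
  rw [this]
  simp

theorem tangent_polyGerm [Fintype n] (hy : InChart κ.compl y) (D : tangentSpace y)
    (P : MvPolynomial n ℂ) : (D : localRing y →ₗ[ℂ] ℂ) (κ.polyGerm hy P) =
      ∑ i, (D : localRing y →ₗ[ℂ] ℂ) (toGerm _ y (κ.isRegularAt_param hy i)) *
        MvPolynomial.eval (κ.param y) (MvPolynomial.pderiv i P) := by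
  classical
  induction P using MvPolynomial.induction_on with
  | C c =>
    rw [MvPolynomial.algHom_C, Algebra.algebraMap_eq_smul_one, map_smul, tangent_one]
    simp
  | add p q hp hq =>
    simp only [map_add, mul_add, Finset.sum_add_distrib, hp, hq]
  | mul_X p i hp =>
    have h1 : κ.polyGerm hy (MvPolynomial.X i) = toGerm _ y (κ.isRegularAt_param hy i) := by
      rw [polyGerm, MvPolynomial.aeval_X]
    have h2 : (κ.polyGerm hy p : Germ (𝓝 y) ℂ).value = MvPolynomial.eval (κ.param y) p := by
      rw [polyGerm_apply]
      rfl
    have h3 : (toGerm _ y (κ.isRegularAt_param hy i) : Germ (𝓝 y) ℂ).value = κ.param y i := rfl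
    rw [map_mul, D.2, hp, h1, h2, h3]
    simp only [Derivation.leibniz, MvPolynomial.pderiv_X, smul_eq_mul, map_add, map_mul,
      MvPolynomial.eval_X, mul_add, Finset.sum_add_distrib]
    congr 1
    · rw [Finset.sum_eq_single i]
      · simp [mul_comm]
      · intro j _ hj
        simp [Pi.single_eq_of_ne hj.symm]
      · simp
    · rw [Finset.mul_sum]
      exact Finset.sum_congr rfl fun j _ => by ring

/-- The derivative of a quotient of polynomials in the parameters. -/
theorem tangent_eq [Fintype n] (hy : InChart κ.compl y) (D : tangentSpace y) {f : Locus S → ℂ}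
    (hf : IsRegularAt f y) {P Q : MvPolynomial n ℂ} (hQ : MvPolynomial.eval (κ.param y) Q ≠ 0)
    (h : ∀ z, InChart κ.compl z → MvPolynomial.eval (κ.param z) Q ≠ 0 →
      f z = MvPolynomial.eval (κ.param z) P / MvPolynomial.eval (κ.param z) Q) :
    (D : localRing y →ₗ[ℂ] ℂ) (toGerm f y hf) =
      ∑ i, (D : localRing y →ₗ[ℂ] ℂ) (toGerm _ y (κ.isRegularAt_param hy i)) *
        (MvPolynomial.eval (κ.param y)
          (MvPolynomial.pderiv i P * Q - P * MvPolynomial.pderiv i Q) /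
          MvPolynomial.eval (κ.param y) (Q * Q)) := by
  -- The quotient rule results from applying the Leibniz rule to `f Q = P` and solving for the
  -- derivative of `f`.
  have h1 : toGerm f y hf * κ.polyGerm hy Q = κ.polyGerm hy P := by
    rw [polyGerm_apply, polyGerm_apply]
    refine localRing_ext (hf := hf.mul (κ.isRegularAt_eval hy Q)) ?_
    refine (κ.mem_nhds_iff hy).2 ⟨Q, hQ, fun z hz hne => ?_⟩
    change f z * _ = _
    rw [h z hz hne, div_mul_cancel₀ _ hne]
  have h2 : (κ.polyGerm hy Q : Germ (𝓝 y) ℂ).value = MvPolynomial.eval (κ.param y) Q := by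
    rw [polyGerm_apply]
    rfl
  have h3 : (toGerm f y hf : Germ (𝓝 y) ℂ).value = f y := rfl
  have h4 := D.2 (toGerm f y hf) (κ.polyGerm hy Q)
  rw [h1, h2, h3, tangent_polyGerm, tangent_polyGerm, h y hy hQ, ← sub_eq_iff_eq_add',
    mul_comm (MvPolynomial.eval (κ.param y) Q)] at h4
  rw [← mul_left_inj' hQ, ← h4, Finset.mul_sum, Finset.sum_mul, ← Finset.sum_sub_distrib]
  refine Finset.sum_congr rfl fun i _ => ?_
  simp only [map_mul, map_sub]
  field_simp

/-- The tangent space at a point of the chart: a tangent vector is given by the derivatives of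
the parameters. -/
def tangentEquiv [Fintype n] (hy : InChart κ.compl y) : tangentSpace y ≃ₗ[ℂ] (n → ℂ) :=
  LinearEquiv.ofBijective
    ({ toFun := fun D i => (D : localRing y →ₗ[ℂ] ℂ) (toGerm _ y (κ.isRegularAt_param hy i))
       map_add' := fun _ _ => rfl
       map_smul' := fun _ _ => rfl } : tangentSpace y →ₗ[ℂ] (n → ℂ)) (by
    constructor
    · rw [← LinearMap.ker_eq_bot, LinearMap.ker_eq_bot']
      intro D hD
      refine Subtype.ext (LinearMap.ext fun g => ?_)
      obtain ⟨f, hf, rfl⟩ := localRing_eq_toGerm g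
      obtain ⟨P, Q, hQ, h⟩ := (κ.isRegularAt_iff hy).1 hf
      rw [κ.tangent_eq hy D hf hQ h]
      refine Finset.sum_eq_zero fun i _ => ?_
      have : (D : localRing y →ₗ[ℂ] ℂ) (toGerm _ y (κ.isRegularAt_param hy i)) = 0 :=
        congrFun hD i
      rw [this, zero_mul]
    · exact fun v => ⟨κ.dirDeriv hy v, funext fun i => κ.dirDeriv_param hy v i⟩)

end AffineChart

/-! ### Inclusions of coordinate subspaces -/

/-- In the charts `κ` and `κ'`, the map `j` is the inclusion of a coordinate subspace: the
parameters `σ i` of `κ'` restrict to the parameters of `κ`, and the other ones, `τ i`, vanish. -/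
structure IsCoordinateInclusion {ι ι' : Type} {l l' : ℕ}
    {S : Set (ι → Submodule ℂ (Fin l → ℂ))} {T : Set (ι' → Submodule ℂ (Fin l' → ℂ))}
    {n m r : Type} (j : Locus S → Locus T) (κ : AffineChart S n) (κ' : AffineChart T m)
    (σ : n → m) (τ : r → m) : Prop where
  mem_range : ∀ i, i ∈ Set.range σ ∨ i ∈ Set.range τ
  inChart_iff : ∀ z, InChart κ'.compl (j z) ↔ InChart κ.compl z
  param_left : ∀ z, InChart κ.compl z → ∀ i, κ'.param (j z) (σ i) = κ.param z i
  param_right : ∀ z, InChart κ.compl z → ∀ i, κ'.param (j z) (τ i) = 0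

section CoordinateInclusion

variable {ι ι' : Type} {l l' : ℕ}
    {S : Set (ι → Submodule ℂ (Fin l → ℂ))} {T : Set (ι' → Submodule ℂ (Fin l' → ℂ))}
    {n m r : Type} {j : Locus S → Locus T} {κ : AffineChart S n} {κ' : AffineChart T m}
    {σ : n → m} {τ : r → m}

theorem IsCoordinateInclusion.eval_rename (h : IsCoordinateInclusion j κ κ' σ τ) {z : Locus S}
    (hz : InChart κ.compl z) (P : MvPolynomial n ℂ) :
    MvPolynomial.eval (κ'.param (j z)) (MvPolynomial.rename σ P) =
      MvPolynomial.eval (κ.param z) P := by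
  rw [MvPolynomial.eval_rename]
  congr 2
  exact funext fun i => h.param_left z hz i

/-- The preimage is the point of `S` whose parameters are the `σ`-parameters of `w`: its image has
the same parameters as `w`, and parameters determine a point of the cell. -/
theorem IsCoordinateInclusion.mem_range_of_param (h : IsCoordinateInclusion j κ κ' σ τ)
    {w : Locus T} (hw : InChart κ'.compl w) (hw0 : ∀ i, κ'.param w (τ i) = 0) :
    w ∈ Set.range j := by
  have hz := κ.inChart (κ'.param w ∘ σ)
  have hjz := (h.inChart_iff _).2 hz
  refine ⟨κ.point (κ'.param w ∘ σ), ?_⟩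
  refine (κ'.point_param _ hjz).symm.trans (Eq.trans ?_ (κ'.point_param w hw))
  congr 1
  funext i
  rcases h.mem_range i with ⟨i, rfl⟩ | ⟨i, rfl⟩
  · rw [h.param_left _ hz, κ.param_point]
    rfl
  · rw [h.param_right _ hz, hw0]

variable [Fintype ι] [Fintype ι']

/-- Numerator and denominator extend by reading them as polynomials in the `σ`-parameters,
independent of the others. -/
theorem IsCoordinateInclusion.exists_extension (h : IsCoordinateInclusion j κ κ' σ τ)
    {y : Locus S} (hy : InChart κ.compl y) {f : Locus S → ℂ} (hf : IsRegularAt f y) :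
    ∃ g : Locus T → ℂ, IsRegularAt g (j y) ∧ ∀ᶠ z in 𝓝 y, f z = g (j z) := by
  obtain ⟨P, Q, hQ, hf⟩ := (κ.isRegularAt_iff hy).1 hf
  refine ⟨fun w => MvPolynomial.eval (κ'.param w) (MvPolynomial.rename σ P) /
    MvPolynomial.eval (κ'.param w) (MvPolynomial.rename σ Q), ?_, ?_⟩
  · refine (κ'.isRegularAt_iff ((h.inChart_iff y).2 hy)).2
      ⟨MvPolynomial.rename σ P, MvPolynomial.rename σ Q, ?_, fun _ _ _ => rfl⟩
    rwa [h.eval_rename hy]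
  · refine (κ.mem_nhds_iff hy).2 ⟨Q, hQ, fun z hz hne => ?_⟩
    change f z = MvPolynomial.eval (κ'.param (j z)) (MvPolynomial.rename σ P) /
      MvPolynomial.eval (κ'.param (j z)) (MvPolynomial.rename σ Q)
    rw [h.eval_rename hz, h.eval_rename hz]
    exact hf z hz hne

theorem IsCoordinateInclusion.comap_nhds (h : IsCoordinateInclusion j κ κ' σ τ)
    {y : Locus S} (hy : InChart κ.compl y) : comap j (𝓝 (j y)) ≤ 𝓝 y := by
  intro U hU
  obtain ⟨Q, hQ, hs⟩ := (κ.mem_nhds_iff hy).1 hU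
  have hy' := (h.inChart_iff y).2 hy
  refine ⟨{w | InChart κ'.compl w ∧ MvPolynomial.eval (κ'.param w) (MvPolynomial.rename σ Q) ≠ 0},
    (κ'.mem_nhds_iff hy').2
    ⟨MvPolynomial.rename σ Q, by rwa [h.eval_rename hy], fun w hw hne => ⟨hw, hne⟩⟩, ?_⟩
  rintro z ⟨hz, hne⟩
  rw [h.inChart_iff] at hz
  rw [h.eval_rename hz] at hne
  exact hs z hz hne

/-- A morphism that is locally the inclusion of a coordinate subspace is the inclusion of a
subvariety. -/
theorem isSubvariety_of_isCoordinateInclusion (hj : IsMorphism j)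
    (h : ∀ y : Locus S, ∃ (n m r : Type) (κ : AffineChart S n) (κ' : AffineChart T m) (σ : n → m)
      (τ : r → m), InChart κ.compl y ∧ IsCoordinateInclusion j κ κ' σ τ) : IsSubvariety j where
  isMorphism := hj
  isEmbedding := by
    refine ⟨isInducing_iff_nhds.2 fun y => le_antisymm ?_ ?_, fun y z hyz => ?_⟩
    · exact (hj.continuous.tendsto y).le_comap
    · obtain ⟨n, m, r, κ, κ', σ, τ, hy, h⟩ := h y
      exact h.comap_nhds hy
    · obtain ⟨n, m, r, κ, κ', σ, τ, hy, h⟩ := h y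
      have hz : InChart κ.compl z := by
        rw [← h.inChart_iff, ← hyz, h.inChart_iff]
        exact hy
      rw [← κ.point_param y hy, ← κ.point_param z hz]
      congr 1
      funext i
      rw [← h.param_left y hy, ← h.param_left z hz, hyz]
  isLocallyClosed := by
    -- It suffices that each point of the range has a neighbourhood in which the range is closed;
    -- the chart serves as this neighbourhood.
    refine ((isLocallyClosed_tfae _).out 0 2).2 ?_
    rintro _ ⟨y, rfl⟩
    obtain ⟨n, m, r, κ, κ', σ, τ, hy, h⟩ := h y
    refine ⟨_, (isOpen_inChart κ'.compl).mem_nhds ((h.inChart_iff y).2 hy), ?_⟩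
    rw [← isOpen_compl_iff, isOpen_iff_mem_nhds]
    rintro ⟨w, hw⟩ hwr
    -- A point of the chart outside the range has a nonzero `τ`-parameter. It remains nonzero
    -- nearby, whereas it vanishes on the range.
    have : ∃ i, κ'.param w (τ i) ≠ 0 := by
      by_contra! h0
      exact hwr (h.mem_range_of_param hw h0)
    obtain ⟨i, hi⟩ := this
    have hev := (κ'.isRegularAt_param hw (τ i)).eventually_ne hi
    have := (continuous_subtype_val.tendsto
      (⟨w, hw⟩ : {x : Locus T | InChart κ'.compl x})).eventually hev
    filter_upwards [this] with v hv hvr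
    obtain ⟨z, hz⟩ := hvr
    have hzc : InChart κ.compl z := (h.inChart_iff z).1 (by rw [hz]; exact v.2)
    refine hv ?_
    rw [← hz]
    exact h.param_right z hzc i
  extend := by
    intro f y hf
    obtain ⟨n, m, r, κ, κ', σ, τ, hy, h⟩ := h y
    exact h.exists_extension hy hf

end CoordinateInclusion

/-! ### Linear algebra -/

section LinearAlgebra

variable {M N I I' : Type} [AddCommGroup M] [Module ℂ M] [AddCommGroup N] [Module ℂ N]

open Classical in
/-- The linear map on `M / K` induced by `c`, or `0` if there is none. -/
def quotCoord (K : Submodule ℂ M) (c : M →ₗ[ℂ] N) : (M ⧸ K) →ₗ[ℂ] N :=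
  if h : K ≤ LinearMap.ker c then K.liftQ c h else 0

theorem quotCoord_mkQ {K : Submodule ℂ M} {c : M →ₗ[ℂ] N} (h : K ≤ LinearMap.ker c) (v : M) :
    quotCoord K c (K.mkQ v) = c v := by
  rw [quotCoord, dif_pos h, Submodule.mkQ_apply, Submodule.liftQ_apply]

theorem quotCoord_injective {K : Submodule ℂ M} {c : M →ₗ[ℂ] N} (h : K = LinearMap.ker c) :
    Function.Injective (quotCoord K c) := by
  rw [← LinearMap.ker_eq_bot, LinearMap.ker_eq_bot']
  intro v hv
  obtain ⟨v, rfl⟩ := K.mkQ_surjective v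
  rw [quotCoord_mkQ h.le] at hv
  rw [Submodule.mkQ_apply, Submodule.Quotient.mk_eq_zero, h]
  exact hv

/-- The matrix of a linear map. -/
def homCoord (e : I → M) (c : N →ₗ[ℂ] (I' → ℂ)) : (M →ₗ[ℂ] N) →ₗ[ℂ] (I' × I → ℂ) where
  toFun φ i := c (φ (e i.2)) i.1
  map_add' φ ψ := funext fun i => by
    rw [LinearMap.add_apply, map_add]
    rfl
  map_smul' a φ := funext fun i => by
    rw [LinearMap.smul_apply, map_smul]
    rfl

theorem homCoord_bijective [Fintype I] [DecidableEq I] {e : I → M} {c : N →ₗ[ℂ] (I' → ℂ)}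
    (hc : Function.Bijective c) (d : M ≃ₗ[ℂ] (I → ℂ)) (he : ∀ i, d (e i) = Pi.single i 1) :
    Function.Bijective (homCoord e c) := by
  constructor
  · rw [← LinearMap.ker_eq_bot, LinearMap.ker_eq_bot']
    intro φ hφ
    refine (Module.Basis.ofEquivFun d).ext fun i => hc.1 (funext fun i' => ?_)
    have hb : Module.Basis.ofEquivFun d i = e i := by
      rw [Module.Basis.coe_ofEquivFun, ← LinearEquiv.symm_apply_apply d (e i), he]
    rw [hb, LinearMap.zero_apply, map_zero]
    exact congrFun hφ (i', i)
  · intro A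
    refine ⟨((LinearEquiv.ofBijective c hc).symm.toLinearMap.comp
      (Matrix.mulVecLin (Matrix.of fun i' i => A (i', i)))).comp d.toLinearMap,
      funext fun i => ?_⟩
    change LinearEquiv.ofBijective c hc ((LinearEquiv.ofBijective c hc).symm
      (Matrix.mulVecLin _ (d (e i.2)))) i.1 = A i
    rw [LinearEquiv.apply_symm_apply, he]
    simp

end LinearAlgebra

namespace VectorFamily

/-! ### Trivializations of vector bundles -/

section Trivialization

variable {ι : Type} {l : ℕ} {S : Set (ι → Submodule ℂ (Fin l → ℂ))}

/-- A trivialization over `U`: linear coordinates on the fibres such that the regular sections are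
those with regular coordinates. -/
structure Trivialization (A : VectorFamily S) (U : Set (Locus S)) (I : Type) where
  coord : ∀ y, A.Fib y →ₗ[ℂ] (I → ℂ)
  bijective : ∀ y ∈ U, Function.Bijective (coord y)
  regularAt_iff : ∀ y ∈ U, ∀ s : ∀ z, A.Fib z,
    A.RegularAt s y ↔ ∀ i, IsRegularAt (fun z => coord z (s z) i) y

namespace Trivialization

variable {A B : VectorFamily S} {U : Set (Locus S)} {I I' : Type}

/-- The coordinates at a point of `U`, as an equivalence. -/
def equiv (t : Trivialization A U I) {y : Locus S} (hy : y ∈ U) : A.Fib y ≃ₗ[ℂ] (I → ℂ) :=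
  LinearEquiv.ofBijective (t.coord y) (t.bijective y hy)

theorem equiv_apply (t : Trivialization A U I) {y : Locus S} (hy : y ∈ U) (v : A.Fib y) :
    t.equiv hy v = t.coord y v := rfl

open Classical in
/-- The section with given coordinates on `U`. -/
def ofCoord (t : Trivialization A U I) (f : Locus S → I → ℂ) (y : Locus S) : A.Fib y :=
  if hy : y ∈ U then (t.equiv hy).symm (f y) else 0

theorem coord_ofCoord (t : Trivialization A U I) (f : Locus S → I → ℂ) {y : Locus S} (hy : y ∈ U) :
    t.coord y (t.ofCoord f y) = f y := by
  rw [ofCoord, dif_pos hy, ← t.equiv_apply hy, LinearEquiv.apply_symm_apply]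

variable [Fintype ι]

theorem regularAt_ofCoord (t : Trivialization A U I) (hU : IsOpen U) {f : Locus S → I → ℂ}
    {y : Locus S} (hy : y ∈ U) (hf : ∀ i, IsRegularAt (fun z => f z i) y) :
    A.RegularAt (t.ofCoord f) y := by
  rw [t.regularAt_iff y hy]
  intro i
  refine (hf i).congr ?_
  filter_upwards [hU.mem_nhds hy] with z hz
  rw [t.coord_ofCoord f hz]

end Trivialization

variable [Fintype ι]

theorem isVectorBundle_of_trivialization {A : VectorFamily S}
    (h : ∀ y₀, ∃ (U : Set (Locus S)) (I : Type), IsOpen U ∧ y₀ ∈ U ∧ Finite I ∧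
      Nonempty (Trivialization A U I)) : A.IsVectorBundle := by
  classical
  intro y₀
  obtain ⟨U, I, hU, hy₀, hI, ⟨t⟩⟩ := h y₀
  obtain ⟨N, ⟨φ⟩⟩ := Finite.exists_equiv_fin I
  let t' : ∀ y ∈ U, A.Fib y ≃ₗ[ℂ] (Fin N → ℂ) := fun y hy =>
    (t.equiv hy).trans (LinearEquiv.funCongrLeft ℂ ℂ φ.symm)
  have ht' : ∀ y hy v i, t' y hy v i = t.coord y v (φ.symm i) := fun _ _ _ _ => rfl
  refine ⟨N, fun i y => if hy : y ∈ U then (t' y hy).symm (Pi.single i 1) else 0, ?_⟩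
  filter_upwards [hU.mem_nhds hy₀] with y hy
  refine ⟨⟨Module.Basis.ofEquivFun (t' y hy), fun i => ?_⟩, fun s => ?_⟩
  · rw [Module.Basis.coe_ofEquivFun, dif_pos hy]
  -- The frame is dual to the coordinate functions, so the coefficients of a section can only be its
  -- coordinates.
  · have key : ∀ (f : Fin N → Locus S → ℂ) (z : Locus S), z ∈ U →
        ((s z = ∑ i, f i z • (if hz : z ∈ U then (t' z hz).symm (Pi.single i 1) else 0)) ↔
          ∀ i, t.coord z (s z) (φ.symm i) = f i z) := by
      intro f z hz
      simp only [dif_pos hz]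
      rw [← (t' z hz).injective.eq_iff, funext_iff]
      refine forall_congr' fun i => ?_
      have e : t' z hz (∑ i, f i z • (t' z hz).symm (Pi.single i 1)) i = f i z := by
        rw [map_sum]
        simp only [map_smul, LinearEquiv.apply_symm_apply]
        simp [Pi.single_apply]
      rw [e, ht']
    rw [t.regularAt_iff y hy]
    constructor
    · intro hs
      refine ⟨fun i z => t.coord z (s z) (φ.symm i), fun i => hs _, ?_⟩
      filter_upwards [hU.mem_nhds hy] with z hz
      exact (key (fun i z => t.coord z (s z) (φ.symm i)) z hz).2 fun i => rfl
    · rintro ⟨f, hf, hs⟩ i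
      refine (hf (φ i)).congr ?_
      filter_upwards [hU.mem_nhds hy, hs] with z hz hsz
      have := (key f z hz).1 hsz (φ i)
      rwa [φ.symm_apply_apply] at this

/-- A fibrewise isomorphism is an isomorphism if it preserves the coordinates of suitable
trivializations. -/
def isoOfTrivialization {A B : VectorFamily S} (e : ∀ y, A.Fib y ≃ₗ[ℂ] B.Fib y)
    (h : ∀ y₀, ∃ (U : Set (Locus S)) (I : Type) (t : Trivialization A U I)
      (t' : Trivialization B U I), IsOpen U ∧ y₀ ∈ U ∧
      ∀ y ∈ U, ∀ v, t'.coord y (e y v) = t.coord y v) : Iso A B where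
  equiv := e
  regularAt_iff := by
    intro s y
    obtain ⟨U, I, t, t', hU, hy, h⟩ := h y
    rw [t.regularAt_iff y hy, t'.regularAt_iff y hy]
    refine forall_congr' fun i => ⟨fun hs => hs.congr ?_, fun hs => hs.congr ?_⟩
    · filter_upwards [hU.mem_nhds hy] with z hz
      rw [h z hz]
    · filter_upwards [hU.mem_nhds hy] with z hz
      rw [h z hz]

variable {A B : VectorFamily S} {U : Set (Locus S)} {I I' : Type}

/-- The trivialization of a quotient, if the subbundle is given by the vanishing of some of the
coordinates. -/
def Trivialization.quot (t : Trivialization A U I) (hU : IsOpen U)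
    {K : ∀ y, Submodule ℂ (A.Fib y)} {τ : I' → I} (hτ : Function.Injective τ)
    (hK : ∀ y ∈ U, K y = LinearMap.ker ((LinearMap.funLeft ℂ ℂ τ).comp (t.coord y))) :
    Trivialization (A.quot K) U I' where
  coord y := quotCoord (K y) ((LinearMap.funLeft ℂ ℂ τ).comp (t.coord y))
  bijective y hy := ⟨quotCoord_injective (hK y hy), fun f => by
    refine ⟨(K y).mkQ (t.ofCoord (fun _ => Function.extend τ f 0) y),
      (quotCoord_mkQ (hK y hy).le _).trans (funext fun i => ?_)⟩
    change t.coord y _ (τ i) = f i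
    rw [t.coord_ofCoord _ hy, hτ.extend_apply]⟩
  regularAt_iff y hy s := by
    constructor
    · rintro ⟨u, hu, hsu⟩ i
      refine ((t.regularAt_iff y hy u).1 hu (τ i)).congr ?_
      filter_upwards [hsu, hU.mem_nhds hy] with z hz hzU
      exact (congrArg (fun v : A.Fib z ⧸ K z => quotCoord (K z)
        ((LinearMap.funLeft ℂ ℂ τ).comp (t.coord z)) v i) hz).trans
        (congrFun (quotCoord_mkQ (hK z hzU).le (u z)) i)
    · intro hs
      let f : Locus S → I' → ℂ := fun z =>
        quotCoord (K z) ((LinearMap.funLeft ℂ ℂ τ).comp (t.coord z)) (s z)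
      -- The lift has the prescribed `τ`-coordinates, and all its other coordinates are `0`.
      refine ⟨t.ofCoord fun z => Function.extend τ (f z) 0,
        t.regularAt_ofCoord hU hy fun i => ?_, ?_⟩
      · by_cases hi : ∃ i', τ i' = i
        · obtain ⟨i', rfl⟩ := hi
          simp only [hτ.extend_apply]
          exact hs i'
        · simp only [Function.extend_apply' _ _ _ hi]
          exact isRegularAt_const 0 y
      · filter_upwards [hU.mem_nhds hy] with z hz
        refine quotCoord_injective (hK z hz) ?_
        refine Eq.trans (funext fun i => ?_) (quotCoord_mkQ (hK z hz).le _).symm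
        change f z i = t.coord z _ (τ i)
        rw [t.coord_ofCoord _ hz, hτ.extend_apply]

theorem Trivialization.quot_coord_mkQ (t : Trivialization A U I) (hU : IsOpen U)
    {K : ∀ y, Submodule ℂ (A.Fib y)} {τ : I' → I} (hτ : Function.Injective τ)
    (hK : ∀ y ∈ U, K y = LinearMap.ker ((LinearMap.funLeft ℂ ℂ τ).comp (t.coord y)))
    {y : Locus S} (hy : y ∈ U) (v : A.Fib y) (i : I') :
    (t.quot hU hτ hK).coord y ((K y).mkQ v) i = t.coord y v (τ i) :=
  congrFun (quotCoord_mkQ (hK y hy).le v) i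

/-- The trivialization of `Hom(A, B)` by matrices. -/
def Trivialization.hom [Fintype I] [DecidableEq I] (t : Trivialization A U I)
    (t' : Trivialization B U I')
    (hU : IsOpen U) : Trivialization (A.hom B) U (I' × I) where
  coord y := homCoord (fun i => t.ofCoord (fun _ => Pi.single i 1) y) (t'.coord y)
  bijective y hy := homCoord_bijective (t'.bijective y hy) (t.equiv hy) fun i => by
    rw [t.equiv_apply, t.coord_ofCoord _ hy]
  regularAt_iff y hy φ := by
    constructor
    · intro h i
      have h1 := h _ (t.regularAt_ofCoord hU (f := fun _ => Pi.single i.2 1) hy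
        fun _ => isRegularAt_const _ y)
      exact (t'.regularAt_iff y hy _).1 h1 i.1
    · intro h s hs
      rw [t'.regularAt_iff y hy]
      rw [t.regularAt_iff y hy] at hs
      intro i'
      let ψ : ∀ z, A.Fib z →ₗ[ℂ] B.Fib z := φ
      have : IsRegularAt (∑ i, (fun z => t.coord z (s z) i) * fun z =>
          t'.coord z (ψ z (t.ofCoord (fun _ => Pi.single i 1) z)) i') y :=
        (regularAt y).sum_mem fun i _ => (regularAt y).mul_mem (hs i) (h (i', i))
      refine this.congr ?_
      filter_upwards [hU.mem_nhds hy] with z hz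
      have e : s z = ∑ i, t.coord z (s z) i • t.ofCoord (fun _ => Pi.single i 1) z := by
        apply (t.bijective z hz).1
        rw [map_sum]
        simp only [map_smul, t.coord_ofCoord _ hz]
        funext i
        simp [Pi.single_apply]
      change t'.coord z (ψ z (s z)) i' = _
      conv_lhs => rw [e]
      simp [Finset.sum_apply]

/-- The trivialization of a subbundle of `ℂ^m` given by the vanishing of some of the
coordinates `H y v`. -/
def Trivialization.sub {m : ℕ} {K : Locus S → Submodule ℂ (Fin m → ℂ)}
    {G H : Locus S → Matrix (Fin m) (Fin m) ℂ} {τ : I → Fin m} (hU : IsOpen U)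
    (hτ : Function.Injective τ) (hGH : ∀ y ∈ U, G y * H y = 1)
    (hG : ∀ y ∈ U, ∀ a b, IsRegularAt (fun z => G z a b) y)
    (hH : ∀ y ∈ U, ∀ a b, IsRegularAt (fun z => H z a b) y)
    (hK : ∀ y ∈ U, ∀ v, v ∈ K y ↔ ∀ i ∉ Set.range τ, (H y).mulVec v i = 0) :
    Trivialization (VectorFamily.sub K) U I where
  coord y := (LinearMap.funLeft ℂ ℂ τ).comp ((H y).mulVecLin.comp (K y).subtype)
  bijective y hy := by
    have hHG : H y * G y = 1 := mul_eq_one_comm.1 (hGH y hy)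
    constructor
    · rw [← LinearMap.ker_eq_bot, LinearMap.ker_eq_bot']
      rintro ⟨v, hv⟩ h0
      have : (H y).mulVec v = 0 := by
        funext i
        by_cases hi : i ∈ Set.range τ
        · obtain ⟨i, rfl⟩ := hi
          exact congrFun h0 i
        · exact (hK y hy v).1 hv i hi
      apply Subtype.ext
      change v = 0
      rw [← Matrix.one_mulVec v, ← hGH y hy, ← Matrix.mulVec_mulVec, this, Matrix.mulVec_zero]
    · intro f
      have hv : (H y).mulVec ((G y).mulVec (Function.extend τ f 0)) = Function.extend τ f 0 := by
        rw [Matrix.mulVec_mulVec, hHG, Matrix.one_mulVec]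
      refine ⟨⟨(G y).mulVec (Function.extend τ f 0), (hK y hy _).2 fun i hi => ?_⟩, ?_⟩
      · rw [hv, Function.extend_apply' _ _ _ hi]
        rfl
      · funext i
        change (H y).mulVec ((G y).mulVec (Function.extend τ f 0)) (τ i) = f i
        rw [hv, hτ.extend_apply]
  regularAt_iff y hy s := by
    let s' : ∀ z, K z := s
    have mul : ∀ {M : Locus S → Matrix (Fin m) (Fin m) ℂ} {f : Locus S → Fin m → ℂ},
        (∀ a b, IsRegularAt (fun z => M z a b) y) → (∀ a, IsRegularAt (fun z => f z a) y) →
        ∀ a, IsRegularAt (fun z => (M z).mulVec (f z) a) y := by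
      intro M f hM hf a
      have : (fun z => (M z).mulVec (f z) a) =
          ∑ b, (fun z => M z a b) * fun z => f z b := by
        funext z
        simp [Matrix.mulVec, dotProduct, Finset.sum_apply]
      rw [this]
      exact (regularAt y).sum_mem fun b _ => (regularAt y).mul_mem (hM a b) (hf b)
    constructor
    · exact fun hs i => mul (hH y hy) hs (τ i)
    · intro hs
      have h1 : ∀ a, IsRegularAt (fun z => (H z).mulVec (s' z : Fin m → ℂ) a) y := by
        intro a
        by_cases ha : a ∈ Set.range τ
        · obtain ⟨i, rfl⟩ := ha
          exact hs i
        · refine (isRegularAt_const 0 y).congr ?_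
          filter_upwards [hU.mem_nhds hy] with z hz
          exact (hK z hz _).1 (s' z).2 a ha
      intro a
      refine (mul (hG y hy) h1 a).congr ?_
      filter_upwards [hU.mem_nhds hy] with z hz
      rw [Matrix.mulVec_mulVec, hGH z hz, Matrix.one_mulVec]

/-- The trivialization of `ℂ^m` by the columns of a matrix function `G`, with inverse `H`. -/
def Trivialization.trivial {m : ℕ} {G H : Locus S → Matrix (Fin m) (Fin m) ℂ} (hU : IsOpen U)
    (hGH : ∀ y ∈ U, G y * H y = 1)
    (hG : ∀ y ∈ U, ∀ a b, IsRegularAt (fun z => G z a b) y)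
    (hH : ∀ y ∈ U, ∀ a b, IsRegularAt (fun z => H z a b) y) :
    Trivialization (VectorFamily.trivial S m) U (Fin m) :=
  -- The trivial bundle is treated as the subbundle with fibre `⊤`, on which no coordinate is
  -- required to vanish.
  let t : Trivialization (VectorFamily.sub fun _ : Locus S => (⊤ : Submodule ℂ (Fin m → ℂ))) U
      (Fin m) := Trivialization.sub (τ := id) hU Function.injective_id hGH hG hH
    (fun _ _ _ => by simp)
  { coord := fun y => (H y).mulVecLin
    bijective := fun y hy => by
      refine ⟨fun v w h => ?_, fun f => ?_⟩
      · have := (t.bijective y hy).1 (a₁ := ⟨v, Submodule.mem_top⟩) (a₂ := ⟨w, Submodule.mem_top⟩) h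
        exact congrArg Subtype.val this
      · obtain ⟨v, hv⟩ := (t.bijective y hy).2 f
        exact ⟨v.1, hv⟩
    regularAt_iff := fun y hy s => t.regularAt_iff y hy fun z => ⟨s z, Submodule.mem_top⟩ }

end Trivialization

/-! ### The normal bundle of a coordinate subspace -/

section Normal

variable {ι ι' : Type} [Fintype ι] [Fintype ι'] {l l' : ℕ}
    {S : Set (ι → Submodule ℂ (Fin l → ℂ))} {T : Set (ι' → Submodule ℂ (Fin l' → ℂ))}
    {n m r : Type} [Fintype n] [Fintype m] {j : Locus S → Locus T} {κ : AffineChart S n}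
    {κ' : AffineChart T m} {σ : n → m} {τ : r → m}

open Classical in
/-- The derivatives of the parameters, on the whole tangent bundle (`0` outside of the chart). -/
def tangentCoord (κ' : AffineChart T m) (x : Locus T) : tangentSpace x →ₗ[ℂ] (m → ℂ) :=
  if h : InChart κ'.compl x then (κ'.tangentEquiv h).toLinearMap else 0

theorem tangentCoord_apply (κ' : AffineChart T m) {x : Locus T} (h : InChart κ'.compl x)
    (D : tangentSpace x) (i : m) : tangentCoord κ' x D i =
      (D : localRing x →ₗ[ℂ] ℂ) (toGerm _ x (κ'.isRegularAt_param h i)) := by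
  rw [tangentCoord, dif_pos h]
  rfl

theorem tangentCoord_bijective (κ' : AffineChart T m) {x : Locus T} (h : InChart κ'.compl x) :
    Function.Bijective (tangentCoord κ' x) := by
  rw [tangentCoord, dif_pos h]
  exact (κ'.tangentEquiv h).bijective

/-- The restriction of the tangent bundle to a subvariety, trivialized by the derivatives of the
parameters. -/
def tangentTrivialization (hj : IsMorphism j) (κ' : AffineChart T m) :
    Trivialization (tangentAlong j) {y | InChart κ'.compl (j y)} m where
  coord y := tangentCoord κ' (j y)
  bijective y hy := tangentCoord_bijective κ' hy
  regularAt_iff y hy v := by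
    have hy' : InChart κ'.compl (j y) := hy
    let v' : ∀ z, tangentSpace (j z) := v
    have hU : ∀ᶠ z in 𝓝 y, InChart κ'.compl (j z) :=
      hj.continuous.continuousAt.eventually ((isOpen_inChart κ'.compl).mem_nhds hy')
    constructor
    · intro hv i
      obtain ⟨g, hg, hvg⟩ := hv _ (κ'.isRegularAt_param hy' i)
      refine hg.congr ?_
      filter_upwards [hvg, hU] with z hz hzU
      obtain ⟨h, hz⟩ := hz
      exact (tangentCoord_apply κ' hzU (v' z) i).trans hz
    · intro hv f hf
      obtain ⟨P, Q, hQ, hPQ⟩ := (κ'.isRegularAt_iff hy').1 hf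
      -- These are the coefficients of the quotient rule `AffineChart.tangent_eq`. They are regular
      -- on `T`, hence regular after pull-back along `j`.
      have hreg : ∀ i, IsRegularAt (fun z => MvPolynomial.eval (κ'.param (j z))
          (MvPolynomial.pderiv i P * Q - P * MvPolynomial.pderiv i Q) /
          MvPolynomial.eval (κ'.param (j z)) (Q * Q)) y := by
        intro i
        refine hj.regular (fun w => MvPolynomial.eval (κ'.param w)
          (MvPolynomial.pderiv i P * Q - P * MvPolynomial.pderiv i Q) /
          MvPolynomial.eval (κ'.param w) (Q * Q)) y ?_
        exact (κ'.isRegularAt_iff hy').2 ⟨_, Q * Q, by simp [hQ], fun _ _ _ => rfl⟩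
      refine ⟨_, (regularAt y).sum_mem (t := Finset.univ) fun i _ =>
        (regularAt y).mul_mem (hv i) (hreg i), ?_⟩
      have hf' := hj.continuous.continuousAt.eventually hf.eventually
      have hQ' := hj.continuous.continuousAt.eventually
        ((κ'.isRegularAt_eval hy' Q).eventually_ne hQ)
      filter_upwards [hU, hf', hQ'] with z hzU hzf hzQ
      refine ⟨hzf, ?_⟩
      refine (κ'.tangent_eq hzU (v' z) hzf hzQ hPQ).trans ?_
      rw [Finset.sum_apply]
      refine Finset.sum_congr rfl fun i _ => ?_
      rw [← tangentCoord_apply κ' hzU (v' z) i]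
      rfl

/-- Pulled back along `j`, the `σ`-parameters become the parameters of `κ` and the `τ`-parameters
become `0`. So in coordinates the differential is itself the inclusion of a coordinate subspace. -/
theorem mem_range_differential (h : IsCoordinateInclusion j κ κ' σ τ) (hj : IsMorphism j)
    {y : Locus S} (hy : InChart κ'.compl (j y)) (D : tangentSpace (j y)) :
    D ∈ LinearMap.range (differential hj y) ↔ ∀ i, tangentCoord κ' (j y) D (τ i) = 0 := by
  have hy' := (h.inChart_iff y).1 hy
  have hU : ∀ᶠ z in 𝓝 y, InChart κ.compl z := (isOpen_inChart κ.compl).mem_nhds hy'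
  have left : ∀ (D : tangentSpace y) i, tangentCoord κ' (j y) (differential hj y D) (σ i) =
      κ.tangentEquiv hy' D i := by
    intro D i
    rw [tangentCoord_apply κ' hy]
    refine congrArg (D : localRing y →ₗ[ℂ] ℂ) (localRing_ext
      (hf := hj.regular _ y (κ'.isRegularAt_param hy (σ i))) ?_)
    filter_upwards [hU] with z hz
    exact h.param_left z hz i
  have right : ∀ (D : tangentSpace y) i,
      tangentCoord κ' (j y) (differential hj y D) (τ i) = 0 := by
    intro D i
    rw [tangentCoord_apply κ' hy, ← map_zero (D : localRing y →ₗ[ℂ] ℂ)]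
    refine congrArg (D : localRing y →ₗ[ℂ] ℂ) (localRing_ext
      (hf := hj.regular _ y (κ'.isRegularAt_param hy (τ i))) (hg := isRegularAt_const 0 y) ?_)
    filter_upwards [hU] with z hz
    exact h.param_right z hz i
  constructor
  · rintro ⟨D, rfl⟩ i
    exact right D i
  · intro h0
    refine ⟨(κ.tangentEquiv hy').symm (tangentCoord κ' (j y) D ∘ σ),
      (tangentCoord_bijective κ' hy).1 (funext fun i => ?_)⟩
    rcases h.mem_range i with ⟨i, rfl⟩ | ⟨i, rfl⟩
    · rw [left, LinearEquiv.apply_symm_apply]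
      rfl
    · rw [right, h0]

theorem range_differential_eq_ker (h : IsCoordinateInclusion j κ κ' σ τ) (hj : IsMorphism j)
    {y : Locus S} (hy : InChart κ'.compl (j y)) : LinearMap.range (differential hj y) =
      LinearMap.ker ((LinearMap.funLeft ℂ ℂ τ).comp (tangentCoord κ' (j y))) := by
  ext D
  rw [mem_range_differential h hj hy, LinearMap.mem_ker, funext_iff]
  rfl

/-- The normal bundle, trivialized by the derivatives of the parameters that vanish on the
subvariety. -/
def normalTrivialization (h : IsCoordinateInclusion j κ κ' σ τ) (hτ : Function.Injective τ)
    (hj : IsMorphism j) :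
    Trivialization (normalBundle hj) {y | InChart κ'.compl (j y)} r :=
  (tangentTrivialization hj κ').quot ((isOpen_inChart _).preimage hj.continuous) hτ
    fun _ hy => range_differential_eq_ker h hj hy

theorem normalTrivialization_coord (h : IsCoordinateInclusion j κ κ' σ τ)
    (hτ : Function.Injective τ) (hj : IsMorphism j) {y : Locus S} (hy : InChart κ'.compl (j y))
    (D : tangentSpace (j y)) (i : r) : (normalTrivialization h hτ hj).coord y
      ((LinearMap.range (differential hj y)).mkQ D) i = tangentCoord κ' (j y) D (τ i) :=
  Trivialization.quot_coord_mkQ (tangentTrivialization hj κ')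
    ((isOpen_inChart _).preimage hj.continuous) hτ (fun _ hy => range_differential_eq_ker h hj hy) hy D i

end Normal

end VectorFamily

/-! ### Coordinate subspaces -/

section FrameSub

variable {l : ℕ} {c : Fin l → Fin 5} {G H : Matrix (Fin l) (Fin l) ℂ}
  {A B : Finset (Fin 5)}

/-- The indices of `ℂ^l` being coloured by `c`, the subspace spanned by the columns of `H⁻¹` with
colour in `A`. -/
def frameSub (c : Fin l → Fin 5) (H : Matrix (Fin l) (Fin l) ℂ) (A : Finset (Fin 5)) :
    Submodule ℂ (Fin l → ℂ) where
  carrier := {v | ∀ b, c b ∉ A → H.mulVec v b = 0}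
  add_mem' := fun {v w} hv hw b hb => by
    rw [Matrix.mulVec_add, Pi.add_apply, hv b hb, hw b hb, add_zero]
  zero_mem' := fun b _ => by rw [Matrix.mulVec_zero]; rfl
  smul_mem' := fun a v hv b hb => by
    rw [Matrix.mulVec_smul, Pi.smul_apply, hv b hb, smul_zero]

theorem mem_frameSub {v : Fin l → ℂ} :
    v ∈ frameSub c H A ↔ ∀ b, c b ∉ A → H.mulVec v b = 0 := Iff.rfl

theorem frameSub_mono (h : A ⊆ B) : frameSub c H A ≤ frameSub c H B :=
  fun _ hv b hb => hv b fun hA => hb (h hA)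

theorem frameSub_inf (c : Fin l → Fin 5) (H : Matrix (Fin l) (Fin l) ℂ) (A B : Finset (Fin 5)) :
    frameSub c H A ⊓ frameSub c H B = frameSub c H (A ∩ B) := by
  ext v
  constructor
  · rintro ⟨h1, h2⟩ b hb
    rw [Finset.mem_inter, not_and_or] at hb
    exact hb.elim (h1 b) (h2 b)
  · intro h
    exact ⟨fun b hb => h b fun hb' => hb (Finset.mem_inter.1 hb').1,
      fun b hb => h b fun hb' => hb (Finset.mem_inter.1 hb').2⟩

theorem mulVec_mulVec_of_mul_eq_one (hHG : H * G = 1) (x : Fin l → ℂ) :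
    H.mulVec (G.mulVec x) = x := by
  rw [Matrix.mulVec_mulVec, hHG, Matrix.one_mulVec]

theorem mulVec_mem_frameSub (hHG : H * G = 1) {x : Fin l → ℂ} :
    G.mulVec x ∈ frameSub c H A ↔ ∀ b, c b ∉ A → x b = 0 := by
  rw [mem_frameSub, mulVec_mulVec_of_mul_eq_one hHG]

theorem frameSub_sup (c : Fin l → Fin 5) (hHG : H * G = 1) (A B : Finset (Fin 5)) :
    frameSub c H A ⊔ frameSub c H B = frameSub c H (A ∪ B) := by
  refine le_antisymm (sup_le (frameSub_mono Finset.subset_union_left)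
    (frameSub_mono Finset.subset_union_right)) fun v hv => ?_
  have hGH : G * H = 1 := mul_eq_one_comm.1 hHG
  rw [Submodule.mem_sup]
  refine ⟨G.mulVec fun b => if c b ∈ A then H.mulVec v b else 0,
    (mulVec_mem_frameSub hHG).2 fun b hb => if_neg hb,
    G.mulVec fun b => if c b ∈ A then 0 else H.mulVec v b,
    (mulVec_mem_frameSub hHG).2 fun b hb => ?_, ?_⟩
  · split_ifs with hA
    · rfl
    · exact hv b (by simp [hA, hb])
  · rw [← Matrix.mulVec_add]
    conv_rhs => rw [← mulVec_mulVec_of_mul_eq_one hGH v]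
    congr 1
    funext b
    rw [Pi.add_apply]
    split_ifs <;> simp

theorem frameSub_univ (c : Fin l → Fin 5) (H : Matrix (Fin l) (Fin l) ℂ) :
    frameSub c H Finset.univ = ⊤ := by
  rw [eq_top_iff]
  exact fun v _ b hb => absurd (Finset.mem_univ _) hb

theorem frameSub_empty (hHG : H * G = 1) : frameSub c H ∅ = ⊥ := by
  rw [eq_bot_iff]
  intro v hv
  have hGH : G * H = 1 := mul_eq_one_comm.1 hHG
  rw [Submodule.mem_bot, ← mulVec_mulVec_of_mul_eq_one hGH v]
  have : H.mulVec v = 0 := funext fun b => hv b (Finset.notMem_empty _)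
  rw [this, Matrix.mulVec_zero]

theorem isCompl_frameSub (hHG : H * G = 1) (A : Finset (Fin 5)) :
    IsCompl (frameSub c H A) (frameSub c H Aᶜ) := by
  constructor
  · rw [disjoint_iff, frameSub_inf, Finset.inter_compl, frameSub_empty hHG]
  · rw [codisjoint_iff, frameSub_sup c hHG, Finset.union_compl, frameSub_univ]

theorem frameSub_le (hHG : H * G = 1) {U : Submodule ℂ (Fin l → ℂ)}
    (h : ∀ b, c b ∈ A → G.mulVec (Pi.single b 1) ∈ U) : frameSub c H A ≤ U := by
  intro v hv
  have hGH : G * H = 1 := mul_eq_one_comm.1 hHG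
  rw [← mulVec_mulVec_of_mul_eq_one hGH v]
  have e : H.mulVec v = ∑ b, H.mulVec v b • (Pi.single b 1 : Fin l → ℂ) := by
    funext a
    simp [Finset.sum_apply, Pi.single_apply]
  rw [e, Matrix.mulVec_sum]
  refine Submodule.sum_mem _ fun b _ => ?_
  rw [Matrix.mulVec_smul]
  by_cases hb : c b ∈ A
  · exact Submodule.smul_mem _ _ (h b hb)
  · rw [hv b hb, zero_smul]
    exact Submodule.zero_mem _

/-- The invertible matrix `G' H` carries one frame to the other and preserves colours. -/
theorem finrank_frameSub_le {H' G' : Matrix (Fin l) (Fin l) ℂ} (hHG : H * G = 1)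
    (hHG' : H' * G' = 1) :
    Module.finrank ℂ (frameSub c H A) ≤ Module.finrank ℂ (frameSub c H' A) := by
  have hGH : G * H = 1 := mul_eq_one_comm.1 hHG
  have hinj : Function.Injective (Matrix.mulVecLin (G' * H)) := by
    refine Function.LeftInverse.injective (g := Matrix.mulVecLin (G * H')) fun v => ?_
    rw [Matrix.mulVecLin_apply, Matrix.mulVecLin_apply, Matrix.mulVec_mulVec, mul_assoc,
      ← mul_assoc H', hHG', one_mul, hGH, Matrix.one_mulVec]
  rw [(Submodule.equivMapOfInjective _ hinj (frameSub c H A)).finrank_eq]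
  refine Submodule.finrank_mono ?_
  rintro _ ⟨v, hv, rfl⟩
  rw [Matrix.mulVecLin_apply, ← Matrix.mulVec_mulVec]
  exact (mulVec_mem_frameSub hHG').2 hv

theorem finrank_frameSub_eq {H' G' : Matrix (Fin l) (Fin l) ℂ} (hHG : H * G = 1)
    (hHG' : H' * G' = 1) :
    Module.finrank ℂ (frameSub c H A) = Module.finrank ℂ (frameSub c H' A) :=
  le_antisymm (finrank_frameSub_le hHG hHG') (finrank_frameSub_le hHG' hHG)

end FrameSub

/-! ### Block matrices -/

section Blocks

variable {l : ℕ} {c : Fin l → Fin 5} {s t : Finset (Fin 5 × Fin 5)}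
  {M N : Matrix (Fin l) (Fin l) ℂ}

/-- Only the blocks in `s` of the matrix `N` are nonzero. -/
def IsSupported (c : Fin l → Fin 5) (s : Finset (Fin 5 × Fin 5)) (N : Matrix (Fin l) (Fin l) ℂ) :
    Prop := ∀ a b, (c a, c b) ∉ s → N a b = 0

/-- The blocks of a product. -/
def compBlocks (s t : Finset (Fin 5 × Fin 5)) : Finset (Fin 5 × Fin 5) :=
  {x | ∃ z, (x.1, z) ∈ s ∧ (z, x.2) ∈ t}

/-- This reduces the vanishing of matrix products to a finite question about pairs of colours, which
`decide` can settle. -/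
theorem IsSupported.mul (hM : IsSupported c s M) (hN : IsSupported c t N) :
    IsSupported c (compBlocks s t) (M * N) := by
  intro a b hab
  rw [Matrix.mul_apply]
  refine Finset.sum_eq_zero fun d _ => ?_
  by_cases h1 : (c a, c d) ∈ s
  · by_cases h2 : (c d, c b) ∈ t
    · exact absurd (Finset.mem_filter.2 ⟨Finset.mem_univ _, c d, h1, h2⟩) hab
    · rw [hN d b h2, mul_zero]
  · rw [hM a d h1, zero_mul]

theorem IsSupported.eq_zero (h : IsSupported c s M) (hs : s = ∅) : M = 0 := by
  funext a b
  exact h a b (by simp [hs])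

/-- The projector onto the coordinates with colour in `A`. -/
def colorProj (c : Fin l → Fin 5) (A : Finset (Fin 5)) : Matrix (Fin l) (Fin l) ℂ :=
  Matrix.diagonal fun b => if c b ∈ A then 1 else 0

theorem colorProj_mulVec (A : Finset (Fin 5)) (x : Fin l → ℂ) (b : Fin l) :
    (colorProj c A).mulVec x b = if c b ∈ A then x b else 0 := by
  rw [colorProj, Matrix.mulVec_diagonal, ite_mul, one_mul, zero_mul]

theorem colorProj_mul_self (A : Finset (Fin 5)) :
    colorProj c A * colorProj c A = colorProj c A := by
  rw [colorProj, Matrix.diagonal_mul_diagonal]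
  congr 1
  funext b
  split_ifs <;> simp

theorem isSupported_colorProj (A : Finset (Fin 5)) :
    IsSupported c {x | x.1 = x.2 ∧ x.1 ∈ A} (colorProj c A) := by
  intro a b hab
  rw [colorProj]
  by_cases h : a = b
  · subst h
    rw [Matrix.diagonal_apply_eq, if_neg]
    intro hA
    exact hab (by simp [hA])
  · exact Matrix.diagonal_apply_ne _ h

/-- The blocks `(row, column)` of the big cell of `tildeDelta`: the colours `0`, ..., `4` are those
of `W`, `Z / W`, `F / Z`, `V / Z`, `ℂ^l / (V + F)`. -/
def pairBlocks : Finset (Fin 5 × Fin 5) := {(1, 0), (2, 0), (2, 1), (4, 1), (2, 3), (4, 3)}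

/-- The blocks of the big cell of `tildeDeltaZero`. -/
def tripleBlocks : Finset (Fin 5 × Fin 5) := {(1, 0), (2, 0), (2, 1), (2, 3), (4, 3)}

/-- The inverse of `1 + N`, if `N ^ 3 = 0`. -/
def unipInv (N : Matrix (Fin l) (Fin l) ℂ) : Matrix (Fin l) (Fin l) ℂ := 1 - N + N * N

/-- Read from column to row, the blocks are arrows `0 → 1`, `0 → 2`, `1 → 2`, `1 → 4`, `3 → 2`, `3 →
4`; no path has length three. -/
theorem IsSupported.cube_eq_zero (hN : IsSupported c pairBlocks N) : N * N * N = 0 :=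
  ((hN.mul hN).mul hN).eq_zero (by decide)

theorem IsSupported.unipInv_mul (hN : IsSupported c pairBlocks N) :
    unipInv N * (1 + N) = 1 := by
  have h : unipInv N * (1 + N) = 1 + N * N * N := by
    rw [unipInv]
    noncomm_ring
  rw [h, hN.cube_eq_zero, add_zero]

/-- The sets of colours of `W`, `Z` and `V`. -/
def flagColors : Finset (Finset (Fin 5)) := {{0}, {0, 1}, {0, 1, 3}}

/-- Within the colours of `W`, `Z` or `V`, the only block of `N` that can survive is `(1, 0)`, and
two arrows `0 → 1` do not compose. Hence, on the coordinates with colour in `A`, the corner of `1 +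
N` has the inverse `P - P N P`, where `P = colorProj c A`. -/
theorem IsSupported.corner_sq (hN : IsSupported c pairBlocks N) {A : Finset (Fin 5)}
    (hA : A ∈ flagColors) :
    colorProj c A * N * colorProj c A * N * colorProj c A = 0 := by
  have hP := isSupported_colorProj (c := c) A
  have key : ∀ A ∈ flagColors, compBlocks (compBlocks (compBlocks (compBlocks
      {x | x.1 = x.2 ∧ x.1 ∈ A} pairBlocks) {x | x.1 = x.2 ∧ x.1 ∈ A}) pairBlocks)
      {x | x.1 = x.2 ∧ x.1 ∈ A} = ∅ := by
    decide
  exact ((((hP.mul hN).mul hP).mul hN).mul hP).eq_zero (key A hA)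

theorem IsSupported.mul_inv_mul (hN : IsSupported c pairBlocks N)
    {T T' : Matrix (Fin l) (Fin l) ℂ} (hT : T * T' = 1) :
    unipInv N * T * (T' * (1 + N)) = 1 := by
  rw [mul_assoc, ← mul_assoc T, hT, one_mul, hN.unipInv_mul]

/-- The translated subspace is spanned by the columns of `T' (1 + N)` with colour in `A`.
Recombining these columns by the inverse `P - P N P` of the corner makes their `A`-coordinates
standard, which gives the projector. It is a polynomial in `N`: no determinant has to be inverted.
-/
theorem IsSupported.isCompl_and_projMat (hN : IsSupported c pairBlocks N)
    {T T' : Matrix (Fin l) (Fin l) ℂ} (hT : T * T' = 1) {A : Finset (Fin 5)}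
    (hA : A ∈ flagColors) :
    IsCompl (frameSub c (unipInv N * T) A) (frameSub c T Aᶜ) ∧
      projMat (frameSub c (unipInv N * T) A) (frameSub c T Aᶜ) =
        T' * ((1 + N) * (colorProj c A - colorProj c A * N * colorProj c A)) * T := by
  set P := colorProj c A with hP
  set X := (1 + N) * (P - P * N * P) with hX
  have hPP : P * P = P := colorProj_mul_self A
  have h1 : ∀ u, (T' * X * T).mulVec u ∈ frameSub c (unipInv N * T) A := by
    intro u b hb
    have e : unipInv N * T * (T' * X * T) = P * ((P - P * N * P) * T) := by
      calc unipInv N * T * (T' * X * T) = unipInv N * (T * T') * X * T := by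
            simp only [mul_assoc]
        _ = unipInv N * (1 + N) * (P - P * N * P) * T := by
            rw [hT, mul_one, hX]
            simp only [mul_assoc]
        _ = (P * P - P * P * N * P) * T := by rw [hN.unipInv_mul, one_mul, hPP]
        _ = P * ((P - P * N * P) * T) := by noncomm_ring
    rw [Matrix.mulVec_mulVec, e, ← Matrix.mulVec_mulVec, colorProj_mulVec, if_neg hb]
  have h2 : ∀ u, u - (T' * X * T).mulVec u ∈ frameSub c T Aᶜ := by
    intro u b hb
    rw [Finset.mem_compl, not_not] at hb
    have e : P * X = P := by
      have := hN.corner_sq hA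
      rw [← hP] at this
      calc P * X = P * P - P * P * N * P + P * N * P - P * N * P * N * P := by
            rw [hX]
            noncomm_ring
        _ = P := by
            rw [this, hPP]
            abel
    have e2 : P * (T - T * (T' * X * T)) = 0 := by
      have : T * (T' * X * T) = X * T := by
        rw [← mul_assoc, ← mul_assoc, hT, one_mul]
      rw [this, mul_sub, ← mul_assoc, e, sub_self]
    have e3 : T.mulVec (u - (T' * X * T).mulVec u) = (T - T * (T' * X * T)).mulVec u := by
      rw [Matrix.mulVec_sub, Matrix.mulVec_mulVec, Matrix.sub_mulVec]
    have e4 := colorProj_mulVec (c := c) A (T.mulVec (u - (T' * X * T).mulVec u)) b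
    rw [if_pos hb, e3, Matrix.mulVec_mulVec, ← hP, e2, Matrix.zero_mulVec] at e4
    rw [e3, ← e4]
    rfl
  have hd : Module.finrank ℂ (frameSub c (unipInv N * T) A) +
      Module.finrank ℂ (frameSub c T Aᶜ) = l := by
    rw [finrank_frameSub_eq (hN.mul_inv_mul hT) hT]
    have := Submodule.finrank_add_eq_of_isCompl (isCompl_frameSub (c := c) hT A)
    rwa [Module.finrank_fin_fun] at this
  have hc := isCompl_of_matrix h1 h2 hd
  exact ⟨hc, projMat_eq hc h1 h2⟩

/-- The projector on a column, in the case where the column of `1 + N` is that of a graph. -/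
theorem IsSupported.projMat_mulVec_col (hN : IsSupported c pairBlocks N)
    {T T' : Matrix (Fin l) (Fin l) ℂ} (hT : T * T' = 1) {A : Finset (Fin 5)}
    (hA : A ∈ flagColors) {b : Fin l} (hb : c b ∈ A) (hNb : ∀ a, c a ∈ A → N a b = 0) :
    (projMat (frameSub c (unipInv N * T) A) (frameSub c T Aᶜ)).mulVec
      (T'.mulVec (Pi.single b 1)) = T'.mulVec ((1 + N).mulVec (Pi.single b 1)) := by
  refine projMat_mulVec_eq (hN.isCompl_and_projMat hT hA).1 ?_ ?_
  · rw [Matrix.mulVec_mulVec, mulVec_mem_frameSub (hN.mul_inv_mul hT)]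
    intro a ha
    rw [Pi.single_apply, if_neg]
    rintro rfl
    exact ha hb
  · rw [← Matrix.mulVec_sub, mulVec_mem_frameSub hT]
    intro a ha
    rw [Finset.mem_compl, not_not] at ha
    simp [hNb a ha, Matrix.one_apply, Pi.single_apply]

end Blocks

/-! ### Adapted bases -/

section Adapted

variable {l : ℕ}

theorem exists_relative_compl {E : Type*} [AddCommGroup E] [Module ℂ E] {W Z : Submodule ℂ E}
    (h : W ≤ Z) : ∃ B, B ≤ Z ∧ W ⊔ B = Z ∧ W ⊓ B = ⊥ := by
  obtain ⟨C, hC⟩ := exists_isCompl W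
  refine ⟨C ⊓ Z, inf_le_right, ?_, ?_⟩
  · rw [← sup_inf_assoc_of_le _ h, hC.sup_eq_top, top_inf_eq]
  · rw [← inf_assoc, hC.inf_eq_bot, bot_inf_eq]

/-- A decomposition of `ℂ^l` into five subspaces, by means of a basis with five colours. -/
theorem exists_frame_of_isInternal {U : Fin 5 → Submodule ℂ (Fin l → ℂ)}
    (hU : DirectSum.IsInternal U) : ∃ (c : Fin l → Fin 5) (T T' : Matrix (Fin l) (Fin l) ℂ),
      T * T' = 1 ∧ ∀ A : Finset (Fin 5), frameSub c T A = ⨆ i ∈ A, U i := by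
  let v : ∀ i, Module.Basis (Fin (Module.finrank ℂ (U i))) ℂ (U i) := fun i => Module.finBasis ℂ _
  let b := hU.collectedBasis v
  have hcard : Fintype.card (Σ i, Fin (Module.finrank ℂ (U i))) = l := by
    rw [← Module.finrank_eq_card_basis b, Module.finrank_fin_fun]
  let ε := Fintype.equivFinOfCardEq hcard
  let b' := b.reindex ε
  let T : Matrix (Fin l) (Fin l) ℂ := LinearMap.toMatrix' b'.equivFun.toLinearMap
  let T' : Matrix (Fin l) (Fin l) ℂ := LinearMap.toMatrix' b'.equivFun.symm.toLinearMap
  have hTT' : T * T' = 1 := by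
    rw [← LinearMap.toMatrix'_comp, LinearEquiv.comp_symm, LinearMap.toMatrix'_id]
  have hT : ∀ u i, T.mulVec u i = b.repr u (ε.symm i) := by
    intro u i
    rw [LinearMap.toMatrix'_mulVec]
    simp [b']
  have hT' : ∀ i, T'.mulVec (Pi.single i 1) = b (ε.symm i) := by
    intro i
    rw [LinearMap.toMatrix'_mulVec]
    simp [b']
  refine ⟨fun i => (ε.symm i).1, T, T', hTT', fun A => le_antisymm ?_ ?_⟩
  · refine frameSub_le hTT' fun i hi => ?_
    rw [hT']
    exact Submodule.mem_iSup_of_mem _ (Submodule.mem_iSup_of_mem hi (hU.collectedBasis_mem v _))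
  · refine iSup₂_le fun i hi u hu a ha => ?_
    rw [hT]
    refine hU.collectedBasis_repr_of_mem_ne v (i := i) ?_ hu
    rintro rfl
    exact ha hi

/-- The summands are removed in the order `4`, `3`, `2`, `1`: each time the relation puts the last
term into a subspace that meets its own summand trivially, namely `V + F`, then `V ∩ F` twice, then
`W`. -/
theorem eq_zero_of_sum_eq_zero {E : Type*} [AddCommGroup E] [Module ℂ E]
    {W V F B D A G : Submodule ℂ E} (hB : B ≤ V ⊓ F) (hB' : W ⊓ B = ⊥) (hD : D ≤ F)
    (hD' : V ⊓ F ⊓ D = ⊥) (hA : A ≤ V) (hA' : V ⊓ F ⊓ A = ⊥) (hW : W ≤ V ⊓ F)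
    (hG : (V ⊔ F) ⊓ G = ⊥) (u : Fin 5 → E) (h0 : u 0 ∈ W) (h1 : u 1 ∈ B) (h2 : u 2 ∈ D)
    (h3 : u 3 ∈ A) (h4 : u 4 ∈ G) (hs : u 0 + u 1 + u 2 + u 3 + u 4 = 0) : ∀ i, u i = 0 := by
  have h01 : u 0 + u 1 ∈ V ⊓ F := add_mem (hW h0) (hB h1)
  have e4 : u 4 = 0 := by
    rw [← Submodule.mem_bot ℂ, ← hG]
    refine ⟨?_, h4⟩
    rw [← neg_eq_of_add_eq_zero_right hs]
    exact neg_mem (add_mem (add_mem (Submodule.mem_sup_left h01.1)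
      (Submodule.mem_sup_right (hD h2))) (Submodule.mem_sup_left (hA h3)))
  rw [e4, add_zero] at hs
  have e3 : u 3 = 0 := by
    rw [← Submodule.mem_bot ℂ, ← hA']
    refine ⟨⟨hA h3, ?_⟩, h3⟩
    rw [← neg_eq_of_add_eq_zero_right hs]
    exact neg_mem (add_mem h01.2 (hD h2))
  rw [e3, add_zero] at hs
  have e2 : u 2 = 0 := by
    rw [← Submodule.mem_bot ℂ, ← hD']
    refine ⟨?_, h2⟩
    rw [← neg_eq_of_add_eq_zero_right hs]
    exact neg_mem h01
  rw [e2, add_zero] at hs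
  have e1 : u 1 = 0 := by
    rw [← Submodule.mem_bot ℂ, ← hB']
    refine ⟨?_, h1⟩
    rw [← neg_eq_of_add_eq_zero_right hs]
    exact neg_mem h0
  rw [e1, add_zero] at hs
  intro i
  fin_cases i
  exacts [hs, e1, e2, e3, e4]

/-- The colours come from complements: `B` of `W` in `V ∩ F`, `D` of `V ∩ F` in `F`, `A` of `V ∩ F`
in `V`, and `G` of `V + F` in the whole space. The decomposition is `W`, `B`, `D`, `A`, `G` in this
order. -/
theorem exists_adapted_frame {W V F : Submodule ℂ (Fin l → ℂ)} (hWV : W ≤ V) (hWF : W ≤ F) :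
    ∃ (c : Fin l → Fin 5) (T T' : Matrix (Fin l) (Fin l) ℂ), T * T' = 1 ∧
      frameSub c T {0} = W ∧ frameSub c T {0, 1} = V ⊓ F ∧ frameSub c T {0, 1, 2} = F ∧
      frameSub c T {0, 1, 3} = V := by
  obtain ⟨B, hB, hB1, hB2⟩ := exists_relative_compl (le_inf hWV hWF)
  obtain ⟨D, hD, hD1, hD2⟩ := exists_relative_compl (inf_le_right : V ⊓ F ≤ F)
  obtain ⟨A, hA, hA1, hA2⟩ := exists_relative_compl (inf_le_left : V ⊓ F ≤ V)
  obtain ⟨G, hG⟩ := exists_isCompl (V ⊔ F)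
  have hint : DirectSum.IsInternal ![W, B, D, A, G] := by
    rw [DirectSum.isInternal_submodule_iff_iSupIndep_and_iSup_eq_top]
    constructor
    · rw [iSupIndep_iff_finsetSum_eq_zero_imp_eq_zero]
      intro s v hv h0 i hi
      have hu : ∀ i, (if i ∈ s then v i else 0) ∈ (![W, B, D, A, G] : Fin 5 → _) i := by
        intro i
        split_ifs with h
        · exact hv i h
        · exact Submodule.zero_mem _
      have h0' : ∑ i, (if i ∈ s then v i else 0) = 0 := by
        rw [Finset.sum_ite_mem, Finset.univ_inter, h0]
      rw [Fin.sum_univ_five] at h0'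
      have := eq_zero_of_sum_eq_zero hB hB2 hD hD2 hA hA2 (le_inf hWV hWF) hG.inf_eq_bot
        (fun i => if i ∈ s then v i else 0) (hu 0) (hu 1) (hu 2) (hu 3) (hu 4) h0' i
      rwa [if_pos hi] at this
    · rw [eq_top_iff, ← hG.sup_eq_top]
      have h : ∀ i, (![W, B, D, A, G] : Fin 5 → _) i ≤ ⨆ i, (![W, B, D, A, G] : Fin 5 → _) i :=
        le_iSup _
      have hZ : V ⊓ F ≤ ⨆ i, (![W, B, D, A, G] : Fin 5 → _) i := by
        rw [← hB1]
        exact sup_le (h 0) (h 1)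
      refine sup_le (sup_le ?_ ?_) (h 4)
      · rw [← hA1]
        exact sup_le hZ (h 3)
      · conv_lhs => rw [← hD1]
        exact sup_le hZ (h 2)
  obtain ⟨c, T, T', hT, h⟩ := exists_frame_of_isInternal hint
  refine ⟨c, T, T', hT, ?_, ?_, ?_, ?_⟩
  · rw [h]
    simp
  · rw [h, ← hB1]
    simp [iSup_or, iSup_sup_eq]
  · rw [h, ← hD1, ← hB1]
    simp [iSup_or, iSup_sup_eq, sup_assoc]
  · rw [h, ← hA1, ← hB1]
    simp [iSup_or, iSup_sup_eq, sup_assoc]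

end Adapted

/-! ### Big cells -/

/-- The functions on `X` that are on `A` polynomials in the functions `g`. -/
def polyFun {X σ : Type*} (g : X → σ → ℂ) (A : Set X) : Subalgebra ℂ (X → ℂ) where
  carrier := {f | ∃ P : MvPolynomial σ ℂ, ∀ x ∈ A, f x = MvPolynomial.eval (g x) P}
  mul_mem' := by
    rintro f f' ⟨P, hP⟩ ⟨P', hP'⟩
    exact ⟨P * P', fun x hx => by rw [Pi.mul_apply, hP x hx, hP' x hx, map_mul]⟩
  add_mem' := by
    rintro f f' ⟨P, hP⟩ ⟨P', hP'⟩
    exact ⟨P + P', fun x hx => by rw [Pi.add_apply, hP x hx, hP' x hx, map_add]⟩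
  algebraMap_mem' a := ⟨MvPolynomial.C a, fun x _ => by simp⟩

section Cell

variable {l : ℕ} {c : Fin l → Fin 5} {s : Finset (Fin 5 × Fin 5)}

/-- The matrix entries in the blocks `s`. -/
abbrev BlockIndex (c : Fin l → Fin 5) (s : Finset (Fin 5 × Fin 5)) : Type :=
  {i : Fin l × Fin l // (c i.1, c i.2) ∈ s}

/-- The matrix with given entries in the blocks `s`. -/
def blockMat (c : Fin l → Fin 5) (s : Finset (Fin 5 × Fin 5)) (a : BlockIndex c s → ℂ) :
    Matrix (Fin l) (Fin l) ℂ :=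
  Matrix.of fun u v => if h : (c u, c v) ∈ s then a ⟨(u, v), h⟩ else 0

theorem blockMat_apply {u v : Fin l} (h : (c u, c v) ∈ s) (a : BlockIndex c s → ℂ) :
    blockMat c s a u v = a ⟨(u, v), h⟩ := dif_pos h

theorem isSupported_blockMat (a : BlockIndex c s → ℂ) : IsSupported c s (blockMat c s a) :=
  fun _ _ h => dif_neg h

theorem IsSupported.mono {N : Matrix (Fin l) (Fin l) ℂ} {t : Finset (Fin 5 × Fin 5)}
    (hN : IsSupported c s N) (h : s ⊆ t) : IsSupported c t N :=
  fun a b hab => hN a b fun hs => hab (h hs)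

theorem tripleBlocks_subset : tripleBlocks ⊆ pairBlocks := by decide

theorem blockMat_mem {X : Type*} {R : Subalgebra ℂ (X → ℂ)} {f : X → BlockIndex c s → ℂ}
    (hf : ∀ i, (fun x => f x i) ∈ R) (u v : Fin l) : (fun x => blockMat c s (f x) u v) ∈ R := by
  by_cases h : (c u, c v) ∈ s
  · simp only [blockMat_apply h]
    exact hf _
  · simp only [isSupported_blockMat _ u v h]
    exact const_mem R 0

theorem cellMat_mem {X : Type*} {R : Subalgebra ℂ (X → ℂ)}
    {N : X → Matrix (Fin l) (Fin l) ℂ} (hN : ∀ u v, (fun x => N x u v) ∈ R)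
    (T T' P : Matrix (Fin l) (Fin l) ℂ) (u v : Fin l) :
    (fun x => (T' * ((1 + N x) * (P - P * N x * P)) * T) u v) ∈ R := by
  have hc : ∀ (M : Matrix (Fin l) (Fin l) ℂ) (u v : Fin l), (fun _ => M u v) ∈ R :=
    fun M u v => const_mem R _
  have h1 : ∀ u v, (fun x => (1 + N x) u v) ∈ R := fun u v => R.add_mem (hc 1 u v) (hN u v)
  have h2 : ∀ u v, (fun x => (P - P * N x * P) u v) ∈ R := fun u v =>
    R.sub_mem (hc P u v) (mul_mem_of_forall (mul_mem_of_forall (hc P) hN) (hc P) u v)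
  exact mul_mem_of_forall (mul_mem_of_forall (hc T') (mul_mem_of_forall h1 h2)) (hc T) u v

theorem mul_mul_apply_eq_mulVec (T E T' : Matrix (Fin l) (Fin l) ℂ) (a b : Fin l) :
    (T * E * T') a b = T.mulVec (E.mulVec (T'.mulVec (Pi.single b 1))) a := by
  rw [Matrix.mulVec_mulVec, Matrix.mulVec_mulVec, Matrix.mulVec_single_one, Matrix.col_apply,
    mul_assoc]

theorem one_add_mulVec_single (N : Matrix (Fin l) (Fin l) ℂ) (a b : Fin l) :
    (1 + N).mulVec (Pi.single b 1) a = (1 : Matrix (Fin l) (Fin l) ℂ) a b + N a b := by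
  simp

variable {T T' : Matrix (Fin l) (Fin l) ℂ} {U : Submodule ℂ (Fin l → ℂ)} {A B : Finset (Fin 5)}

/-- Projecting along the span of the colours outside `A` leaves the coordinates with colour in `A`
unchanged. -/
theorem mul_projMat_mul_apply_of_mem (hT : T * T' = 1) (hU : IsCompl U (frameSub c T Aᶜ))
    {a : Fin l} (ha : c a ∈ A) (b : Fin l) :
    (T * projMat U (frameSub c T Aᶜ) * T') a b = (1 : Matrix (Fin l) (Fin l) ℂ) a b := by
  have h := sub_projMat_mulVec_mem hU (T'.mulVec (Pi.single b 1)) a (by simpa using ha)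
  rw [Matrix.mulVec_sub, Pi.sub_apply, sub_eq_zero, mulVec_mulVec_of_mul_eq_one hT] at h
  rw [mul_mul_apply_eq_mulVec, ← h, Pi.single_apply, Matrix.one_apply]

theorem mul_projMat_mul_apply_of_notMem {C : Submodule ℂ (Fin l → ℂ)} (hU : IsCompl U C)
    (hB : U ≤ frameSub c T B) {a : Fin l} (ha : c a ∉ B) (b : Fin l) :
    (T * projMat U C * T') a b = 0 := by
  rw [mul_mul_apply_eq_mulVec]
  exact hB (projMat_mulVec_mem hU _) a ha

/-- The complements that define the big cell. -/
def flagCompl {ι : Type} (c : Fin l → Fin 5) (T : Matrix (Fin l) (Fin l) ℂ)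
    (colors : ι → Finset (Fin 5)) (i : ι) : Submodule ℂ (Fin l → ℂ) :=
  frameSub c T (colors i)ᶜ

/-- The translate by `1 + N` of the standard flag. -/
def flagPoint {ι : Type} (c : Fin l → Fin 5) (T N : Matrix (Fin l) (Fin l) ℂ)
    (colors : ι → Finset (Fin 5)) (i : ι) : Submodule ℂ (Fin l → ℂ) :=
  frameSub c (unipInv N * T) (colors i)

theorem inChart_of_flagPoint {ι : Type} {S : Set (ι → Submodule ℂ (Fin l → ℂ))}
    {colors : ι → Finset (Fin 5)} (hcol : ∀ i, colors i ∈ flagColors) (hT : T * T' = 1)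
    {N : Matrix (Fin l) (Fin l) ℂ} (hN : IsSupported c pairBlocks N) {x : Locus S}
    (hx : x.sub = flagPoint c T N colors) : InChart (flagCompl c T colors) x := by
  intro i
  rw [hx]
  exact (hN.isCompl_and_projMat hT (hcol i)).1

theorem coord_poly_of_flagPoint {ι : Type} {S : Set (ι → Submodule ℂ (Fin l → ℂ))}
    {colors : ι → Finset (Fin 5)} (hcol : ∀ i, colors i ∈ flagColors) (hT : T * T' = 1)
    (hs : s ⊆ pairBlocks) {x : (BlockIndex c s → ℂ) → Locus S}
    (hx : ∀ a, (x a).sub = flagPoint c T (blockMat c s a) colors) (t : ι × Fin l × Fin l) :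
    ∃ P : MvPolynomial (BlockIndex c s) ℂ, ∀ a,
      coord (flagCompl c T colors) (x a) t = MvPolynomial.eval a P := by
  have hid : ∀ i, (fun a : BlockIndex c s → ℂ => a i) ∈
      polyFun (id : (BlockIndex c s → ℂ) → BlockIndex c s → ℂ) Set.univ :=
    fun i => ⟨MvPolynomial.X i, fun a _ => by simp⟩
  obtain ⟨P, hP⟩ := cellMat_mem (blockMat_mem hid) T T' (colorProj c (colors t.1)) t.2.1 t.2.2
  refine ⟨P, fun a => ?_⟩
  refine Eq.trans ?_ (hP a trivial)
  rw [coord, hx, flagPoint, flagCompl,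
    (((isSupported_blockMat a).mono hs).isCompl_and_projMat hT (hcol t.1)).2]

/-- The colours of `W` and `V`. -/
def pairColors : Fin 2 → Finset (Fin 5) := ![{0}, {0, 1, 3}]

/-- The colours of `W`, `Z` and `V`. -/
def tripleColors : Fin 3 → Finset (Fin 5) := ![{0}, {0, 1}, {0, 1, 3}]

theorem pairColors_mem : ∀ i, pairColors i ∈ flagColors := by decide

theorem tripleColors_mem : ∀ i, tripleColors i ∈ flagColors := by decide

/-! ### The big cell of `tildeDelta` as an affine space -/

variable {F : Submodule ℂ (Fin l → ℂ)} {k p q : ℕ}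

/-- The coloured basis is adapted to `F` and to a point of `tildeDelta`. -/
structure IsAdapted (F : Submodule ℂ (Fin l → ℂ)) (k p : ℕ) (c : Fin l → Fin 5)
    (T T' : Matrix (Fin l) (Fin l) ℂ) : Prop where
  mul_eq_one : T * T' = 1
  fixed : frameSub c T {0, 1, 2} = F
  finrank_left : Module.finrank ℂ (frameSub c T {0}) = k + 1 - p
  finrank_right : Module.finrank ℂ (frameSub c T {0, 1, 3}) = k

theorem IsAdapted.col_mem_fixed (h : IsAdapted F k p c T T') {N : Matrix (Fin l) (Fin l) ℂ}
    {b : Fin l} (hb : c b ∈ ({0, 1, 2} : Finset (Fin 5)))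
    (hN : ∀ a, c a ∉ ({0, 1, 2} : Finset (Fin 5)) → N a b = 0) :
    (T' * (1 + N)).mulVec (Pi.single b 1) ∈ F := by
  rw [← h.fixed, ← Matrix.mulVec_mulVec, mulVec_mem_frameSub h.mul_eq_one]
  intro a ha
  have hab : a ≠ b := by
    rintro rfl
    exact ha hb
  rw [one_add_mulVec_single, hN a ha, Matrix.one_apply_ne hab, add_zero]

theorem finrank_flag (hT : T * T' = 1) {N : Matrix (Fin l) (Fin l) ℂ}
    (hN : IsSupported c pairBlocks N) (A : Finset (Fin 5)) :
    Module.finrank ℂ (frameSub c (unipInv N * T) A) = Module.finrank ℂ (frameSub c T A) :=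
  finrank_frameSub_eq (hN.mul_inv_mul hT) hT

/-- A point of the big cell of `tildeDelta`. -/
def IsAdapted.point (h : IsAdapted F k p c T T') (a : BlockIndex c pairBlocks → ℂ) :
    Locus (tildeDelta F k p) where
  sub := flagPoint c T (blockMat c pairBlocks a) pairColors
  mem := by
    have hN := isSupported_blockMat (c := c) (s := pairBlocks) a
    refine ⟨?_, ?_, ?_, frameSub_mono (by decide)⟩
    · refine frameSub_le (hN.mul_inv_mul h.mul_eq_one) fun b hb => ?_
      have hb0 : c b = 0 := Finset.mem_singleton.1 hb
      refine h.col_mem_fixed (by simp [hb0]) fun a ha => hN a b ?_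
      rw [hb0]
      revert ha
      generalize c a = x
      revert x
      decide
    · exact (finrank_flag h.mul_eq_one hN _).trans h.finrank_left
    · exact (finrank_flag h.mul_eq_one hN _).trans h.finrank_right

/-- The index of the subspace, `W` or `V`, that determines the columns of a given colour. -/
def slot (x : Fin 5) : Fin 2 := if x = 0 then 0 else 1

/-- The parameters of the big cell of `tildeDelta`. -/
def pairParam (c : Fin l → Fin 5) (T T' : Matrix (Fin l) (Fin l) ℂ)
    (x : Locus (tildeDelta F k p)) (i : BlockIndex c pairBlocks) : ℂ :=
  (T * projMat (x.sub (slot (c i.1.2))) (flagCompl c T pairColors (slot (c i.1.2))) * T')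
    i.1.1 i.1.2

/-- The columns of `1 + N` are the projections of the basis vectors to `W` and `V`. -/
theorem IsAdapted.one_add_blockMat_apply (h : IsAdapted F k p c T T')
    {x : Locus (tildeDelta F k p)} (hx : InChart (flagCompl c T pairColors) x) {b : Fin l}
    (hb : c b ∈ ({0, 1, 3} : Finset (Fin 5))) (a : Fin l) :
    (1 + blockMat c pairBlocks (pairParam c T T' x)) a b =
      (T * projMat (x.sub (slot (c b))) (flagCompl c T pairColors (slot (c b))) * T') a b := by
  rw [Matrix.add_apply]
  by_cases hab : (c a, c b) ∈ pairBlocks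
  · have hne : a ≠ b := by
      rintro rfl
      revert hab
      generalize c a = x
      revert x
      decide
    rw [blockMat_apply hab, Matrix.one_apply_ne hne, zero_add]
    rfl
  · rw [isSupported_blockMat _ a b hab, add_zero]
    by_cases ha : c a ∈ pairColors (slot (c b))
    · exact (mul_projMat_mul_apply_of_mem h.mul_eq_one (hx (slot (c b))) ha b).symm
    · have key : ∀ x y : Fin 5, y ∈ ({0, 1, 3} : Finset (Fin 5)) → (x, y) ∉ pairBlocks →
          x ∉ pairColors (slot y) → y = 0 ∧ x ∉ ({0, 1, 2} : Finset (Fin 5)) := by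
        decide
      obtain ⟨hb0, ha'⟩ := key _ _ hb hab ha
      have hne : a ≠ b := by
        rintro rfl
        exact ha' (by simp [hb0])
      rw [Matrix.one_apply_ne hne]
      refine (mul_projMat_mul_apply_of_notMem (hx _) ?_ ha' b).symm
      rw [hb0, h.fixed]
      exact x.mem.1

theorem IsAdapted.col_eq (h : IsAdapted F k p c T T')
    {x : Locus (tildeDelta F k p)} (hx : InChart (flagCompl c T pairColors) x) {b : Fin l}
    (hb : c b ∈ ({0, 1, 3} : Finset (Fin 5))) :
    (T' * (1 + blockMat c pairBlocks (pairParam c T T' x))).mulVec (Pi.single b 1) =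
      (projMat (x.sub (slot (c b))) (flagCompl c T pairColors (slot (c b)))).mulVec
        (T'.mulVec (Pi.single b 1)) := by
  have hT' : T' * T = 1 := mul_eq_one_comm.1 h.mul_eq_one
  have e : (1 + blockMat c pairBlocks (pairParam c T T' x)).mulVec (Pi.single b 1) =
      T.mulVec ((projMat (x.sub (slot (c b))) (flagCompl c T pairColors (slot (c b)))).mulVec
        (T'.mulVec (Pi.single b 1))) := by
    funext a
    rw [← mul_mul_apply_eq_mulVec, ← h.one_add_blockMat_apply hx hb, Matrix.mulVec_single_one]
    rfl
  rw [← Matrix.mulVec_mulVec, e, mulVec_mulVec_of_mul_eq_one hT']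

/-- The spanning columns are projections to `W` or to `V`, so they lie there; those of colour `0`
lie in `V` too since `W ⊆ V`. Equality follows by comparing dimensions. -/
theorem IsAdapted.flagPoint_pairParam (h : IsAdapted F k p c T T')
    {x : Locus (tildeDelta F k p)} (hx : InChart (flagCompl c T pairColors) x) :
    flagPoint c T (blockMat c pairBlocks (pairParam c T T' x)) pairColors = x.sub := by
  have hN := isSupported_blockMat (pairParam c T T' x)
  have hcol : ∀ b, c b ∈ ({0, 1, 3} : Finset (Fin 5)) →
      (T' * (1 + blockMat c pairBlocks (pairParam c T T' x))).mulVec (Pi.single b 1) ∈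
        x.sub (slot (c b)) := fun b hb => by
    rw [h.col_eq hx hb]
    exact projMat_mulVec_mem (hx _) _
  have h0 : frameSub c (unipInv (blockMat c pairBlocks (pairParam c T T' x)) * T) {0} ≤
      x.sub 0 := by
    refine frameSub_le (hN.mul_inv_mul h.mul_eq_one) fun b hb => ?_
    have hb0 : c b = 0 := Finset.mem_singleton.1 hb
    have := hcol b (by simp [hb0])
    rwa [hb0] at this
  have h1 : frameSub c (unipInv (blockMat c pairBlocks (pairParam c T T' x)) * T) {0, 1, 3} ≤
      x.sub 1 := by
    refine frameSub_le (hN.mul_inv_mul h.mul_eq_one) fun b hb => ?_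
    have := hcol b hb
    by_cases hb0 : c b = 0
    · rw [hb0] at this
      exact x.mem.2.2.2 this
    · rwa [slot, if_neg hb0] at this
  funext i
  fin_cases i
  · refine Submodule.eq_of_le_of_finrank_eq h0 ?_
    exact ((finrank_flag h.mul_eq_one hN _).trans h.finrank_left).trans x.mem.2.1.symm
  · refine Submodule.eq_of_le_of_finrank_eq h1 ?_
    exact ((finrank_flag h.mul_eq_one hN _).trans h.finrank_right).trans x.mem.2.2.1.symm

/-- A column of `N` has no entries in the colours of its own slot, so the projector sends the basis
vector to the column of `1 + N` itself. For colour `0` this is true of `W` but not of `V`, because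
of the block `(1, 0)`; this explains the choice made in `slot`. -/
theorem IsAdapted.pairParam_eq (h : IsAdapted F k p c T T') (a : BlockIndex c pairBlocks → ℂ)
    {x : Locus (tildeDelta F k p)}
    (hx : x.sub = flagPoint c T (blockMat c pairBlocks a) pairColors) :
    pairParam c T T' x = a := by
  funext ⟨⟨u, v⟩, huv⟩
  have hN := isSupported_blockMat (c := c) (s := pairBlocks) a
  have key : ∀ y x : Fin 5, (x, y) ∈ pairBlocks → y ∈ pairColors (slot y) ∧
      ∀ z ∈ pairColors (slot y), (z, y) ∉ pairBlocks := by
    decide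
  obtain ⟨hv, hz⟩ := key _ _ huv
  have hne : u ≠ v := by
    rintro rfl
    exact hz _ hv huv
  rw [pairParam, mul_mul_apply_eq_mulVec, hx, flagPoint, flagCompl,
    hN.projMat_mulVec_col h.mul_eq_one (pairColors_mem _) hv (fun w hw => hN w v (hz _ hw)),
    mulVec_mulVec_of_mul_eq_one h.mul_eq_one, one_add_mulVec_single, Matrix.one_apply_ne hne,
    zero_add, blockMat_apply huv]

theorem pairParam_mem {X : Type*} {R : Subalgebra ℂ (X → ℂ)} {x : X → Locus (tildeDelta F k p)}
    (hx : ∀ i u v, (fun z => projMat ((x z).sub i) (flagCompl c T pairColors i) u v) ∈ R)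
    (i : BlockIndex c pairBlocks) : (fun z => pairParam c T T' (x z) i) ∈ R :=
  mul_mem_of_forall (mul_mem_of_forall (M := fun _ => T) (fun _ _ => const_mem R _) (hx _))
    (N := fun _ => T') (fun _ _ => const_mem R _) _ _

/-- The big cell of `tildeDelta`. -/
def IsAdapted.chart (h : IsAdapted F k p c T T') :
    AffineChart (tildeDelta F k p) (BlockIndex c pairBlocks) where
  compl := flagCompl c T pairColors
  point := h.point
  param := pairParam c T T'
  inChart a := inChart_of_flagPoint pairColors_mem h.mul_eq_one (isSupported_blockMat a) rfl
  coord_poly := coord_poly_of_flagPoint pairColors_mem h.mul_eq_one (Finset.Subset.refl _)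
    fun _ => rfl
  param_poly i := by
    obtain ⟨P, hP⟩ := pairParam_mem (c := c) (T := T) (T' := T')
      (R := polyFun (coord (S := tildeDelta F k p) (flagCompl c T pairColors)) Set.univ)
      (x := fun y => y) (fun i u v => ⟨MvPolynomial.X (i, u, v), fun y _ => by simp [coord]⟩) i
    exact ⟨P, fun y _ => hP y trivial⟩
  param_point a := h.pairParam_eq a rfl
  point_param y hy := by
    have e := h.flagPoint_pairParam hy
    obtain ⟨s, hs⟩ := y
    simp only [IsAdapted.point, e]

/-! ### The big cell of `tildeDeltaZero` as a coordinate subspace -/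

/-- The coloured basis is adapted to `F` and to a point of `tildeDeltaZero`. -/
structure IsAdaptedTriple (F : Submodule ℂ (Fin l → ℂ)) (k p q : ℕ) (c : Fin l → Fin 5)
    (T T' : Matrix (Fin l) (Fin l) ℂ) : Prop extends IsAdapted F k p c T T' where
  finrank_mid : Module.finrank ℂ (frameSub c T {0, 1}) = k + 1 - q
  mem_stratum : frameSub c T {0, 1, 3} ∈ schubertStratum F k q

/-- Not lying in `Δ_{q-1}` bounds `dim (V ∩ F)` strictly by `i_{q-1} = i_q + 1`, so `V ∩ F` is no
larger than its subspace `Z`. -/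
theorem tildeDeltaZero_mid_eq (y : Locus (tildeDeltaZero F k p q)) :
    y.sub 1 = y.sub 2 ⊓ F := by
  obtain ⟨-, h2, -, h4, h5, h6, h7⟩ := y.mem
  refine Submodule.eq_of_le_of_finrank_le (le_inf h5 h2) ?_
  have : ¬ (k + 1 - (q - 1) ≤ Module.finrank ℂ ↥(y.sub 2 ⊓ F)) := fun h => h7 ⟨h6.1, h⟩
  rw [h4]
  omega

theorem incl_injective : Function.Injective (incl F k p q) := by
  intro y z hyz
  have h0 : y.sub 0 = z.sub 0 := congrFun (congrArg Locus.sub hyz) 0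
  have h2 : y.sub 2 = z.sub 2 := congrFun (congrArg Locus.sub hyz) 1
  have h1 : y.sub 1 = z.sub 1 := by
    rw [tildeDeltaZero_mid_eq, tildeDeltaZero_mid_eq, h2]
  have h : y.sub = z.sub := by
    funext i
    fin_cases i
    exacts [h0, h1, h2]
  cases y
  cases z
  simpa using h

/-- Once the block `(4, 1)` is dropped, the columns of colours `0`, `1`, `2` have no entries in rows
`3` and `4`: the translation by `1 + N` preserves `F`, and with it the dimension of `V ∩ F`. -/
theorem IsAdapted.frameSub_fixed (h : IsAdapted F k p c T T') {N : Matrix (Fin l) (Fin l) ℂ}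
    (hN : IsSupported c tripleBlocks N) : frameSub c (unipInv N * T) {0, 1, 2} = F := by
  have hN' := hN.mono tripleBlocks_subset
  refine Submodule.eq_of_le_of_finrank_eq ?_ ?_
  · refine frameSub_le (hN'.mul_inv_mul h.mul_eq_one) fun b hb => ?_
    refine h.col_mem_fixed hb fun a ha => hN a b ?_
    revert ha hb
    generalize c a = x
    generalize c b = y
    revert x y
    decide
  · rw [finrank_flag h.mul_eq_one hN', h.fixed]

theorem mem_schubertStratum_of_finrank_eq {V V' : Submodule ℂ (Fin l → ℂ)}
    (h1 : Module.finrank ℂ V = Module.finrank ℂ V')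
    (h2 : Module.finrank ℂ ↥(V ⊓ F) = Module.finrank ℂ ↥(V' ⊓ F))
    (h : V' ∈ schubertStratum F k q) : V ∈ schubertStratum F k q := by
  obtain ⟨⟨ha, hb⟩, hc⟩ := h
  exact ⟨⟨h1.trans ha, by rwa [h2]⟩, fun hd => hc ⟨ha, by rw [← h2]; exact hd.2⟩⟩

/-- A point of the big cell of `tildeDeltaZero`. -/
def IsAdaptedTriple.point (h : IsAdaptedTriple F k p q c T T')
    (a : BlockIndex c tripleBlocks → ℂ) : Locus (tildeDeltaZero F k p q) where
  sub := flagPoint c T (blockMat c tripleBlocks a) tripleColors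
  mem := by
    have hN := isSupported_blockMat (c := c) (s := tripleBlocks) a
    have hN' := hN.mono tripleBlocks_subset
    have hF := h.frameSub_fixed hN
    refine ⟨frameSub_mono (by decide), ?_, ?_, ?_, frameSub_mono (by decide), ?_⟩
    · conv_rhs => rw [← hF]
      exact frameSub_mono (by decide)
    · exact (finrank_flag h.mul_eq_one hN' _).trans h.finrank_left
    · exact (finrank_flag h.mul_eq_one hN' _).trans h.finrank_mid
    · have e1 : Module.finrank ℂ (frameSub c (unipInv (blockMat c tripleBlocks a) * T) {0, 1, 3}) =
          Module.finrank ℂ (frameSub c T {0, 1, 3}) := finrank_flag h.mul_eq_one hN' _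
      have e2 : Module.finrank ℂ
          ↥(frameSub c (unipInv (blockMat c tripleBlocks a) * T) {0, 1, 3} ⊓ F) =
          Module.finrank ℂ ↥(frameSub c T {0, 1, 3} ⊓ F) := by
        conv_lhs => rw [← hF]
        conv_rhs => rw [← h.fixed]
        rw [frameSub_inf, frameSub_inf, finrank_flag h.mul_eq_one hN']
      exact mem_schubertStratum_of_finrank_eq e1 e2 h.mem_stratum

theorem incl_point_sub (h : IsAdaptedTriple F k p q c T T') (a : BlockIndex c tripleBlocks → ℂ) :
    (incl F k p q (h.point a)).sub = flagPoint c T (blockMat c tripleBlocks a) pairColors := by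
  funext i
  fin_cases i <;> rfl

theorem blockMat_entries {N : Matrix (Fin l) (Fin l) ℂ} (hN : IsSupported c s N) :
    blockMat c s (fun i => N i.1.1 i.1.2) = N := by
  funext u v
  by_cases h : (c u, c v) ∈ s
  · rw [blockMat_apply h]
  · rw [isSupported_blockMat _ u v h, hN u v h]

/-- The parameters of the big cell of `tildeDeltaZero` among those of the big cell of
`tildeDelta`. -/
def tripleIndex (c : Fin l → Fin 5) (i : BlockIndex c tripleBlocks) : BlockIndex c pairBlocks :=
  ⟨i.1, tripleBlocks_subset i.2⟩

/-- The remaining parameters, in the block `Hom(Z / W, ℂ^l / (V + F))`. -/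
def normalIndex (c : Fin l → Fin 5) (i : {a // c a = 4} × {b // c b = 1}) :
    BlockIndex c pairBlocks :=
  ⟨(i.1.1, i.2.1), by rw [i.1.2, i.2.2]; decide⟩

theorem normalIndex_injective : Function.Injective (normalIndex c) := by
  rintro ⟨⟨a, ha⟩, ⟨b, hb⟩⟩ ⟨⟨a', ha'⟩, ⟨b', hb'⟩⟩ h
  have h' := congrArg Subtype.val h
  simp only [normalIndex, Prod.mk.injEq] at h'
  simp [h'.1, h'.2]

theorem mem_range_tripleIndex_or (i : BlockIndex c pairBlocks) :
    i ∈ Set.range (tripleIndex c) ∨ i ∈ Set.range (normalIndex c) := by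
  obtain ⟨⟨u, v⟩, h⟩ := i
  have key : ∀ x ∈ pairBlocks, x ∈ tripleBlocks ∨ x = (4, 1) := by decide
  rcases key _ h with h' | h'
  · exact Or.inl ⟨⟨(u, v), h'⟩, rfl⟩
  · rw [Prod.mk.injEq] at h'
    exact Or.inr ⟨(⟨u, h'.1⟩, ⟨v, h'.2⟩), rfl⟩

/-- The condition on `Z` is automatic. Its complement has colours `2`, `3`, `4` and meets `F` in
colour `2`, which lies in the complement of `V`. So `Z` meets it only inside the intersection of `V`
with the complement of `V`, which is zero. -/
theorem IsAdaptedTriple.inChart_incl_iff (h : IsAdaptedTriple F k p q c T T')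
    (y : Locus (tildeDeltaZero F k p q)) :
    InChart (flagCompl c T pairColors) (incl F k p q y) ↔
      InChart (flagCompl c T tripleColors) y := by
  constructor
  · intro hy
    have h2 : IsCompl (y.sub 2) (frameSub c T {0, 1, 3}ᶜ) := hy 1
    have h1 : IsCompl (y.sub 1) (frameSub c T {0, 1}ᶜ) := by
      have hdisj : Disjoint (y.sub 1) (frameSub c T {0, 1}ᶜ) := by
        have hle : y.sub 1 ⊓ frameSub c T {0, 1}ᶜ ≤ y.sub 2 ⊓ frameSub c T {0, 1, 3}ᶜ := by
          refine le_inf (inf_le_left.trans y.mem.2.2.2.2.1) ?_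
          refine (inf_le_inf_right _ (y.mem.2.1.trans h.fixed.ge)).trans ?_
          rw [frameSub_inf]
          exact frameSub_mono (by decide)
        rw [disjoint_iff, eq_bot_iff, ← h2.inf_eq_bot]
        exact hle
      refine ⟨hdisj, ?_⟩
      · have hd : Module.finrank ℂ (y.sub 1) = Module.finrank ℂ (frameSub c T {0, 1}) :=
          y.mem.2.2.2.1.trans h.finrank_mid.symm
        have hc := isCompl_frameSub (c := c) h.mul_eq_one {0, 1}
        have e := Submodule.finrank_add_eq_of_isCompl hc
        have e' := Submodule.finrank_sup_add_finrank_inf_eq (y.sub 1) (frameSub c T {0, 1}ᶜ)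
        rw [hdisj.eq_bot, finrank_bot, add_zero, hd, e] at e'
        exact codisjoint_iff.2 (Submodule.eq_top_of_finrank_eq e')
    intro i
    fin_cases i
    exacts [hy 0, h1, hy 1]
  · intro hy i
    fin_cases i
    exacts [hy 0, hy 2]

theorem pairParam_incl {i : BlockIndex c pairBlocks} (hi : c i.1.2 ≠ 0)
    (y : Locus (tildeDeltaZero F k p q)) : pairParam c T T' (incl F k p q y) i =
      (T * projMat (y.sub 2) (frameSub c T {0, 1, 3}ᶜ) * T') i.1.1 i.1.2 := by
  have hslot : slot (c i.1.2) = 1 := if_neg hi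
  rw [pairParam, hslot]
  rfl

/-- Let `w` be the projection to `Z` of a basis vector of colour `1`. Their difference lies in `F`
and in the complement of `Z`, so it has colour `2` and lies in the complement of `V`. Hence `w` is
also the projection to `V`, and it has no component of colour `4` because `w ∈ F`. -/
theorem IsAdaptedTriple.pairParam_normalIndex (h : IsAdaptedTriple F k p q c T T')
    {y : Locus (tildeDeltaZero F k p q)} (hy : InChart (flagCompl c T tripleColors) y)
    (i : {a // c a = 4} × {b // c b = 1}) :
    pairParam c T T' (incl F k p q y) (normalIndex c i) = 0 := by
  obtain ⟨⟨a, ha⟩, ⟨b, hb⟩⟩ := i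
  have h1 : IsCompl (y.sub 1) (frameSub c T {0, 1}ᶜ) := hy 1
  have h2 : IsCompl (y.sub 2) (frameSub c T {0, 1, 3}ᶜ) := hy 2
  set w := (projMat (y.sub 1) (frameSub c T {0, 1}ᶜ)).mulVec (T'.mulVec (Pi.single b 1)) with hw
  have hwZ : w ∈ y.sub 1 := projMat_mulVec_mem h1 _
  have hwF : w ∈ frameSub c T {0, 1, 2} := by
    rw [h.fixed]
    exact y.mem.2.1 hwZ
  have hbF : T'.mulVec (Pi.single b 1) ∈ frameSub c T {0, 1, 2} := by
    rw [mulVec_mem_frameSub h.mul_eq_one]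
    intro d hd
    rw [Pi.single_apply, if_neg]
    rintro rfl
    exact hd (by simp [hb])
  have hdiff : T'.mulVec (Pi.single b 1) - w ∈ frameSub c T {0, 1, 3}ᶜ := by
    have hm : T'.mulVec (Pi.single b 1) - w ∈
        frameSub c T {0, 1}ᶜ ⊓ frameSub c T {0, 1, 2} :=
      ⟨sub_projMat_mulVec_mem h1 _, sub_mem hbF hwF⟩
    rw [frameSub_inf] at hm
    exact frameSub_mono (by decide) hm
  have e := projMat_mulVec_eq h2 (y.mem.2.2.2.2.1 hwZ) hdiff
  rw [pairParam_incl (i := normalIndex c (⟨a, ha⟩, ⟨b, hb⟩)) (by simp [normalIndex, hb]),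
    mul_mul_apply_eq_mulVec]
  exact (congrArg (fun v => T.mulVec v a) e).trans (hwF a (by rw [ha]; decide))

/-- The parameters of the big cell of `tildeDeltaZero`. -/
def tripleParam (c : Fin l → Fin 5) (T T' : Matrix (Fin l) (Fin l) ℂ)
    (y : Locus (tildeDeltaZero F k p q)) (i : BlockIndex c tripleBlocks) : ℂ :=
  pairParam c T T' (incl F k p q y) (tripleIndex c i)

theorem IsAdaptedTriple.blockMat_tripleParam (h : IsAdaptedTriple F k p q c T T')
    {y : Locus (tildeDeltaZero F k p q)} (hy : InChart (flagCompl c T tripleColors) y) :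
    blockMat c tripleBlocks (tripleParam c T T' y) =
      blockMat c pairBlocks (pairParam c T T' (incl F k p q y)) := by
  funext u v
  by_cases hu : (c u, c v) ∈ pairBlocks
  · rw [blockMat_apply hu]
    rcases mem_range_tripleIndex_or ⟨(u, v), hu⟩ with ⟨i, hi⟩ | ⟨i, hi⟩
    · have hu' : (c u, c v) ∈ tripleBlocks := by
        have := i.2
        rwa [show i.1 = (u, v) from congrArg Subtype.val hi] at this
      rw [blockMat_apply hu']
      rfl
    · rw [← hi, h.pairParam_normalIndex hy]
      refine isSupported_blockMat _ u v ?_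
      have e : (i.1.1, i.2.1) = (u, v) := congrArg Subtype.val hi
      rw [Prod.mk.injEq] at e
      rw [← e.1, ← e.2, i.1.2, i.2.2]
      decide
  · rw [isSupported_blockMat _ u v hu, isSupported_blockMat _ u v fun h => hu
      (tripleBlocks_subset h)]

theorem projMat_incl (y : Locus (tildeDeltaZero F k p q)) (j : Fin 2) :
    projMat ((incl F k p q y).sub j) (flagCompl c T pairColors j) =
      projMat (y.sub ((![0, 2] : Fin 2 → Fin 3) j))
        (flagCompl c T tripleColors ((![0, 2] : Fin 2 → Fin 3) j)) := by
  fin_cases j <;> rfl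

/-- The big cell of `tildeDeltaZero`. -/
def IsAdaptedTriple.chartZero (h : IsAdaptedTriple F k p q c T T') :
    AffineChart (tildeDeltaZero F k p q) (BlockIndex c tripleBlocks) where
  compl := flagCompl c T tripleColors
  point := h.point
  param := tripleParam c T T'
  inChart a := inChart_of_flagPoint tripleColors_mem h.mul_eq_one
    ((isSupported_blockMat a).mono tripleBlocks_subset) rfl
  coord_poly := coord_poly_of_flagPoint tripleColors_mem h.mul_eq_one tripleBlocks_subset
    fun _ => rfl
  param_poly i := by
    obtain ⟨P, hP⟩ := pairParam_mem (c := c) (T := T) (T' := T')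
      (R := polyFun (coord (S := tildeDeltaZero F k p q) (flagCompl c T tripleColors)) Set.univ)
      (x := incl F k p q) (fun j u v =>
        ⟨MvPolynomial.X ((![0, 2] : Fin 2 → Fin 3) j, u, v), fun y _ => by
          rw [MvPolynomial.eval_X]
          exact congrFun (congrFun (projMat_incl y j) u) v⟩)
      (tripleIndex c i)
    exact ⟨P, fun y _ => hP y trivial⟩
  param_point a := by
    have hN := (isSupported_blockMat (c := c) (s := tripleBlocks) a).mono tripleBlocks_subset
    funext i
    rw [tripleParam, h.pairParam_eq
      (fun i => blockMat c tripleBlocks a i.1.1 i.1.2)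
      (by rw [incl_point_sub, blockMat_entries hN])]
    exact blockMat_apply i.2 a
  point_param y hy := by
    -- `Z` is determined by `V`, so it is enough to compare the pairs `(W, V)`.
    apply incl_injective
    have e : (incl F k p q (h.point (tripleParam c T T' y))).sub = (incl F k p q y).sub := by
      rw [incl_point_sub, h.blockMat_tripleParam hy,
        h.flagPoint_pairParam ((h.inChart_incl_iff y).2 hy)]
    generalize incl F k p q (h.point (tripleParam c T T' y)) = w at e ⊢
    generalize incl F k p q y = w' at e ⊢
    cases w
    cases w'
    simpa using e

theorem IsAdaptedTriple.isCoordinateInclusion (h : IsAdaptedTriple F k p q c T T') :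
    IsCoordinateInclusion (incl F k p q) h.chartZero h.chart (tripleIndex c) (normalIndex c) where
  mem_range := mem_range_tripleIndex_or
  inChart_iff := h.inChart_incl_iff
  param_left _ _ _ := rfl
  param_right _ hz i := h.pairParam_normalIndex hz i

/-! ### Covering by big cells: smoothness and the subvariety -/

theorem exists_isAdapted (x : Locus (tildeDelta F k p)) :
    ∃ (c : Fin l → Fin 5) (T T' : Matrix (Fin l) (Fin l) ℂ) (h : IsAdapted F k p c T T'),
      InChart h.chart.compl x := by
  obtain ⟨h1, h2, h3, h4⟩ := x.mem
  obtain ⟨c, T, T', hT, hW, hZ, hF, hV⟩ := exists_adapted_frame h4 h1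
  refine ⟨c, T, T', ⟨hT, hF, by rw [hW, h2], by rw [hV, h3]⟩, fun i => ?_⟩
  fin_cases i
  · change IsCompl (x.sub 0) (frameSub c T {0}ᶜ)
    rw [← hW]
    exact isCompl_frameSub hT _
  · change IsCompl (x.sub 1) (frameSub c T {0, 1, 3}ᶜ)
    rw [← hV]
    exact isCompl_frameSub hT _

theorem exists_isAdaptedTriple (y : Locus (tildeDeltaZero F k p q)) :
    ∃ (c : Fin l → Fin 5) (T T' : Matrix (Fin l) (Fin l) ℂ) (h : IsAdaptedTriple F k p q c T T'),
      InChart h.chartZero.compl y := by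
  have hmid := tildeDeltaZero_mid_eq y
  obtain ⟨h1, h2, h3, h4, h5, h6⟩ := y.mem
  obtain ⟨c, T, T', hT, hW, hZ, hF, hV⟩ := exists_adapted_frame (h1.trans h5) (h1.trans h2)
  rw [← hmid] at hZ
  refine ⟨c, T, T', ⟨⟨hT, hF, by rw [hW, h3], by rw [hV, h6.1.1]⟩, by rw [hZ, h4],
    by rwa [hV]⟩, fun i => ?_⟩
  fin_cases i
  · change IsCompl (y.sub 0) (frameSub c T {0}ᶜ)
    rw [← hW]
    exact isCompl_frameSub hT _
  · change IsCompl (y.sub 1) (frameSub c T {0, 1}ᶜ)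
    rw [← hZ]
    exact isCompl_frameSub hT _
  · change IsCompl (y.sub 2) (frameSub c T {0, 1, 3}ᶜ)
    rw [← hV]
    exact isCompl_frameSub hT _

theorem isSmooth_tildeDelta (F : Submodule ℂ (Fin l → ℂ)) (k p : ℕ) :
    IsSmooth (tildeDelta F k p) := by
  intro x
  obtain ⟨c, T, T', h, hx⟩ := exists_isAdapted x
  exact h.chart.isRegularLocalRing hx

theorem isSmooth_tildeDeltaZero (F : Submodule ℂ (Fin l → ℂ)) (k p q : ℕ) :
    IsSmooth (tildeDeltaZero F k p q) := by
  intro y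
  obtain ⟨c, T, T', h, hy⟩ := exists_isAdaptedTriple y
  exact h.chartZero.isRegularLocalRing hy

theorem isSubvariety_incl (F : Submodule ℂ (Fin l → ℂ)) (k p q : ℕ) :
    IsSubvariety (incl F k p q) := by
  refine isSubvariety_of_isCoordinateInclusion (isMorphism_incl F k p q) fun y => ?_
  obtain ⟨c, T, T', h, hy⟩ := exists_isAdaptedTriple y
  exact ⟨_, _, _, h.chartZero, h.chart, _, _, hy, h.isCoordinateInclusion⟩

end Cell

/-! ### Derivatives of matrix functions -/

section Derivative

variable {ι : Type} {l : ℕ} {S : Set (ι → Submodule ℂ (Fin l → ℂ))} {x : Locus S}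

/-- The entries of `M` are regular near `x`. -/
def IsRegularMat (M : Locus S → Matrix (Fin l) (Fin l) ℂ) (x : Locus S) : Prop :=
  ∀ u v, IsRegularAt (fun z => M z u v) x

open Classical in
/-- The derivative of a function in the direction of a tangent vector. -/
def tderiv (D : tangentSpace x) (f : Locus S → ℂ) : ℂ :=
  if h : IsRegularAt f x then (D : localRing x →ₗ[ℂ] ℂ) (toGerm f x h) else 0

theorem tderiv_eq (D : tangentSpace x) {f : Locus S → ℂ} (h : IsRegularAt f x) :
    tderiv D f = (D : localRing x →ₗ[ℂ] ℂ) (toGerm f x h) := dif_pos h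

/-- The derivative of a matrix function in the direction of a tangent vector. -/
def dMat (D : tangentSpace x) (M : Locus S → Matrix (Fin l) (Fin l) ℂ) :
    Matrix (Fin l) (Fin l) ℂ :=
  Matrix.of fun u v => tderiv D fun z => M z u v

theorem dMat_apply (D : tangentSpace x) (M : Locus S → Matrix (Fin l) (Fin l) ℂ) (u v : Fin l) :
    dMat D M u v = tderiv D fun z => M z u v := rfl

theorem isRegularMat_const (A : Matrix (Fin l) (Fin l) ℂ) : IsRegularMat (fun _ => A) x :=
  fun _ _ => isRegularAt_const _ x

theorem IsRegularMat.mul {M N : Locus S → Matrix (Fin l) (Fin l) ℂ} (hM : IsRegularMat M x)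
    (hN : IsRegularMat N x) : IsRegularMat (fun z => M z * N z) x :=
  mul_mem_of_forall (A := regularAt x) hM hN

theorem IsRegularMat.add {M N : Locus S → Matrix (Fin l) (Fin l) ℂ} (hM : IsRegularMat M x)
    (hN : IsRegularMat N x) : IsRegularMat (fun z => M z + N z) x :=
  fun u v => (hM u v).add (hN u v)

theorem IsRegularMat.sub {M N : Locus S → Matrix (Fin l) (Fin l) ℂ} (hM : IsRegularMat M x)
    (hN : IsRegularMat N x) : IsRegularMat (fun z => M z - N z) x :=
  fun u v => (regularAt x).sub_mem (hM u v) (hN u v)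

theorem tderiv_add_left (D D' : tangentSpace x) (f : Locus S → ℂ) :
    tderiv (D + D') f = tderiv D f + tderiv D' f := by
  by_cases h : IsRegularAt f x
  · rw [tderiv_eq _ h, tderiv_eq _ h, tderiv_eq _ h]
    rfl
  · rw [tderiv, tderiv, tderiv, dif_neg h, dif_neg h, dif_neg h, add_zero]

theorem tderiv_smul_left (a : ℂ) (D : tangentSpace x) (f : Locus S → ℂ) :
    tderiv (a • D) f = a * tderiv D f := by
  by_cases h : IsRegularAt f x
  · rw [tderiv_eq _ h, tderiv_eq _ h]
    rfl
  · rw [tderiv, tderiv, dif_neg h, dif_neg h, mul_zero]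

theorem tderiv_const (D : tangentSpace x) (a : ℂ) : tderiv D (fun _ => a) = 0 := by
  have h : toGerm (fun _ => a) x (isRegularAt_const a x) = algebraMap ℂ (localRing x) a :=
    Subtype.ext (germ_algebraMap _ a).symm
  rw [tderiv_eq D (isRegularAt_const a x), h, Algebra.algebraMap_eq_smul_one, map_smul,
    tangent_one, smul_zero]

theorem tderiv_add (D : tangentSpace x) {f g : Locus S → ℂ} (hf : IsRegularAt f x)
    (hg : IsRegularAt g x) : tderiv D (f + g) = tderiv D f + tderiv D g := by
  rw [tderiv_eq D hf, tderiv_eq D hg, tderiv_eq D (hf.add hg), ← map_add]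
  rfl

theorem tderiv_mul (D : tangentSpace x) {f g : Locus S → ℂ} (hf : IsRegularAt f x)
    (hg : IsRegularAt g x) : tderiv D (f * g) = f x * tderiv D g + g x * tderiv D f := by
  rw [tderiv_eq D hf, tderiv_eq D hg, tderiv_eq D (hf.mul hg)]
  exact D.2 (toGerm f x hf) (toGerm g x hg)

theorem dMat_add_left (D D' : tangentSpace x) (M : Locus S → Matrix (Fin l) (Fin l) ℂ) :
    dMat (D + D') M = dMat D M + dMat D' M := by
  ext u v
  exact tderiv_add_left D D' _

theorem dMat_smul_left (a : ℂ) (D : tangentSpace x) (M : Locus S → Matrix (Fin l) (Fin l) ℂ) :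
    dMat (a • D) M = a • dMat D M := by
  ext u v
  exact tderiv_smul_left a D _

theorem dMat_const (D : tangentSpace x) (A : Matrix (Fin l) (Fin l) ℂ) :
    dMat D (fun _ => A) = 0 := by
  ext u v
  exact tderiv_const D _

theorem tderiv_sum (D : tangentSpace x) {n : Type} (s : Finset n) {f : n → Locus S → ℂ}
    (hf : ∀ i, IsRegularAt (f i) x) : tderiv D (∑ i ∈ s, f i) = ∑ i ∈ s, tderiv D (f i) := by
  classical
  induction s using Finset.induction_on with
  | empty => exact tderiv_const D 0
  | insert i s hi ih =>
    rw [Finset.sum_insert hi, Finset.sum_insert hi,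
      tderiv_add D (hf i) ((regularAt x).sum_mem fun i _ => hf i), ih]

theorem dMat_mul (D : tangentSpace x) {M N : Locus S → Matrix (Fin l) (Fin l) ℂ}
    (hM : IsRegularMat M x) (hN : IsRegularMat N x) :
    dMat D (fun z => M z * N z) = dMat D M * N x + M x * dMat D N := by
  ext u v
  have e : (fun z => (M z * N z) u v) =
      ∑ w, (fun z => M z u w) * fun z => N z w v := by
    funext z
    simp [Matrix.mul_apply, Finset.sum_apply]
  rw [dMat_apply, e, tderiv_sum D _ fun w => (hM u w).mul (hN w v), Matrix.add_apply,
    Matrix.mul_apply, Matrix.mul_apply, ← Finset.sum_add_distrib]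
  refine Finset.sum_congr rfl fun w _ => ?_
  rw [tderiv_mul D (hM u w) (hN w v), dMat_apply, dMat_apply]
  ring

variable [Fintype ι]

theorem tderiv_congr (D : tangentSpace x) {f g : Locus S → ℂ} (hg : IsRegularAt g x)
    (h : f =ᶠ[𝓝 x] g) : tderiv D f = tderiv D g := by
  rw [tderiv_eq D hg, tderiv_eq D (hg.congr h)]
  exact congrArg (D : localRing x →ₗ[ℂ] ℂ) (localRing_ext h)

theorem dMat_congr (D : tangentSpace x) {M N : Locus S → Matrix (Fin l) (Fin l) ℂ}
    (hN : IsRegularMat N x) (h : ∀ᶠ z in 𝓝 x, M z = N z) : dMat D M = dMat D N := by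
  ext u v
  refine tderiv_congr D (hN u v) ?_
  filter_upwards [h] with z hz
  rw [hz]

theorem dMat_mulVec_eq_zero (D : tangentSpace x) {M : Locus S → Matrix (Fin l) (Fin l) ℂ}
    (hM : IsRegularMat M x) {n : Fin l → ℂ} (h : ∀ᶠ z in 𝓝 x, (M z).mulVec n = 0) :
    (dMat D M).mulVec n = 0 := by
  -- The constant vector `n` is repeated in every column, so that the product rule for matrices
  -- applies.
  have e : dMat D (fun z => M z * Matrix.of fun u _ => n u) = dMat D fun _ => 0 := by
    refine dMat_congr D (isRegularMat_const 0) ?_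
    filter_upwards [h] with z hz
    ext u v
    exact congrFun hz u
  rw [dMat_mul D hM (isRegularMat_const _), dMat_const, dMat_const, mul_zero, add_zero] at e
  funext u
  exact congrFun (congrFun e u) u

theorem isRegularMat_projMat {C : ι → Submodule ℂ (Fin l → ℂ)} (hC : InChart C x) (i : ι) :
    IsRegularMat (fun z : Locus S => projMat (z.sub i) (C i)) x :=
  fun u v => isRegularAt_coord hC (i, u, v)

theorem projMat_mul_projMat {V W C C' : Submodule ℂ (Fin l → ℂ)} (h : IsCompl V C)
    (h' : IsCompl W C') (hWV : W ≤ V) : projMat V C * projMat W C' = projMat W C' := by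
  apply Matrix.toLin'.injective
  refine LinearMap.ext fun u => ?_
  rw [Matrix.toLin'_apply, Matrix.toLin'_apply, ← Matrix.mulVec_mulVec]
  exact projMat_mulVec_of_mem h (hWV (projMat_mulVec_mem h' u))

/-- The derivatives of the projectors to subspaces `W ⊆ V` agree on `W` up to `V`. -/
theorem dMat_projMat_sub_mem (D : tangentSpace x) {C C' : ι → Submodule ℂ (Fin l → ℂ)}
    (hC : InChart C x) (hC' : InChart C' x) {i j : ι} (hij : ∀ z : Locus S, z.sub i ≤ z.sub j)
    {w : Fin l → ℂ} (hw : w ∈ x.sub i) :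
    (dMat D fun z => projMat (z.sub i) (C' i)).mulVec w -
      (dMat D fun z => projMat (z.sub j) (C j)).mulVec w ∈ x.sub j := by
  -- Differentiating `P_V P_W = P_W` and evaluating at `w = P_W w` gives `P_W' w - P_V' w = P_V
  -- (P_W' w)`, an element of `V`.
  have e : dMat D (fun z => projMat (z.sub j) (C j) * projMat (z.sub i) (C' i)) =
      dMat D fun z => projMat (z.sub i) (C' i) := by
    refine dMat_congr D (isRegularMat_projMat hC' i) ?_
    filter_upwards [(isOpen_inChart C).mem_nhds hC, (isOpen_inChart C').mem_nhds hC'] with z hz hz'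
    exact projMat_mul_projMat (hz j) (hz' i) (hij z)
  rw [dMat_mul D (isRegularMat_projMat hC j) (isRegularMat_projMat hC' i)] at e
  rw [← e, Matrix.add_mulVec, ← Matrix.mulVec_mulVec, ← Matrix.mulVec_mulVec,
    projMat_mulVec_of_mem (hC' i) hw, add_sub_cancel_left]
  exact projMat_mulVec_mem (hC j) _

/-- The derivative of the projector to a subspace of a fixed subspace `F` has values in `F`. -/
theorem dMat_projMat_mem (D : tangentSpace x) {C : ι → Submodule ℂ (Fin l → ℂ)}
    (hC : InChart C x) {i : ι} {F : Submodule ℂ (Fin l → ℂ)} (hF : ∀ z : Locus S, z.sub i ≤ F)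
    (w : Fin l → ℂ) : (dMat D fun z => projMat (z.sub i) (C i)).mulVec w ∈ F := by
  obtain ⟨B, hB⟩ := exists_isCompl F
  -- `projMat B F` is a constant projector with kernel `F`. Its product with the projector to a
  -- subspace of `F` is identically zero, and so is the derivative.
  have e : dMat D (fun z => projMat B F * projMat (z.sub i) (C i)) = dMat D fun _ => 0 := by
    refine dMat_congr D (isRegularMat_const 0) ?_
    filter_upwards [(isOpen_inChart C).mem_nhds hC] with z hz
    apply Matrix.toLin'.injective
    refine LinearMap.ext fun u => ?_
    rw [Matrix.toLin'_apply, Matrix.toLin'_apply, ← Matrix.mulVec_mulVec, Matrix.zero_mulVec]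
    exact projMat_mulVec_of_mem_right hB.symm (hF z (projMat_mulVec_mem (hz i) u))
  rw [dMat_mul D (isRegularMat_const _) (isRegularMat_projMat hC i), dMat_const, dMat_const,
    zero_mul, zero_add] at e
  have h := sub_projMat_mulVec_mem hB.symm ((dMat D fun z => projMat (z.sub i) (C i)).mulVec w)
  rwa [Matrix.mulVec_mulVec, e, Matrix.zero_mulVec, sub_zero] at h

end Derivative

/-! ### The homomorphism from the normal bundle to `Hom(S_q / S_p, J_{pq})` -/

section Normal

variable {l : ℕ} {F : Submodule ℂ (Fin l → ℂ)} {k p q : ℕ}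

/-- A tangent vector at `(W, V)` moves the vectors of `V` modulo `V + F`. -/
def moveMap (F : Submodule ℂ (Fin l → ℂ)) {k p : ℕ} (x : Locus (tildeDelta F k p))
    (D : tangentSpace x) : (Fin l → ℂ) →ₗ[ℂ] (Fin l → ℂ) ⧸ (x.sub 1 ⊔ F) :=
  (x.sub 1 ⊔ F).mkQ.comp
    (dMat D fun z => projMat (z.sub 1) ((exists_inChart x).choose 1)).mulVecLin

/-- This is `dMat_projMat_sub_mem` for `V ⊆ V` with two different complements: the derivatives
differ on `V` by vectors of `V`. -/
theorem moveMap_apply_eq {x : Locus (tildeDelta F k p)} (D : tangentSpace x)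
    {C : Fin 2 → Submodule ℂ (Fin l → ℂ)} (hC : InChart C x) {v : Fin l → ℂ} (hv : v ∈ x.sub 1) :
    moveMap F x D v =
      (x.sub 1 ⊔ F).mkQ ((dMat D fun z => projMat (z.sub 1) (C 1)).mulVec v) := by
  rw [← sub_eq_zero]
  refine (map_sub (x.sub 1 ⊔ F).mkQ _ _).symm.trans ((Submodule.Quotient.mk_eq_zero _).2 ?_)
  exact Submodule.mem_sup_left
    (dMat_projMat_sub_mem D hC (exists_inChart x).choose_spec (fun _ => le_rfl) hv)

/-- On `W` the derivative of the projector to `V` agrees modulo `V` with that of the projector to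
`W`, and the latter has values in `F` because `W` never leaves `F`. -/
theorem moveMap_eq_zero {x : Locus (tildeDelta F k p)} (D : tangentSpace x) {w : Fin l → ℂ}
    (hw : w ∈ x.sub 0) : moveMap F x D w = 0 := by
  have hC := (exists_inChart x).choose_spec
  refine (Submodule.Quotient.mk_eq_zero _).2 ?_
  have h1 := dMat_projMat_sub_mem D hC hC (fun z : Locus (tildeDelta F k p) => z.mem.2.2.2) hw
  have h2 := dMat_projMat_mem D hC (fun z : Locus (tildeDelta F k p) => z.mem.1) w
  have h := sub_mem (Submodule.mem_sup_right (S := x.sub 1) h2) (Submodule.mem_sup_left (T := F) h1)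
  rwa [sub_sub_cancel] at h

/-- The map `T_{(W, V)} → Hom(Z / W, ℂ^l / (V + F))`. -/
def tangentToHom (y : Locus (tildeDeltaZero F k p q)) :
    tangentSpace (incl F k p q y) →ₗ[ℂ]
      ((y.sub 1) ⧸ (y.sub 0).comap (y.sub 1).subtype) →ₗ[ℂ] ((Fin l → ℂ) ⧸ (y.sub 2 ⊔ F)) where
  toFun D := ((y.sub 0).comap (y.sub 1).subtype).liftQ
    ((moveMap F (incl F k p q y) D).comp (y.sub 1).subtype)
    fun z hz => moveMap_eq_zero (x := incl F k p q y) D hz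
  map_add' D D' := by
    refine Submodule.linearMap_qext _ (LinearMap.ext fun z => ?_)
    change (y.sub 2 ⊔ F).mkQ ((dMat (D + D') _).mulVec z.1) =
      (y.sub 2 ⊔ F).mkQ ((dMat D _).mulVec z.1) + (y.sub 2 ⊔ F).mkQ ((dMat D' _).mulVec z.1)
    rw [dMat_add_left, Matrix.add_mulVec, map_add]
  map_smul' a D := by
    refine Submodule.linearMap_qext _ (LinearMap.ext fun z => ?_)
    change (y.sub 2 ⊔ F).mkQ ((dMat (a • D) _).mulVec z.1) =
      a • (y.sub 2 ⊔ F).mkQ ((dMat D _).mulVec z.1)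
    rw [dMat_smul_left, Matrix.smul_mulVec, map_smul]

theorem tangentToHom_mkQ (y : Locus (tildeDeltaZero F k p q)) (D : tangentSpace (incl F k p q y))
    {C : Fin 2 → Submodule ℂ (Fin l → ℂ)} (hC : InChart C (incl F k p q y)) (z : y.sub 1) :
    tangentToHom y D (((y.sub 0).comap (y.sub 1).subtype).mkQ z) =
      (y.sub 2 ⊔ F).mkQ ((dMat D fun x => projMat (x.sub 1) (C 1)).mulVec z.1) :=
  moveMap_apply_eq D hC (y.mem.2.2.2.2.1 z.2)

/-! ### Moving frames and trivializations over a big cell -/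

/-- The matrix whose columns of colours `0`, `{0, 1}` and `{0, 1, 3}` span `W`, `Z` and `V`. -/
def cellFrame (c : Fin l → Fin 5) (T T' : Matrix (Fin l) (Fin l) ℂ)
    (y : Locus (tildeDeltaZero F k p q)) : Matrix (Fin l) (Fin l) ℂ :=
  T' * (1 + blockMat c tripleBlocks (tripleParam c T T' y))

/-- The inverse of `cellFrame`. -/
def cellCoframe (c : Fin l → Fin 5) (T T' : Matrix (Fin l) (Fin l) ℂ)
    (y : Locus (tildeDeltaZero F k p q)) : Matrix (Fin l) (Fin l) ℂ :=
  unipInv (blockMat c tripleBlocks (tripleParam c T T' y)) * T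

namespace IsAdaptedTriple

variable {c : Fin l → Fin 5} {T T' : Matrix (Fin l) (Fin l) ℂ}

theorem cellCoframe_mul_cellFrame (h : IsAdaptedTriple F k p q c T T')
    (y : Locus (tildeDeltaZero F k p q)) : cellCoframe c T T' y * cellFrame c T T' y = 1 :=
  ((isSupported_blockMat _).mono tripleBlocks_subset).mul_inv_mul h.mul_eq_one

theorem cellFrame_mul_cellCoframe (h : IsAdaptedTriple F k p q c T T')
    (y : Locus (tildeDeltaZero F k p q)) : cellFrame c T T' y * cellCoframe c T T' y = 1 :=
  mul_eq_one_comm.1 (h.cellCoframe_mul_cellFrame y)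

theorem sub_eq (h : IsAdaptedTriple F k p q c T T') {y : Locus (tildeDeltaZero F k p q)}
    (hy : InChart h.chart.compl (incl F k p q y)) (i : Fin 3) :
    y.sub i = frameSub c (cellCoframe c T T' y) (tripleColors i) :=
  (congrArg (fun z : Locus (tildeDeltaZero F k p q) => z.sub i)
    (h.chartZero.point_param y ((h.inChart_incl_iff y).1 hy))).symm

theorem sub_sup_fixed_eq (h : IsAdaptedTriple F k p q c T T')
    {y : Locus (tildeDeltaZero F k p q)} (hy : InChart h.chart.compl (incl F k p q y)) :
    y.sub 2 ⊔ F = frameSub c (cellCoframe c T T' y) {0, 1, 2, 3} := by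
  have hF : frameSub c (cellCoframe c T T' y) {0, 1, 2} = F :=
    h.frameSub_fixed (isSupported_blockMat _)
  refine (congrArg₂ (· ⊔ ·) (h.sub_eq hy 2) hF.symm).trans
    ((frameSub_sup c (h.cellCoframe_mul_cellFrame y) _ _).trans ?_)
  congr 1
  decide

theorem isRegularMat_blockMat (h : IsAdaptedTriple F k p q c T T')
    {y : Locus (tildeDeltaZero F k p q)} (hy : InChart h.chart.compl (incl F k p q y)) :
    IsRegularMat (fun z => blockMat c tripleBlocks (tripleParam c T T' z)) y :=
  blockMat_mem (R := regularAt y)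
    (h.chartZero.isRegularAt_param ((h.inChart_incl_iff y).1 hy))

theorem isRegularMat_cellFrame (h : IsAdaptedTriple F k p q c T T')
    {y : Locus (tildeDeltaZero F k p q)} (hy : InChart h.chart.compl (incl F k p q y)) :
    IsRegularMat (cellFrame c T T') y :=
  (isRegularMat_const T').mul ((isRegularMat_const 1).add (h.isRegularMat_blockMat hy))

theorem isRegularMat_cellCoframe (h : IsAdaptedTriple F k p q c T T')
    {y : Locus (tildeDeltaZero F k p q)} (hy : InChart h.chart.compl (incl F k p q y)) :
    IsRegularMat (cellCoframe c T T') y :=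
  have hN := h.isRegularMat_blockMat hy
  (((isRegularMat_const 1).sub hN).add (hN.mul hN)).mul (isRegularMat_const T)

/-- The matrix of `tangentToHom` in the frame. -/
theorem cellCoframe_dMat_cellFrame (h : IsAdaptedTriple F k p q c T T')
    {y : Locus (tildeDeltaZero F k p q)} (hy : InChart h.chart.compl (incl F k p q y))
    (D : tangentSpace (incl F k p q y)) (i : {a // c a = 4} × {b // c b = 1}) :
    (cellCoframe c T T' y).mulVec ((dMat D fun x => projMat (x.sub 1)
      (frameSub c T {0, 1, 3}ᶜ)).mulVec ((cellFrame c T T' y).mulVec (Pi.single i.2.1 1))) i.1.1 =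
    VectorFamily.tangentCoord h.chart (incl F k p q y) D (normalIndex c i) := by
  obtain ⟨⟨a, ha⟩, ⟨b, hb⟩⟩ := i
  have hT := h.mul_eq_one
  set N := blockMat c tripleBlocks (tripleParam c T T' y) with hNdef
  have hN : IsSupported c tripleBlocks N := isSupported_blockMat _
  set M : Locus (tildeDelta F k p) → Matrix (Fin l) (Fin l) ℂ :=
    fun x => projMat (x.sub 1) (frameSub c T {0, 1, 3}ᶜ) with hM
  have hMreg : IsRegularMat M (incl F k p q y) := isRegularMat_projMat hy 1
  have hev : ∀ᶠ x in 𝓝 (incl F k p q y), IsCompl (x.sub 1) (frameSub c T {0, 1, 3}ᶜ) := by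
    filter_upwards [(isOpen_inChart h.chart.compl).mem_nhds hy] with x hx
    exact hx 1
  -- On the stratum, column `b` of `N` has entries of colour `2` only. It lies in the fixed
  -- complement of `V`, which every nearby projector kills; so replacing the moving frame vector by
  -- the fixed one changes nothing.
  have hzero : (dMat D M).mulVec (T'.mulVec (N.mulVec (Pi.single b 1))) = 0 := by
    refine dMat_mulVec_eq_zero D hMreg ?_
    filter_upwards [hev] with x hx
    refine projMat_mulVec_of_mem_right hx ((mulVec_mem_frameSub hT).2 fun d hd => ?_)
    rw [Matrix.mulVec_single_one, Matrix.col_apply]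
    refine hN d b ?_
    rw [hb]
    revert hd
    generalize c d = e
    revert e
    decide
  have hd : dMat D (fun x => T * M x * T') = T * dMat D M * T' := by
    rw [dMat_mul D ((isRegularMat_const T).mul hMreg) (isRegularMat_const T'),
      dMat_mul D (isRegularMat_const T) hMreg, dMat_const, dMat_const, zero_mul, zero_add,
      mul_zero, add_zero]
  -- In these rows the entries of `T M T'` are constant, so `ξ` below has components of colours `2`
  -- and `4` only.
  have hsupp : ∀ d, c d ∈ ({0, 1, 3} : Finset (Fin 5)) → (T * dMat D M * T') d b = 0 := by
    intro d hd'
    rw [← hd]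
    refine (tderiv_congr D (isRegularAt_const ((1 : Matrix (Fin l) (Fin l) ℂ) d b) _) ?_).trans
      (tderiv_const D _)
    filter_upwards [hev] with x hx
    exact mul_projMat_mul_apply_of_mem hT hx hd' b
  set ξ : Fin l → ℂ := T.mulVec ((dMat D M).mulVec (T'.mulVec (Pi.single b 1))) with hξ
  have hξ' : ∀ d, ξ d = (T * dMat D M * T') d b := fun d =>
    (mul_mul_apply_eq_mulVec T (dMat D M) T' d b).symm
  -- `N` has no columns of colour `2` or `4`. Hence `unipInv N` fixes `ξ`, and the moving coframe
  -- may be replaced by `T`.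
  have hNξ : N.mulVec ξ = 0 := by
    funext d
    change ∑ e, N d e * ξ e = 0
    refine Finset.sum_eq_zero fun e _ => ?_
    by_cases he : c e ∈ ({0, 1, 3} : Finset (Fin 5))
    · rw [hξ', hsupp e he, mul_zero]
    · rw [hN d e, zero_mul]
      revert he
      generalize c e = u
      generalize c d = v
      revert u v
      decide
  have e1 : (cellCoframe c T T' y).mulVec ((dMat D M).mulVec
      ((cellFrame c T T' y).mulVec (Pi.single b 1))) = ξ := by
    rw [cellFrame, ← hNdef, ← Matrix.mulVec_mulVec, Matrix.add_mulVec, Matrix.one_mulVec,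
      Matrix.mulVec_add, Matrix.mulVec_add, hzero, add_zero, cellCoframe, ← hNdef,
      ← Matrix.mulVec_mulVec, ← hξ, unipInv, Matrix.add_mulVec, Matrix.sub_mulVec,
      Matrix.one_mulVec, ← Matrix.mulVec_mulVec, hNξ, Matrix.mulVec_zero, sub_zero, add_zero]
  refine (congrFun e1 a).trans ?_
  rw [hξ', ← hd, VectorFamily.tangentCoord_apply h.chart hy, dMat_apply]
  have hfun : (fun x : Locus (tildeDelta F k p) => (T * M x * T') a b) =
      fun x => h.chart.param x (normalIndex c (⟨a, ha⟩, ⟨b, hb⟩)) := by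
    funext x
    have hslot : slot (c b) = 1 := by
      rw [hb]
      rfl
    change _ = (T * projMat (x.sub (slot (c b))) (flagCompl c T pairColors (slot (c b))) * T') a b
    rw [hslot]
    rfl
  rw [hfun]
  exact tderiv_eq D _

theorem isOpen_cell (h : IsAdaptedTriple F k p q c T T') :
    IsOpen {y | InChart h.chart.compl (incl F k p q y)} :=
  (isOpen_inChart _).preimage (isMorphism_incl F k p q).continuous

theorem mem_mid_iff (h : IsAdaptedTriple F k p q c T T') {y : Locus (tildeDeltaZero F k p q)}
    (hy : InChart h.chart.compl (incl F k p q y)) (v : Fin l → ℂ) : v ∈ y.sub 1 ↔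
      ∀ i ∉ Set.range (Subtype.val : {b // c b = 0 ∨ c b = 1} → Fin l),
        (cellCoframe c T T' y).mulVec v i = 0 := by
  rw [h.sub_eq hy, mem_frameSub]
  have key : ∀ x : Fin 5, x ∈ tripleColors 1 ↔ x = 0 ∨ x = 1 := by decide
  exact forall_congr' fun b => imp_congr_left (not_congr
    ⟨fun hb => ⟨⟨b, (key _).1 hb⟩, rfl⟩, fun ⟨i, hi⟩ => (key _).2 (hi ▸ i.2)⟩)

/-- The indices of the colour `1`, among those of `Z`. -/
def midIndex (c : Fin l → Fin 5) (b : {b // c b = 1}) : {b // c b = 0 ∨ c b = 1} :=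
  ⟨b.1, Or.inr b.2⟩

theorem midIndex_injective : Function.Injective (midIndex c) := by
  intro b b' h
  exact Subtype.ext (congrArg (fun b => b.1) h)

/-- The trivialization of `S_q` in the big cell. -/
def trivSq (h : IsAdaptedTriple F k p q c T T') :
    VectorFamily.Trivialization (VectorFamily.sub fun y : Locus (tildeDeltaZero F k p q) => y.sub 1)
      {y | InChart h.chart.compl (incl F k p q y)} {b // c b = 0 ∨ c b = 1} :=
  VectorFamily.Trivialization.sub (G := cellFrame c T T') (H := cellCoframe c T T') h.isOpen_cell
    Subtype.val_injective (fun y _ => h.cellFrame_mul_cellCoframe y)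
    (fun _ hy => h.isRegularMat_cellFrame hy) (fun _ hy => h.isRegularMat_cellCoframe hy)
    (fun _ hy => h.mem_mid_iff hy)

theorem mem_left_iff (h : IsAdaptedTriple F k p q c T T') {y : Locus (tildeDeltaZero F k p q)}
    (hy : InChart h.chart.compl (incl F k p q y)) {v : Fin l → ℂ} (hv : v ∈ y.sub 1) :
    v ∈ y.sub 0 ↔ ∀ b : {b // c b = 1}, (cellCoframe c T T' y).mulVec v b.1 = 0 := by
  rw [h.sub_eq hy, mem_frameSub] at hv ⊢
  constructor
  · intro hv0 b
    refine hv0 b.1 ?_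
    rw [b.2]
    decide
  · intro hv1 b hb
    by_cases hb1 : c b = 1
    · exact hv1 ⟨b, hb1⟩
    · refine hv b fun hb' => ?_
      rcases Finset.mem_insert.1 hb' with hb' | hb'
      · exact hb (Finset.mem_singleton.2 hb')
      · exact hb1 (Finset.mem_singleton.1 hb')

/-- The trivialization of `S_q / S_p` in the big cell. -/
def trivQuot (h : IsAdaptedTriple F k p q c T T') :
    VectorFamily.Trivialization (quotSqSp F k p q)
      {y | InChart h.chart.compl (incl F k p q y)} {b // c b = 1} :=
  h.trivSq.quot h.isOpen_cell midIndex_injective fun y hy => by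
    ext ⟨v, hv⟩
    exact (h.mem_left_iff hy hv).trans funext_iff.symm

theorem mem_sup_iff (h : IsAdaptedTriple F k p q c T T') {y : Locus (tildeDeltaZero F k p q)}
    (hy : InChart h.chart.compl (incl F k p q y)) (v : Fin l → ℂ) :
    v ∈ y.sub 2 ⊔ F ↔ ∀ a : {a // c a = 4}, (cellCoframe c T T' y).mulVec v a.1 = 0 := by
  rw [h.sub_sup_fixed_eq hy, mem_frameSub]
  have key : ∀ x : Fin 5, x ∉ ({0, 1, 2, 3} : Finset (Fin 5)) ↔ x = 4 := by decide
  exact ⟨fun hv a => hv a.1 ((key _).2 a.2), fun hv a ha => hv ⟨a, (key _).1 ha⟩⟩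

/-- The trivialization of `J_{pq}` in the big cell. -/
def trivJ (h : IsAdaptedTriple F k p q c T T') :
    VectorFamily.Trivialization (bundleJ F k p q)
      {y | InChart h.chart.compl (incl F k p q y)} {a // c a = 4} :=
  (VectorFamily.Trivialization.trivial (G := cellFrame c T T') (H := cellCoframe c T T')
    h.isOpen_cell (fun y _ => h.cellFrame_mul_cellCoframe y)
    (fun _ hy => h.isRegularMat_cellFrame hy)
    (fun _ hy => h.isRegularMat_cellCoframe hy)).quot h.isOpen_cell
    (τ := (Subtype.val : {a // c a = 4} → Fin l)) Subtype.val_injective fun y hy => by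
      exact Submodule.ext fun v => (h.mem_sup_iff hy v).trans funext_iff.symm

theorem trivQuot_coord_mkQ (h : IsAdaptedTriple F k p q c T T')
    {y : Locus (tildeDeltaZero F k p q)} (hy : InChart h.chart.compl (incl F k p q y))
    (z : y.sub 1) (b : {b // c b = 1}) :
    h.trivQuot.coord y (((y.sub 0).comap (y.sub 1).subtype).mkQ z) b =
      (cellCoframe c T T' y).mulVec z.1 b.1 :=
  VectorFamily.Trivialization.quot_coord_mkQ h.trivSq h.isOpen_cell midIndex_injective _ hy z b

theorem trivJ_coord_mkQ (h : IsAdaptedTriple F k p q c T T')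
    {y : Locus (tildeDeltaZero F k p q)} (hy : InChart h.chart.compl (incl F k p q y))
    (v : Fin l → ℂ) (a : {a // c a = 4}) :
    h.trivJ.coord y ((y.sub 2 ⊔ F).mkQ v) a = (cellCoframe c T T' y).mulVec v a.1 :=
  VectorFamily.Trivialization.quot_coord_mkQ (VectorFamily.Trivialization.trivial
    (G := cellFrame c T T') (H := cellCoframe c T T')
    h.isOpen_cell (fun y _ => h.cellFrame_mul_cellCoframe y)
    (fun _ hy => h.isRegularMat_cellFrame hy)
    (fun _ hy => h.isRegularMat_cellCoframe hy)) h.isOpen_cell Subtype.val_injective _ hy v a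

/-- The trivialization of `Hom(S_q / S_p, J_{pq})` in the big cell. -/
def trivHom (h : IsAdaptedTriple F k p q c T T') :
    VectorFamily.Trivialization ((quotSqSp F k p q).hom (bundleJ F k p q))
      {y | InChart h.chart.compl (incl F k p q y)} ({a // c a = 4} × {b // c b = 1}) :=
  h.trivQuot.hom h.trivJ h.isOpen_cell

theorem cellFrame_mem (h : IsAdaptedTriple F k p q c T T')
    {y : Locus (tildeDeltaZero F k p q)} (hy : InChart h.chart.compl (incl F k p q y))
    (b : {b // c b = 1}) : (cellFrame c T T' y).mulVec (Pi.single b.1 1) ∈ y.sub 1 := by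
  rw [h.sub_eq hy, mulVec_mem_frameSub (h.cellCoframe_mul_cellFrame y)]
  intro a ha
  rw [Pi.single_apply, if_neg]
  rintro rfl
  rw [b.2] at ha
  exact ha (by decide)

theorem trivQuot_ofCoord (h : IsAdaptedTriple F k p q c T T')
    {y : Locus (tildeDeltaZero F k p q)} (hy : InChart h.chart.compl (incl F k p q y))
    (b : {b // c b = 1}) : h.trivQuot.ofCoord (fun _ => Pi.single b 1) y =
      ((y.sub 0).comap (y.sub 1).subtype).mkQ
        ⟨(cellFrame c T T' y).mulVec (Pi.single b.1 1), h.cellFrame_mem hy b⟩ := by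
  refine (h.trivQuot.bijective y hy).1 (funext fun i => ?_)
  rw [h.trivQuot.coord_ofCoord _ hy]
  refine Eq.trans ?_ (h.trivQuot_coord_mkQ hy _ i).symm
  refine Eq.trans ?_ (congrFun (mulVec_mulVec_of_mul_eq_one
    (h.cellCoframe_mul_cellFrame y) (Pi.single b.1 1)) i.1).symm
  simp [Pi.single_apply, Subtype.ext_iff]

/-- A matrix entry of a homomorphism is a coordinate of the image of a frame vector, and
`cellCoframe_dMat_cellFrame` computes exactly this number. -/
theorem trivHom_coord_tangentToHom (h : IsAdaptedTriple F k p q c T T')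
    {y : Locus (tildeDeltaZero F k p q)} (hy : InChart h.chart.compl (incl F k p q y))
    (D : tangentSpace (incl F k p q y)) (i : {a // c a = 4} × {b // c b = 1}) :
    h.trivHom.coord y (tangentToHom y D) i =
      VectorFamily.tangentCoord h.chart (incl F k p q y) D (normalIndex c i) := by
  refine Eq.trans ?_ (h.cellCoframe_dMat_cellFrame hy D i)
  refine Eq.trans ?_ (h.trivJ_coord_mkQ hy _ i.1)
  refine congrArg (fun w => h.trivJ.coord y w i.1) ?_
  refine Eq.trans (congrArg (tangentToHom y D) (h.trivQuot_ofCoord hy i.2)) ?_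
  exact tangentToHom_mkQ y D hy _

end IsAdaptedTriple

/-! ### The isomorphism of bundles -/

theorem range_differential_eq_ker_tangentToHom (y : Locus (tildeDeltaZero F k p q)) :
    LinearMap.range (differential (isMorphism_incl F k p q) y) =
      LinearMap.ker (tangentToHom y) := by
  obtain ⟨c, T, T', h, hy⟩ := exists_isAdaptedTriple y
  replace hy := (h.inChart_incl_iff y).2 hy
  ext D
  -- Both sides say that the derivatives of the `(4, 1)` parameters along `D` vanish.
  rw [VectorFamily.mem_range_differential h.isCoordinateInclusion _ hy, LinearMap.mem_ker]
  refine Iff.trans ?_ (map_eq_zero_iff (h.trivHom.coord y) (h.trivHom.bijective y hy).1)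
  refine Iff.trans (forall_congr' fun i => ?_) funext_iff.symm
  rw [← h.trivHom_coord_tangentToHom hy]
  rfl

/-- The isomorphism of the normal space with `Hom(Z / W, ℂ^l / (V + F))`. -/
def normalToHom (y : Locus (tildeDeltaZero F k p q)) :
    (normalBundlePQ F k p q).Fib y →ₗ[ℂ] ((quotSqSp F k p q).hom (bundleJ F k p q)).Fib y :=
  (LinearMap.range (differential (isMorphism_incl F k p q) y)).liftQ (tangentToHom y)
    (range_differential_eq_ker_tangentToHom y).le

/-- The trivialization of the normal bundle in the big cell. -/
def IsAdaptedTriple.trivNormal {c : Fin l → Fin 5} {T T' : Matrix (Fin l) (Fin l) ℂ}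
    (h : IsAdaptedTriple F k p q c T T') :
    VectorFamily.Trivialization (normalBundlePQ F k p q)
      {y | InChart h.chart.compl (incl F k p q y)} ({a // c a = 4} × {b // c b = 1}) :=
  VectorFamily.normalTrivialization h.isCoordinateInclusion normalIndex_injective
    (isMorphism_incl F k p q)

/-- In these two trivializations the canonical map is the identity. Its bijectivity and its
compatibility with regular sections both follow from this. -/
theorem IsAdaptedTriple.trivHom_coord_normalToHom {c : Fin l → Fin 5}
    {T T' : Matrix (Fin l) (Fin l) ℂ} (h : IsAdaptedTriple F k p q c T T')
    {y : Locus (tildeDeltaZero F k p q)} (hy : InChart h.chart.compl (incl F k p q y))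
    (v : (normalBundlePQ F k p q).Fib y) :
    h.trivHom.coord y (normalToHom y v) = h.trivNormal.coord y v := by
  obtain ⟨D, rfl⟩ :=
    (LinearMap.range (differential (isMorphism_incl F k p q) y)).mkQ_surjective v
  funext i
  refine (h.trivHom_coord_tangentToHom hy D i).trans ?_
  exact (VectorFamily.normalTrivialization_coord h.isCoordinateInclusion normalIndex_injective
    (isMorphism_incl F k p q) hy D i).symm

theorem normalToHom_bijective (y : Locus (tildeDeltaZero F k p q)) :
    Function.Bijective (normalToHom y) := by
  obtain ⟨c, T, T', h, hy⟩ := exists_isAdaptedTriple y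
  replace hy := (h.inChart_incl_iff y).2 hy
  refine (Function.Bijective.of_comp_iff' (h.trivHom.bijective y hy) _).1 ?_
  have e : h.trivHom.coord y ∘ normalToHom y = h.trivNormal.coord y :=
    funext fun v => h.trivHom_coord_normalToHom hy v
  rw [e]
  exact h.trivNormal.bijective y hy

/-- The isomorphism of the normal bundle with `Hom(S_q / S_p, J_{pq})`. -/
def normalIso (F : Submodule ℂ (Fin l → ℂ)) (k p q : ℕ) : (normalBundlePQ F k p q).Iso
    ((quotSqSp F k p q).hom (bundleJ F k p q)) :=
  VectorFamily.isoOfTrivialization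
    (fun y => LinearEquiv.ofBijective (normalToHom y) (normalToHom_bijective y)) fun y => by
      obtain ⟨c, T, T', h, hy⟩ := exists_isAdaptedTriple y
      exact ⟨_, _, h.trivNormal, h.trivHom, h.isOpen_cell, (h.inChart_incl_iff y).2 hy,
        fun z hz v => h.trivHom_coord_normalToHom hz v⟩

theorem isVectorBundle_normalBundlePQ (F : Submodule ℂ (Fin l → ℂ)) (k p q : ℕ) :
    (normalBundlePQ F k p q).IsVectorBundle := by
  refine VectorFamily.isVectorBundle_of_trivialization fun y => ?_
  obtain ⟨c, T, T', h, hy⟩ := exists_isAdaptedTriple y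
  exact ⟨_, _, h.isOpen_cell, (h.inChart_incl_iff y).2 hy, inferInstance, ⟨h.trivNormal⟩⟩

theorem isVectorBundle_hom (F : Submodule ℂ (Fin l → ℂ)) (k p q : ℕ) :
    ((quotSqSp F k p q).hom (bundleJ F k p q)).IsVectorBundle := by
  refine VectorFamily.isVectorBundle_of_trivialization fun y => ?_
  obtain ⟨c, T, T', h, hy⟩ := exists_isAdaptedTriple y
  exact ⟨_, _, h.isOpen_cell, (h.inChart_incl_iff y).2 hy, inferInstance, ⟨h.trivHom⟩⟩

end Normal

end GrassmannVariety
end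

theorem proposition3p1 (i j k l : ℕ) (hi : 0 < i) (hik : i < k) (hkj : k ≤ j) (hjl : j < l)
    (hrc : k - i < l - j) (F : Submodule ℂ (Fin l → ℂ)) (hF : Module.finrank ℂ F = j)
    (p q : ℕ) (hq : 1 ≤ q) (hqp : q < p) (hp : p ≤ k - i + 1) :
    GrassmannVariety.IsSmooth (GrassmannVariety.tildeDelta F k p) ∧
    GrassmannVariety.IsSmooth (GrassmannVariety.tildeDeltaZero F k p q) ∧
    GrassmannVariety.IsSubvariety (GrassmannVariety.incl F k p q) ∧
    (GrassmannVariety.normalBundlePQ F k p q).IsVectorBundle ∧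
    ((GrassmannVariety.quotSqSp F k p q).hom
      (GrassmannVariety.bundleJ F k p q)).IsVectorBundle ∧
    Nonempty ((GrassmannVariety.normalBundlePQ F k p q).Iso
      ((GrassmannVariety.quotSqSp F k p q).hom (GrassmannVariety.bundleJ F k p q))) := by
  exact ⟨GrassmannVariety.isSmooth_tildeDelta F k p, GrassmannVariety.isSmooth_tildeDeltaZero F k p q,
    GrassmannVariety.isSubvariety_incl F k p q, GrassmannVariety.isVectorBundle_normalBundlePQ F k p q,
    GrassmannVariety.isVectorBundle_hom F k p q, ⟨GrassmannVariety.normalIso F k p q⟩⟩
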